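/- Let $\mathbb{D}=\{z\in\mathbb{C}:|z|<1\}$ and let $dA$ be Lebesgue area measure. A radial weight is a nonnegative $\omega\in L^1([0,1))$, extended to $\mathbb{D}$ by $\omega(z)=\omega(|z|)$, such that $\widehat{\omega}(r)=\int_r^1\omega(s)\,ds>0$ for all $0\le r<1$. Write $\omega\in\widehat{\mathcal{D}}$ if there is $C\ge1$ with $\widehat{\omega}(r)\le C\,\widehat{\omega}\left(\frac{1+r}{2}\right)$ for all $0\le r<1$, and $\omega\in\mathcal{D}$ if $\omega\in\widehat{\mathcal{D}}$ and in addition there are $K>1$ and $C>1$ with $\widehat{\omega}(r)\ge C\,\widehat{\omega}\left(1-\frac{1-r}{K}\right)$ for all $0\le r<1$. For $0<p<\infty$, the weighted Bergman space $A^p_\omega$ consists of the analytic functions $f$ in $\mathbb{D}$ with $\|f\|_{A^p_\omega}^p=\int_{\mathbb{D}}|f|^p\omega\,dA<\infty$. For $0<q<\infty$ and a positive Borel measure $\nu$ on $\mathbb{D}$, $L^q_\nu$ consists of the $\nu$-measurable $g:\mathbb{D}\to\mathbb{C}$ with $\|g\|_{L^q_\nu}^q=\int_{\mathbb{D}}|g|^q\,d\nu<\infty$.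 A linear operator $T$ is bounded from $A^p_\omega$ to $L^q_\nu$ if it maps $A^p_\omega$ into $L^q_\nu$ and $\|Tf\|_{L^q_\nu}\le C\|f\|_{A^p_\omega}$ for all $f\in A^p_\omega$, with a finite constant $C$ independent of $f$; it is compact if it maps $A^p_\omega$ into $L^q_\nu$ and for every bounded sequence $(f_n)$ in $A^p_\omega$ the sequence $(Tf_n)$ has a subsequence converging in $L^q_\nu$. **Proposition.** Let either $0<p<q<\infty$ and $\omega\in\widehat{\mathcal{D}}$, or $0<p=q<\infty$ and $\omega\in\mathcal{D}$. Let $\nu$ be a positive Borel measure on $\mathbb{D}$, let $\varphi$ and $\psi$ be analytic self-maps of $\mathbb{D}$, let $C_\varphi f=f\circ\varphi$ and $C_\psi f=f\circ\psi$, and let $$\delta(z)=\frac{\psi(z)-\varphi(z)}{1-\overline{\psi(z)}\,\varphi(z)},\qquad z\in\mathbb{D}.$$ If $C_\varphi-C_\psi$ is bounded (resp. compact) from $A^p_\omega$ to $L^q_\nu$, then both $\delta C_\varphi:f\mapsto\delta\cdot(f\circ\varphi)$ and $\delta C_\psi:f\mapsto\delta\cdot(f\circ\psi)$ are bounded (resp.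 compact) from $A^p_\omega$ to $L^q_\nu$. -/

import Mathlib

open MeasureTheory Set Filter Topology

noncomputable section

namespace WeightedBergman

/-- The open unit disc of the complex plane. -/
abbrev disc : Set ℂ := Metric.ball (0 : ℂ) 1

/-- The tail integral `ω̂(r) = ∫_r^1 ω(s) ds` of a function on `[0,1)`. -/
def tail (ω : ℝ → ℝ) (r : ℝ) : ℝ := ∫ s in r..1, ω s

/-- `ω` is (the profile on `[0,1)` of) a radial weight: a nonnegative function in `L¹([0,1))`,
with the standing assumption that `ω̂ > 0` on `[0,1)`. Only the values on `[0,1)` matter. -/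
structure IsRadialWeight (ω : ℝ → ℝ) : Prop where
  nonneg : ∀ r ∈ Ico (0 : ℝ) 1, 0 ≤ ω r
  integrable : IntegrableOn ω (Ico (0 : ℝ) 1)
  tail_pos : ∀ r ∈ Ico (0 : ℝ) 1, 0 < tail ω r

/-- The upper doubling class `𝒟̂`. -/
def UpperDoubling (ω : ℝ → ℝ) : Prop :=
  IsRadialWeight ω ∧
    ∃ C : ℝ, 1 ≤ C ∧ ∀ r ∈ Ico (0 : ℝ) 1, tail ω r ≤ C * tail ω ((1 + r) / 2)

/-- The lower doubling class `𝒟̌`. -/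
def LowerDoubling (ω : ℝ → ℝ) : Prop :=
  IsRadialWeight ω ∧
    ∃ K C : ℝ, 1 < K ∧ 1 < C ∧ ∀ r ∈ Ico (0 : ℝ) 1, C * tail ω (1 - (1 - r) / K) ≤ tail ω r

/-- The two-sided doubling class `𝒟 = 𝒟̂ ∩ 𝒟̌`. -/
def Doubling (ω : ℝ → ℝ) : Prop := UpperDoubling ω ∧ LowerDoubling ω

/-- The measure `ω(|z|) dA(z)` on the unit disc. -/
def weightMeasure (ω : ℝ → ℝ) : Measure ℂ :=
  (volume.restrict disc).withDensity fun z => ENNReal.ofReal (ω ‖z‖)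

/-- The `L^p` (quasi-)norm over the unit disc, `(∫_𝔻 |f|^p dμ)^{1/p}`, with values in `[0,∞]`,
for a real exponent `0 < p`. Borel measures on the disc are represented by the restrictions to the
disc of Borel measures on the plane. -/
def lpNorm (p : ℝ) (μ : Measure ℂ) (f : ℂ → ℂ) : ENNReal :=
  eLpNorm f (ENNReal.ofReal p) (μ.restrict disc)

/-- Membership in the Lebesgue space `L^p_μ` over the unit disc. -/
def MemLebesgue (p : ℝ) (μ : Measure ℂ) (f : ℂ → ℂ) : Prop :=
  MemLp f (ENNReal.ofReal p) (μ.restrict disc)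

/-- Membership in the weighted Bergman space `A^p_ω`: analytic in the unit disc and in `L^p_ω`. -/
def MemBergman (p : ℝ) (ω : ℝ → ℝ) (f : ℂ → ℂ) : Prop :=
  DifferentiableOn ℂ f disc ∧ MemLebesgue p (weightMeasure ω) f

/-- The (quasi-)norm of the weighted Bergman space `A^p_ω`. -/
def bergmanNorm (p : ℝ) (ω : ℝ → ℝ) (f : ℂ → ℂ) : ENNReal :=
  lpNorm p (weightMeasure ω) f

/-- The operator `T` is bounded from `A^p_ω` to `L^q_ν`. -/
def IsBoundedOperator (p q : ℝ) (ω : ℝ → ℝ) (ν : Measure ℂ) (T : (ℂ → ℂ) → (ℂ → ℂ)) : Prop :=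
  (∀ f, MemBergman p ω f → MemLebesgue q ν (T f)) ∧
    ∃ C : NNReal, ∀ f, MemBergman p ω f → lpNorm q ν (T f) ≤ C * bergmanNorm p ω f

/-- The operator `T` is compact from `A^p_ω` to `L^q_ν`: it maps `A^p_ω` into `L^q_ν`, and the image
of every norm-bounded sequence has a subsequence that converges in `L^q_ν`. -/
def IsCompactOp (p q : ℝ) (ω : ℝ → ℝ) (ν : Measure ℂ) (T : (ℂ → ℂ) → (ℂ → ℂ)) : Prop :=
  (∀ f, MemBergman p ω f → MemLebesgue q ν (T f)) ∧
    ∀ f : ℕ → ℂ → ℂ, (∀ n, MemBergman p ω (f n)) →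
      (∃ M : NNReal, ∀ n, bergmanNorm p ω (f n) ≤ M) →
      ∃ (g : ℂ → ℂ) (k : ℕ → ℕ), MemLebesgue q ν g ∧ StrictMono k ∧
        Tendsto (fun n => lpNorm q ν (T (f (k n)) - g)) atTop (𝓝 0)

/-- Analytic self-maps of the unit disc. -/
def IsAnalyticSelfMap (φ : ℂ → ℂ) : Prop :=
  DifferentiableOn ℂ φ disc ∧ MapsTo φ disc disc

/-- The composition operator `C_φ f = f ∘ φ`. -/
def compOp (φ : ℂ → ℂ) : (ℂ → ℂ) → (ℂ → ℂ) := fun f => f ∘ φ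

/-- The weighted composition operator `u C_φ f = u · (f ∘ φ)`. -/
def weightedCompOp (u φ : ℂ → ℂ) : (ℂ → ℂ) → (ℂ → ℂ) := fun f => u * (f ∘ φ)

/-- `δ(z) = (ψ(z) - φ(z)) / (1 - conj (ψ(z)) φ(z))`. -/
def delta (φ ψ : ℂ → ℂ) : ℂ → ℂ := fun z =>
  (ψ z - φ z) / (1 - (starRingEnd ℂ) (ψ z) * φ z)

end WeightedBergman

end

/-! Test C_φ - C_ψ on f_a(z) = ((1-|a|)/(1 - conj(a) z))^γ and on σ_a f_a, where σ_a is the disc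
automorphism exchanging a and 0. In the identity f_a(z)(σ_a(z) - σ_a(v)) = [(σ_a f_a)(z) - (σ_a
f_a)(v)] - σ_a(v)[f_a(z) - f_a(v)], taken at z = φ and v = ψ, the right side contains only the
images of the two test functions and a bounded factor. On the left, if φ lies in a region of size
comparable to 1-|a| around a, then |f_a(φ)| is bounded below and |σ_a(φ) - σ_a(ψ)| dominates |δ|,
wherever ψ may be (`norm_div_le_of_mem_nearRegion`). For γ large, upper doubling bounds the p-th
powers of the norms of both test functions by a multiple of (1-|a|) ω̂(|a|). So the image under φ of
|δ|^q ν gives such a region mass at most a constant times ((1-|a|) ω̂(|a|))^{q/p}. This is a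
Carleson condition, and a Carleson embedding theorem turns it back into boundedness of δC_φ. Only
|δ| matters, and it is symmetric in φ and ψ, so δC_ψ is covered too.

The embedding rests on the domination of |f|^t by Poisson integrals over circles of radius at least
(1+|z|)/2. Integrating in the radius against ω bounds |f(z)|^t by an average of |f|^t against a
Poisson-type kernel. The Carleson condition is moved to that kernel by averaging over centres on a
circle (`annularCarleson_of_nearRegion`), so no covering or maximal function argument is needed. For
p = q, lower doubling allows the average to be taken over a window of boundedly many dyadic annuli;
Fubini and the bounded overlap of the windows conclude (`IsProfile.lintegral_rpow_le_of_lower`). For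
p < q, the kernel satisfies a weak type estimate, because its contributions from the dyadic annuli
decay geometrically on both sides of a critical annulus; truncating |f|^{p/2} at every level, as in
Marcinkiewicz interpolation, gives the strong bound (`IsProfile.lintegral_rpow_le_of_one_lt`).

For compactness, the normalized test functions tend to zero pointwise as |a| → 1, so their images
tend to zero in norm and the Carleson condition holds with arbitrarily small constant near the unit
circle. The embedding bound is linear in the Carleson constant, so the part of the image measure
near the circle contributes little; Montel's theorem and dominated convergence handle the remaining
compact part. -/

noncomputable section

namespace WeightedBergman

/-! ### Subharmonicity of |f|^t through the Poisson integral -/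

/-- Real parts of entire functions are uniformly dense in the continuous functions on a circle. -/
theorem exists_differentiable_re_approx {R : ℝ} (hR : 0 < R) {φ : ℂ → ℝ}
    (hφ : ContinuousOn φ (Metric.sphere 0 R)) {η : ℝ} (hη : 0 < η) :
    ∃ Q : ℂ → ℂ, Differentiable ℂ Q ∧ ∀ z ∈ Metric.sphere (0 : ℂ) R, |φ z - (Q z).re| ≤ η := by
  have : Fact (0 < 2 * Real.pi) := ⟨Real.two_pi_pos⟩
  let e : AddCircle (2 * Real.pi) → ℂ := fun x => R * (AddCircle.toCircle x : ℂ)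
  have he : Continuous e := by
    refine continuous_const.mul ?_
    exact continuous_subtype_val.comp AddCircle.continuous_toCircle
  have hes : ∀ x, e x ∈ Metric.sphere (0 : ℂ) R := by
    intro x
    simp only [e, mem_sphere_zero_iff_norm, norm_mul, Complex.norm_real, Circle.norm_coe, mul_one,
      Real.norm_eq_abs, abs_of_pos hR]
  have hsurj : ∀ z ∈ Metric.sphere (0 : ℂ) R, ∃ x, e x = z := by
    intro z hz
    refine ⟨((Complex.arg z : ℝ) : AddCircle (2 * Real.pi)), ?_⟩
    have hz' : ‖z‖ = R := by simpa using hz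
    simp only [e]
    rw [AddCircle.toCircle_apply_mk]
    have : (2 * Real.pi) / (2 * Real.pi) = 1 := div_self (by positivity)
    rw [this, one_mul, Circle.coe_exp, ← hz']
    exact Complex.norm_mul_exp_arg_mul_I z
  let F : C(AddCircle (2 * Real.pi), ℂ) :=
    ⟨fun x => ((φ (e x) : ℝ) : ℂ), Complex.continuous_ofReal.comp
      (hφ.comp_continuous he hes)⟩
  -- The multiplier c is quantified inside the induction because taking real parts is only real
  -- linear, while the span is complex.
  have key : ∀ L ∈ Submodule.span ℂ (range (@fourier (2 * Real.pi))),
      ∀ c : ℂ, ∃ Q : ℂ → ℂ, Differentiable ℂ Q ∧ ∀ x, (c * L x).re = (Q (e x)).re := by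
    intro L hL
    induction hL using Submodule.span_induction with
    | mem L hL =>
      obtain ⟨n, rfl⟩ := hL
      intro c
      have hpow : ∀ x : AddCircle (2 * Real.pi), fourier n x = (AddCircle.toCircle x : ℂ) ^ n := by
        intro x
        rw [fourier_apply, AddCircle.toCircle_zsmul]
        simp
      have hdiv : ∀ x : AddCircle (2 * Real.pi), e x / R = (AddCircle.toCircle x : ℂ) := by
        intro x
        have : (R : ℂ) ≠ 0 := by exact_mod_cast hR.ne'
        simp only [e]
        field_simp
      rcases le_total 0 n with hn | hn
      · lift n to ℕ using hn
        refine ⟨fun z => c * (z / R) ^ n, by fun_prop, fun x => ?_⟩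
        simp only [hpow, hdiv, zpow_natCast]
      · obtain ⟨m, rfl⟩ : ∃ m : ℕ, n = -(m : ℤ) := ⟨n.natAbs, by omega⟩
        -- On the unit circle inversion is conjugation, so a negative frequency has the same real
        -- part as the conjugate monomial, which is entire.
        refine ⟨fun z => (starRingEnd ℂ) c * (z / R) ^ m, by fun_prop, fun x => ?_⟩
        simp only [hpow, hdiv]
        rw [zpow_neg, zpow_natCast, ← inv_pow, ← Circle.coe_inv, Circle.coe_inv_eq_conj,
          ← map_pow]
        rw [← Complex.conj_re]
        simp
    | zero => intro c; exact ⟨fun _ => 0, by fun_prop, by simp⟩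
    | add L₁ L₂ _ _ h₁ h₂ =>
      intro c
      obtain ⟨Q₁, hQ₁, h₁⟩ := h₁ c
      obtain ⟨Q₂, hQ₂, h₂⟩ := h₂ c
      refine ⟨fun z => Q₁ z + Q₂ z, by fun_prop, fun x => ?_⟩
      simp only [ContinuousMap.add_apply, mul_add, Complex.add_re, h₁, h₂]
    | smul a L _ h =>
      intro c
      obtain ⟨Q, hQ, h⟩ := h (c * a)
      exact ⟨Q, hQ, fun x => by rw [← h, ContinuousMap.smul_apply, smul_eq_mul, mul_assoc]⟩
  have hF : F ∈ (Submodule.span ℂ (range (@fourier (2 * Real.pi)))).topologicalClosure := by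
    rw [span_fourier_closure_eq_top]; trivial
  rw [← SetLike.mem_coe, Submodule.topologicalClosure_coe, Metric.mem_closure_iff] at hF
  obtain ⟨L, hL, hFL⟩ := hF η hη
  obtain ⟨Q, hQ, h⟩ := key L hL 1
  refine ⟨Q, hQ, fun z hz => ?_⟩
  obtain ⟨x, rfl⟩ := hsurj z hz
  rw [← h, one_mul]
  have h1 : dist (F x) (L x) ≤ η := (ContinuousMap.dist_apply_le_dist x).trans hFL.le
  rw [dist_eq_norm] at h1
  have h2 := (Complex.abs_re_le_norm (F x - L x)).trans h1
  simpa [F] using h2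

/-- Subharmonicity of `|f|^t`, in the form of domination by the Poisson integral. -/
theorem norm_rpow_le_circleAverage_poissonKernel {R : ℝ} {f : ℂ → ℂ}
    (hf : DiffContOnCl ℂ f (Metric.ball 0 R)) {z : ℂ} (hz : z ∈ Metric.ball (0 : ℂ) R)
    {t : ℝ} (ht : 0 < t) :
    ‖f z‖ ^ t ≤ Real.circleAverage (fun ζ => poissonKernel 0 z ζ * ‖f ζ‖ ^ t) 0 R := by
  have hR : 0 < R := Metric.pos_of_mem_ball hz
  have hcl : closure (Metric.ball (0 : ℂ) R) = Metric.closedBall 0 R := closure_ball _ hR.ne'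
  have hfs : ContinuousOn f (Metric.sphere 0 R) := by
    refine hf.continuousOn.mono ?_
    rw [hcl]; exact Metric.sphere_subset_closedBall
  have hne : ∀ ζ ∈ Metric.sphere (0 : ℂ) R, ‖ζ - z‖ ≠ 0 := by
    intro ζ hζ h0
    rw [norm_eq_zero, sub_eq_zero] at h0
    subst h0
    simp at hζ hz
    linarith
  have hPc : ContinuousOn (poissonKernel 0 z) (Metric.sphere 0 R) := by
    unfold poissonKernel
    simp only [sub_zero]
    refine ContinuousOn.div (by fun_prop) (by fun_prop) fun ζ hζ => pow_ne_zero 2 (hne ζ hζ)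
  have hP0 : ∀ ζ ∈ Metric.sphere (0 : ℂ) R, 0 ≤ poissonKernel 0 z ζ := by
    intro ζ hζ
    unfold poissonKernel
    have h1 : ‖ζ‖ = R := by simpa using hζ
    have h2 : ‖z‖ < R := by simpa using hz
    simp only [sub_zero, h1]
    have : ‖z‖ ^ 2 ≤ R ^ 2 := by gcongr
    exact div_nonneg (by linarith) (by positivity)
  have hci : ∀ {g : ℂ → ℝ}, ContinuousOn g (Metric.sphere 0 R) → CircleIntegrable g 0 R :=
    fun h => h.circleIntegrable hR.le
  have hft : ContinuousOn (fun ζ => ‖f ζ‖ ^ t) (Metric.sphere 0 R) :=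
    hfs.norm.rpow_const fun _ _ => Or.inr ht.le
  set A := Real.circleAverage (fun ζ => poissonKernel 0 z ζ * ‖f ζ‖ ^ t) 0 R with hA
  set B := Real.circleAverage (poissonKernel 0 z) 0 R with hB
  -- Let Re Q approximate log max(|f|, ε) on the circle. The maximum principle for f e^{-Q} gives
  -- |f| ≤ e^{ε + Re Q} inside; the Poisson formula for the holomorphic e^{tQ} then returns to
  -- boundary values. Zeros of f need no separate treatment, and each passage costs a factor e^{tε}.
  have main : ∀ ε : ℝ, 0 < ε → ‖f z‖ ^ t ≤ Real.exp (2 * t * ε) * (A + ε ^ t * B) := by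
    intro ε hε
    have hφ : ContinuousOn (fun ζ => Real.log (max ‖f ζ‖ ε)) (Metric.sphere 0 R) := by
      refine ContinuousOn.log (ContinuousOn.sup hfs.norm continuousOn_const) fun ζ _ => ?_
      exact (lt_max_of_lt_right hε).ne'
    obtain ⟨Q, hQ, hQa⟩ := exists_differentiable_re_approx hR hφ hε
    have hmaxpos : ∀ ζ, 0 < max ‖f ζ‖ ε := fun ζ => lt_max_of_lt_right hε
    have h1 : ‖f z * Complex.exp (-Q z)‖ ≤ Real.exp ε := by
      refine Complex.norm_le_of_forall_mem_frontier_norm_le (U := Metric.ball (0 : ℂ) R)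
        (f := fun z => f z * Complex.exp (-Q z)) Metric.isBounded_ball ?_ ?_ (subset_closure hz)
      · exact DiffContOnCl.smul (c := f) (f := fun z => Complex.exp (-Q z)) hf
          (by fun_prop : Differentiable ℂ fun z => Complex.exp (-Q z)).diffContOnCl
      · intro ζ hζ
        rw [frontier_ball _ hR.ne'] at hζ
        rw [norm_mul, Complex.norm_exp, Complex.neg_re]
        have h2 := (abs_le.1 (hQa ζ hζ)).2
        have h3 : ‖f ζ‖ ≤ Real.exp (Real.log (max ‖f ζ‖ ε)) := by
          rw [Real.exp_log (hmaxpos ζ)]; exact le_max_left _ _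
        calc ‖f ζ‖ * Real.exp (-(Q ζ).re)
            ≤ Real.exp (Real.log (max ‖f ζ‖ ε)) * Real.exp (-(Q ζ).re) := by gcongr
          _ = Real.exp (Real.log (max ‖f ζ‖ ε) - (Q ζ).re) := by rw [← Real.exp_add]; ring_nf
          _ ≤ Real.exp ε := Real.exp_le_exp.2 h2
    have h2 : ‖f z‖ ≤ Real.exp (ε + (Q z).re) := by
      rw [norm_mul, Complex.norm_exp, Complex.neg_re, Real.exp_neg, ← div_eq_mul_inv,
        div_le_iff₀ (Real.exp_pos _)] at h1
      rwa [Real.exp_add]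
    have h3 : ‖f z‖ ^ t ≤ Real.exp (t * ε) * Real.exp (t * (Q z).re) := by
      calc ‖f z‖ ^ t ≤ (Real.exp (ε + (Q z).re)) ^ t := by gcongr
        _ = _ := by rw [← Real.exp_mul, ← Real.exp_add]; ring_nf
    have hE : Differentiable ℂ fun ζ => Complex.exp (t * Q ζ) := by fun_prop
    have hnE : ∀ ζ, ‖Complex.exp (t * Q ζ)‖ = Real.exp (t * (Q ζ).re) := by
      intro ζ; rw [Complex.norm_exp]; simp
    have h4 : Real.exp (t * (Q z).re)
        ≤ Real.circleAverage (fun ζ => poissonKernel 0 z ζ * Real.exp (t * (Q ζ).re)) 0 R := by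
      have hp := (hE.diffContOnCl (s := Metric.ball 0 R)).circleAverage_poissonKernel_smul hz
      rw [← hnE, ← hp, Real.circleAverage_def, Real.circleAverage_def, norm_smul, smul_eq_mul,
        Real.norm_of_nonneg (by positivity)]
      refine mul_le_mul_of_nonneg_left ?_ (by positivity)
      refine (intervalIntegral.norm_integral_le_integral_norm Real.two_pi_pos.le).trans ?_
      refine le_of_eq (intervalIntegral.integral_congr fun θ _ => ?_)
      simp only [Pi.smul_apply', norm_smul, hnE]
      rw [Real.norm_of_nonneg (hP0 _ (circleMap_mem_sphere 0 hR.le θ))]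
    have hQc : Continuous fun ζ => Real.exp (t * (Q ζ).re) :=
      Real.continuous_exp.comp (continuous_const.mul (Complex.continuous_re.comp hQ.continuous))
    have h5 : Real.circleAverage (fun ζ => poissonKernel 0 z ζ * Real.exp (t * (Q ζ).re)) 0 R
        ≤ Real.circleAverage (fun ζ => Real.exp (t * ε) * (poissonKernel 0 z ζ * ‖f ζ‖ ^ t
          + ε ^ t * poissonKernel 0 z ζ)) 0 R := by
      refine Real.circleAverage_mono (hci (hPc.mul hQc.continuousOn))
        (hci (continuousOn_const.mul ((hPc.mul hft).add (continuousOn_const.mul hPc)))) ?_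
      intro ζ hζ
      rw [abs_of_pos hR] at hζ
      have h6 := (abs_le.1 (hQa ζ hζ)).1
      have h7 : Real.exp (t * (Q ζ).re) ≤ Real.exp (t * ε) * (‖f ζ‖ ^ t + ε ^ t) := by
        calc Real.exp (t * (Q ζ).re) ≤ Real.exp (t * ε + Real.log (max ‖f ζ‖ ε) * t) := by
              apply Real.exp_le_exp.2; nlinarith
          _ = Real.exp (t * ε) * (max ‖f ζ‖ ε) ^ t := by
              rw [Real.exp_add, Real.rpow_def_of_pos (hmaxpos ζ)]
          _ ≤ _ := by
              gcongr
              have := Real.rpow_nonneg (norm_nonneg (f ζ)) t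
              have := Real.rpow_nonneg hε.le t
              rcases max_choice ‖f ζ‖ ε with h | h <;> rw [h] <;> linarith
      calc poissonKernel 0 z ζ * Real.exp (t * (Q ζ).re)
          ≤ poissonKernel 0 z ζ * (Real.exp (t * ε) * (‖f ζ‖ ^ t + ε ^ t)) :=
            mul_le_mul_of_nonneg_left h7 (hP0 ζ hζ)
        _ = _ := by ring
    have h6 : Real.circleAverage (fun ζ => Real.exp (t * ε) * (poissonKernel 0 z ζ * ‖f ζ‖ ^ t
          + ε ^ t * poissonKernel 0 z ζ)) 0 R = Real.exp (t * ε) * (A + ε ^ t * B) := by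
      have e1 := Real.circleAverage_fun_smul (a := Real.exp (t * ε)) (c := (0 : ℂ)) (R := R)
        (f := fun ζ => poissonKernel 0 z ζ * ‖f ζ‖ ^ t + ε ^ t * poissonKernel 0 z ζ)
      have e2 := Real.circleAverage_fun_add (c := (0 : ℂ)) (R := R)
        (hci (hPc.mul hft)) (hci (continuousOn_const (c := ε ^ t) |>.mul hPc))
      have e3 := Real.circleAverage_fun_smul (a := ε ^ t) (c := (0 : ℂ)) (R := R)
        (f := poissonKernel 0 z)
      simp only [smul_eq_mul] at e1 e3
      rw [e1]
      congr 1
      exact e2.trans (congrArg₂ (· + ·) rfl e3)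
    calc ‖f z‖ ^ t ≤ Real.exp (t * ε) * Real.exp (t * (Q z).re) := h3
      _ ≤ Real.exp (t * ε) * (Real.exp (t * ε) * (A + ε ^ t * B)) := by
          gcongr; exact h4.trans (h5.trans_eq h6)
      _ = _ := by rw [← mul_assoc, ← Real.exp_add]; ring_nf
  have hlim : Tendsto (fun ε : ℝ => Real.exp (2 * t * ε) * (A + ε ^ t * B)) (𝓝[>] 0) (𝓝 A) := by
    have hc : Continuous fun ε : ℝ => Real.exp (2 * t * ε) * (A + ε ^ t * B) := by
      have := Real.continuous_rpow_const ht.le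
      fun_prop
    have := (hc.tendsto 0).mono_left (nhdsWithin_le_nhds (s := Ioi 0))
    simpa [Real.zero_rpow ht.ne'] using this
  exact ge_of_tendsto hlim (eventually_mem_nhdsWithin.mono fun ε hε => main ε hε)

/-- Circle averages of nonnegative continuous functions as lower integrals over `(-π, π)`. -/
theorem ofReal_circleAverage_eq_lintegral {R : ℝ} (hR : 0 ≤ R) {g : ℂ → ℝ}
    (hg : ContinuousOn g (Metric.sphere 0 R)) (h0 : ∀ ζ ∈ Metric.sphere (0 : ℂ) R, 0 ≤ g ζ) :
    ENNReal.ofReal (2 * Real.pi * Real.circleAverage g 0 R) =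
      ∫⁻ θ in Ioo (-Real.pi) Real.pi, ENNReal.ofReal (g (R * Complex.exp (θ * Complex.I))) := by
  have hmem : ∀ θ : ℝ, (R * Complex.exp (θ * Complex.I) : ℂ) ∈ Metric.sphere (0 : ℂ) R := by
    intro θ; simp [abs_of_nonneg hR]
  have hc : Continuous fun θ : ℝ => g (R * Complex.exp (θ * Complex.I)) :=
    hg.comp_continuous (by fun_prop) hmem
  have h1 : 2 * Real.pi * Real.circleAverage g 0 R
      = ∫ θ in Ioo (-Real.pi) Real.pi, g (R * Complex.exp (θ * Complex.I)) := by
    rw [Real.circleAverage_eq_integral_add (-Real.pi), smul_eq_mul,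
      mul_inv_cancel_left₀ Real.two_pi_pos.ne',
      intervalIntegral.integral_comp_add_right (fun θ => g (circleMap 0 R θ)),
      intervalIntegral.integral_of_le (by linarith [Real.pi_pos]), integral_Ioc_eq_integral_Ioo]
    rw [show 0 + -Real.pi = -Real.pi by ring, show 2 * Real.pi + -Real.pi = Real.pi by ring]
    simp [circleMap]
  rw [h1]
  refine ofReal_integral_eq_lintegral_ofReal ?_ ?_
  · exact (hc.integrableOn_Icc (a := -Real.pi) (b := Real.pi)).mono_set Ioo_subset_Icc_self
  · exact Eventually.of_forall fun θ => h0 _ (hmem θ)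

/-! ### The Poisson-type kernel on circles -/

/-- The Poisson-type kernel `(1 - |z|) / |1 - conj z ζ|²`. -/
def kernelFun (z ζ : ℂ) : ℝ := (1 - ‖z‖) / ‖1 - (starRingEnd ℂ) z * ζ‖ ^ 2

theorem norm_one_sub_conj_mul_comm (z ζ : ℂ) :
    ‖1 - (starRingEnd ℂ) z * ζ‖ = ‖1 - (starRingEnd ℂ) ζ * z‖ := by
  rw [← Complex.norm_conj]
  simp [mul_comm]

theorem one_sub_norm_mul_le (z ζ : ℂ) : 1 - ‖z‖ * ‖ζ‖ ≤ ‖1 - (starRingEnd ℂ) z * ζ‖ := by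
  have := norm_sub_norm_le (1 : ℂ) ((starRingEnd ℂ) z * ζ)
  simpa using this

theorem one_sub_norm_le {z ζ : ℂ} (hζ : ‖ζ‖ ≤ 1) :
    1 - ‖z‖ ≤ ‖1 - (starRingEnd ℂ) z * ζ‖ := by
  refine le_trans ?_ (one_sub_norm_mul_le z ζ)
  have := mul_le_of_le_one_right (norm_nonneg z) hζ
  linarith

theorem norm_one_sub_conj_mul_pos {z ζ : ℂ} (hz : ‖z‖ < 1) (hζ : ‖ζ‖ ≤ 1) :
    0 < ‖1 - (starRingEnd ℂ) z * ζ‖ := lt_of_lt_of_le (by linarith) (one_sub_norm_le hζ)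

/-- The integral of the Poisson-type kernel over a circle. -/
theorem lintegral_inv_norm_sq_le {z : ℂ} {r : ℝ} (hr : 0 ≤ r) (hr1 : r ≤ 1) (hz : ‖z‖ < 1) :
    ∫⁻ θ in Ioo (-Real.pi) Real.pi,
      ENNReal.ofReal (1 / ‖1 - (starRingEnd ℂ) z * (r * Complex.exp (θ * Complex.I))‖ ^ 2)
      ≤ ENNReal.ofReal (2 * Real.pi / (1 - ‖z‖ * r)) := by
  -- The radius is moved from the circle to the point: |1 - conj(z) r e^{iθ}| = |e^{iθ} - rz|, so
  -- the integrand is the Poisson kernel of the unit disc at rz divided by 1 - |rz|².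
  set w : ℂ := z * r with hw
  have hwn : ‖w‖ = ‖z‖ * r := by simp [hw, abs_of_nonneg hr]
  have hwz : ‖w‖ ≤ ‖z‖ := by rw [hwn]; exact mul_le_of_le_one_right (norm_nonneg z) hr1
  have hw1 : ‖w‖ < 1 := hwz.trans_lt hz
  have hwb : w ∈ Metric.ball (0 : ℂ) 1 := by simpa using hw1
  have hne : ∀ ζ ∈ Metric.sphere (0 : ℂ) 1, ‖ζ - w‖ ≠ 0 := by
    intro ζ hζ h0
    rw [norm_eq_zero, sub_eq_zero] at h0
    subst h0
    simp at hζ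
    linarith
  have hPc : ContinuousOn (poissonKernel 0 w) (Metric.sphere 0 1) := by
    unfold poissonKernel
    simp only [sub_zero]
    exact ContinuousOn.div (by fun_prop) (by fun_prop) fun ζ hζ => pow_ne_zero 2 (hne ζ hζ)
  have hsq : 0 < 1 - ‖w‖ ^ 2 := by nlinarith [norm_nonneg w]
  have hP : ∀ ζ ∈ Metric.sphere (0 : ℂ) 1, poissonKernel 0 w ζ = (1 - ‖w‖ ^ 2) / ‖ζ - w‖ ^ 2 := by
    intro ζ hζ
    have : ‖ζ‖ = 1 := by simpa using hζ
    simp [poissonKernel, this]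
  have hP1 : Real.circleAverage (poissonKernel 0 w) 0 1 = 1 := by
    have := InnerProductSpace.HarmonicContOnCl.circleAverage_poissonKernel_smul
      (f := fun _ => (1 : ℝ)) (c := 0) (R := 1) (w := w) ⟨fun x _ => ?_, continuousOn_const⟩ hwb
    · convert this using 2
      ext; simp
    · exact InnerProductSpace.harmonicAt_const 1
  have h := ofReal_circleAverage_eq_lintegral zero_le_one hPc
    (fun ζ hζ => by rw [hP ζ hζ]; positivity)
  rw [hP1, mul_one] at h
  have hpt : ∀ θ : ℝ, ENNReal.ofReal
      (1 / ‖1 - (starRingEnd ℂ) z * (r * Complex.exp (θ * Complex.I))‖ ^ 2)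
      = ENNReal.ofReal (1 / (1 - ‖w‖ ^ 2)) *
        ENNReal.ofReal (poissonKernel 0 w ((1 : ℝ) * Complex.exp (θ * Complex.I))) := by
    intro θ
    have hs : ((1 : ℝ) * Complex.exp (θ * Complex.I) : ℂ) ∈ Metric.sphere (0 : ℂ) 1 := by simp
    rw [hP _ hs, ← ENNReal.ofReal_mul (by positivity)]
    congr 1
    have e1 : ‖1 - (starRingEnd ℂ) z * (r * Complex.exp (θ * Complex.I))‖
        = ‖((1 : ℝ) : ℂ) * Complex.exp (θ * Complex.I) - w‖ := by
      rw [norm_one_sub_conj_mul_comm, map_mul, Complex.conj_ofReal, ← Complex.exp_conj]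
      have e2 : ((1 : ℝ) : ℂ) * Complex.exp (θ * Complex.I) - w = Complex.exp (θ * Complex.I) *
          (1 - r * Complex.exp ((starRingEnd ℂ) (θ * Complex.I)) * z) := by
        rw [mul_sub, ← mul_assoc, mul_left_comm _ (r : ℂ), ← Complex.exp_add]
        simp [hw, mul_comm]
      rw [e2, norm_mul, Complex.norm_exp_ofReal_mul_I, one_mul]
    rw [e1]
    field_simp
  simp_rw [hpt]
  rw [lintegral_const_mul' _ _ ENNReal.ofReal_ne_top, ← h, ← ENNReal.ofReal_mul (by positivity)]
  apply ENNReal.ofReal_le_ofReal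
  rw [one_div, inv_mul_eq_div]
  rw [← hwn]
  have : 0 < 1 - ‖w‖ := by linarith
  apply div_le_div_of_nonneg_left Real.two_pi_pos.le this
  nlinarith [norm_nonneg w]

/-- Since ρ ≥ (1+|z|)/2, points ζ of the circle satisfy |ζ - z| ≥ (1-|z|)/2. Hence |1 - conj(z) ζ| ≤
5|ζ - z|, and the Poisson kernel of the disc of radius ρ is at most 50 times `kernelFun z`, a kernel
whose form no longer depends on ρ. -/
theorem enorm_rpow_le_lintegral_circle {f : ℂ → ℂ} (hf : DifferentiableOn ℂ f disc) {z : ℂ}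
    (hz : ‖z‖ < 1) {ρ : ℝ} (hρ : (1 + ‖z‖) / 2 ≤ ρ) (hρ1 : ρ < 1) {t : ℝ} (ht : 0 < t) :
    ‖f z‖ₑ ^ t ≤ 8 * ∫⁻ θ in Ioo (-Real.pi) Real.pi,
      ENNReal.ofReal (kernelFun z (ρ * Complex.exp (θ * Complex.I))) *
        ‖f (ρ * Complex.exp (θ * Complex.I))‖ₑ ^ t := by
  have hz0 := norm_nonneg z
  have hzρ : ‖z‖ < ρ := by linarith
  have hρ0 : 0 < ρ := by linarith
  have hzb : z ∈ Metric.ball (0 : ℂ) ρ := by simpa using hzρ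
  have hcl : closure (Metric.ball (0 : ℂ) ρ) ⊆ disc := by
    rw [closure_ball _ hρ0.ne']; exact Metric.closedBall_subset_ball hρ1
  have hfd : DiffContOnCl ℂ f (Metric.ball 0 ρ) := DifferentiableOn.diffContOnCl (hf.mono hcl)
  have hfs : ContinuousOn f (Metric.sphere 0 ρ) :=
    hf.continuousOn.mono (Metric.sphere_subset_closedBall.trans
      (Metric.closedBall_subset_ball hρ1))
  have hs1 : ∀ ζ ∈ Metric.sphere (0 : ℂ) ρ, ‖ζ‖ ≤ 1 := by
    intro ζ hζ
    have : ‖ζ‖ = ρ := by simpa using hζ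
    linarith
  have hkpos : ∀ ζ ∈ Metric.sphere (0 : ℂ) ρ, 0 ≤ kernelFun z ζ := fun ζ hζ =>
    div_nonneg (by linarith) (by positivity)
  have hkc : ContinuousOn (kernelFun z) (Metric.sphere 0 ρ) := by
    unfold kernelFun
    refine ContinuousOn.div (by fun_prop) (by fun_prop) fun ζ hζ => ?_
    exact pow_ne_zero 2 (norm_one_sub_conj_mul_pos hz (hs1 ζ hζ)).ne'
  have hft : ContinuousOn (fun ζ => ‖f ζ‖ ^ t) (Metric.sphere 0 ρ) :=
    hfs.norm.rpow_const fun _ _ => Or.inr ht.le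
  have hzs : ∀ ζ ∈ Metric.sphere (0 : ℂ) ρ, (1 - ‖z‖) / 2 ≤ ‖ζ - z‖ := by
    intro ζ hζ
    have h1 : ‖ζ‖ = ρ := by simpa using hζ
    have h2 := norm_sub_norm_le ζ z
    linarith
  have hPk : ∀ ζ ∈ Metric.sphere (0 : ℂ) ρ, poissonKernel 0 z ζ ≤ 50 * kernelFun z ζ := by
    intro ζ hζ
    have h1 : ‖ζ‖ = ρ := by simpa using hζ
    have h2 := hzs ζ hζ
    have h3 : ‖1 - (starRingEnd ℂ) z * ζ‖ ≤ 5 * ‖ζ - z‖ := by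
      have e : 1 - (starRingEnd ℂ) z * ζ
          = ((1 - ‖z‖ ^ 2 : ℝ) : ℂ) - (starRingEnd ℂ) z * (ζ - z) := by
        have := Complex.conj_mul' z
        push_cast
        rw [← this]; ring
      rw [e]
      refine (norm_sub_le _ _).trans ?_
      rw [Complex.norm_real, Real.norm_of_nonneg (by nlinarith), norm_mul, Complex.norm_conj]
      have := norm_nonneg (ζ - z)
      nlinarith
    have h4 := norm_one_sub_conj_mul_pos hz (hs1 ζ hζ)
    have h5 : 0 < ‖ζ - z‖ := by linarith
    unfold poissonKernel kernelFun
    simp only [sub_zero, h1]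
    rw [← mul_div_assoc, div_le_div_iff₀ (by positivity) (by positivity)]
    have h6 : ‖1 - (starRingEnd ℂ) z * ζ‖ ^ 2 ≤ 25 * ‖ζ - z‖ ^ 2 := by
      calc _ ≤ (5 * ‖ζ - z‖) ^ 2 := by gcongr
        _ = _ := by ring
    have h7 : ρ ^ 2 - ‖z‖ ^ 2 ≤ 2 * (1 - ‖z‖) := by nlinarith
    calc (ρ ^ 2 - ‖z‖ ^ 2) * ‖1 - (starRingEnd ℂ) z * ζ‖ ^ 2
        ≤ (2 * (1 - ‖z‖)) * (25 * ‖ζ - z‖ ^ 2) := by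
          gcongr
      _ = _ := by ring
  have hne : ∀ ζ ∈ Metric.sphere (0 : ℂ) ρ, ‖ζ - z‖ ^ 2 ≠ 0 := fun ζ hζ =>
    pow_ne_zero 2 (by linarith [hzs ζ hζ] : (0 : ℝ) < ‖ζ - z‖).ne'
  have hPc : ContinuousOn (poissonKernel 0 z) (Metric.sphere 0 ρ) := by
    unfold poissonKernel
    simp only [sub_zero]
    exact ContinuousOn.div (by fun_prop) (by fun_prop) hne
  have h := norm_rpow_le_circleAverage_poissonKernel hfd hzb ht
  have h2 : Real.circleAverage (fun ζ => poissonKernel 0 z ζ * ‖f ζ‖ ^ t) 0 ρ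
      ≤ 50 * Real.circleAverage (fun ζ => kernelFun z ζ * ‖f ζ‖ ^ t) 0 ρ := by
    have e1 := Real.circleAverage_fun_smul (a := (50 : ℝ)) (c := (0 : ℂ)) (R := ρ)
      (f := fun ζ => kernelFun z ζ * ‖f ζ‖ ^ t)
    simp only [smul_eq_mul] at e1
    rw [← e1]
    refine Real.circleAverage_mono ((hPc.mul hft).circleIntegrable hρ0.le)
      ((continuousOn_const.mul (hkc.mul hft)).circleIntegrable hρ0.le) fun ζ hζ => ?_
    rw [abs_of_pos hρ0] at hζ
    simp only [← mul_assoc]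
    exact mul_le_mul_of_nonneg_right (hPk ζ hζ) (by positivity)
  have h3 := ofReal_circleAverage_eq_lintegral hρ0.le (hkc.mul hft)
    (fun ζ hζ => mul_nonneg (hkpos ζ hζ) (by positivity))
  -- The factor 8 in the conclusion comes from 50/(2π) < 8.
  have hpi := Real.pi_gt_d2
  set A := Real.circleAverage (fun ζ => kernelFun z ζ * ‖f ζ‖ ^ t) 0 ρ with hA
  have hA' : Real.circleAverage (kernelFun z * fun ζ => ‖f ζ‖ ^ t) 0 ρ = A := rfl
  have hen : ∀ x : ℂ, ‖x‖ₑ ^ t = ENNReal.ofReal (‖x‖ ^ t) := fun x => by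
    rw [← ofReal_norm, ENNReal.ofReal_rpow_of_nonneg (norm_nonneg x) ht.le]
  have hA0 : 0 ≤ A := by
    have := Real.rpow_nonneg (norm_nonneg (f z)) t
    linarith
  have h4 : ∫⁻ θ in Ioo (-Real.pi) Real.pi,
      ENNReal.ofReal (kernelFun z (ρ * Complex.exp (θ * Complex.I))) *
        ‖f (ρ * Complex.exp (θ * Complex.I))‖ₑ ^ t = ENNReal.ofReal (2 * Real.pi * A) := by
    rw [← hA', h3]
    refine lintegral_congr fun θ => ?_
    have hm : (ρ * Complex.exp (θ * Complex.I) : ℂ) ∈ Metric.sphere (0 : ℂ) ρ := by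
      simp [abs_of_pos hρ0]
    rw [hen, ← ENNReal.ofReal_mul (hkpos _ hm)]
    rfl
  rw [h4, hen, show (8 : ENNReal) = ENNReal.ofReal 8 by simp,
    ← ENNReal.ofReal_mul (by norm_num)]
  apply ENNReal.ofReal_le_ofReal
  nlinarith

/-! ### Doubling radial profiles and growth of Bergman functions -/

open scoped ENNReal

/-- The mass of the profile `w` on `[r, ∞)`. -/
def tailMass (w : ℝ → ℝ≥0∞) (r : ℝ) : ℝ≥0∞ := ∫⁻ s in Ici r, w s

/-- The rotation invariant measure with density `w(|z|)`. -/
def radialMeasure (w : ℝ → ℝ≥0∞) : Measure ℂ := volume.withDensity fun z => w ‖z‖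

/-- A measurable radial profile on `[0,1)` whose tail integrals are doubling with constant `D`. -/
structure IsProfile (w : ℝ → ℝ≥0∞) (D : ℝ≥0∞) : Prop where
  measurable : Measurable w
  eq_zero : ∀ r, r ∉ Ico (0 : ℝ) 1 → w r = 0
  const_ne_top : D ≠ ⊤
  finite : tailMass w 0 ≠ ⊤
  pos : ∀ r < 1, tailMass w r ≠ 0
  doubling : ∀ r < 1, tailMass w r ≤ D * tailMass w ((1 + r) / 2)

theorem tailMass_antitone (w : ℝ → ℝ≥0∞) : Antitone (tailMass w) := fun _ _ h =>
  lintegral_mono_set (Ici_subset_Ici.2 h)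

variable {w : ℝ → ℝ≥0∞} {D : ℝ≥0∞}

theorem IsProfile.tailMass_le (hw : IsProfile w D) (r : ℝ) : tailMass w r ≤ tailMass w 0 := by
  rcases le_total 0 r with h | h
  · exact tailMass_antitone w h
  · unfold tailMass
    rw [← lintegral_indicator measurableSet_Ici, ← lintegral_indicator measurableSet_Ici]
    refine lintegral_mono fun s => ?_
    by_cases hs : s ∈ Ico (0 : ℝ) 1
    · rw [indicator_of_mem (show s ∈ Ici (0 : ℝ) from hs.1)]
      exact indicator_le_self _ _ _
    · have := hw.eq_zero s hs
      simp [indicator, this]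

theorem IsProfile.tailMass_ne_top (hw : IsProfile w D) (r : ℝ) : tailMass w r ≠ ⊤ :=
  ne_top_of_le_ne_top hw.finite (hw.tailMass_le r)

theorem IsProfile.doubling_pow (hw : IsProfile w D) {h : ℝ} (hh : 0 < h) (k : ℕ) :
    tailMass w (1 - 2 ^ k * h) ≤ D ^ k * tailMass w (1 - h) := by
  induction k with
  | zero => simp
  | succ k ih =>
    calc tailMass w (1 - 2 ^ (k + 1) * h) ≤ D * tailMass w (1 - 2 ^ k * h) := by
          have := hw.doubling (1 - 2 ^ (k + 1) * h) (by have : 0 < 2 ^ (k + 1) * h := by positivity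
                                                        linarith)
          convert this using 3
          ring
      _ ≤ D * (D ^ k * tailMass w (1 - h)) := by gcongr
      _ = _ := by rw [← mul_assoc, pow_succ']

theorem lintegral_radialMeasure (hw : Measurable w) {F : ℂ → ℝ≥0∞} (hF : Measurable F) :
    ∫⁻ z, F z ∂(radialMeasure w) = ∫⁻ r in Ioi (0 : ℝ), w r * (ENNReal.ofReal r *
      ∫⁻ θ in Ioo (-Real.pi) Real.pi, F (r * Complex.exp (θ * Complex.I))) := by
  have hwn : Measurable fun z : ℂ => w ‖z‖ := hw.comp measurable_norm
  rw [radialMeasure, lintegral_withDensity_eq_lintegral_mul _ hwn hF,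
    ← Complex.lintegral_comp_polarCoord_symm]
  have hsymm : ∀ p : ℝ × ℝ, Complex.polarCoord.symm p = p.1 * Complex.exp (p.2 * Complex.I) := by
    intro p
    rw [Complex.polarCoord_symm_apply, Complex.exp_mul_I]
    simp
  have hm : Measurable fun p : ℝ × ℝ => (p.1 : ℂ) * Complex.exp (p.2 * Complex.I) := by fun_prop
  rw [polarCoord_target, Measure.volume_eq_prod, ← Measure.prod_restrict]
  simp only [hsymm]
  rw [lintegral_prod]
  · refine setLIntegral_congr_fun measurableSet_Ioi fun r hr => ?_
    have hr' : (0 : ℝ) < r := hr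
    have : ∀ θ : ℝ, ENNReal.ofReal r • (((fun z : ℂ => w ‖z‖) * F) (r * Complex.exp (θ * Complex.I)))
        = (w r * ENNReal.ofReal r) * F (r * Complex.exp (θ * Complex.I)) := by
      intro θ
      simp only [Pi.mul_apply, smul_eq_mul, norm_mul, Complex.norm_exp_ofReal_mul_I, mul_one,
        Complex.norm_real, Real.norm_of_nonneg hr'.le]
      ring
    simp only [this]
    rw [lintegral_const_mul, mul_assoc]
    exact hF.comp (hm.comp measurable_prodMk_left)
  · refine Measurable.aemeasurable ?_
    simp only [smul_eq_mul]
    exact (ENNReal.measurable_ofReal.comp measurable_fst).mul ((hwn.mul hF).comp hm)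

theorem lintegral_radialMeasure_le (hw : IsProfile w D) {F : ℂ → ℝ≥0∞} (hF : Measurable F)
    {G : ℝ → ℝ≥0∞} (hFG : ∀ r ∈ Ico (0 : ℝ) 1,
      ∫⁻ θ in Ioo (-Real.pi) Real.pi, F (r * Complex.exp (θ * Complex.I)) ≤ G r) :
    ∫⁻ z, F z ∂(radialMeasure w) ≤ ∫⁻ r, w r * G r := by
  rw [lintegral_radialMeasure hw.measurable hF]
  refine (lintegral_mono fun r => ?_).trans (setLIntegral_le_lintegral (Ioi 0) _)
  by_cases hr : r ∈ Ico (0 : ℝ) 1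
  · gcongr
    refine le_trans ?_ (hFG r hr)
    refine mul_le_of_le_one_left zero_le ?_
    simpa using hr.2.le
  · simp [hw.eq_zero r hr]

theorem measurable_kernelFun (z : ℂ) : Measurable (kernelFun z) := by
  unfold kernelFun; fun_prop

theorem measurable_kernelFun_uncurry : Measurable fun x : ℂ × ℂ => kernelFun x.1 x.2 := by
  unfold kernelFun
  have : Measurable fun x : ℂ × ℂ => (starRingEnd ℂ) x.1 :=
    Complex.continuous_conj.measurable.comp measurable_fst
  fun_prop

/-- The circle estimate is integrated in the radius against w; radii in S exceed 1/2, so the polar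
Jacobian costs a factor 2. The set S is left free: the full range beyond (1+|z|)/2 serves the growth
estimate and the case p < q, a bounded dyadic window serves p = q. -/
theorem IsProfile.lintegral_mul_enorm_rpow_le (hw : IsProfile w D) {f : ℂ → ℂ} (hfm : Measurable f)
    (hf : DifferentiableOn ℂ f disc) {z : ℂ} (hz : ‖z‖ < 1) {t : ℝ} (ht : 0 < t) {S : Set ℝ}
    (hS : MeasurableSet S) (hzS : S ⊆ Ici ((1 + ‖z‖) / 2)) :
    (∫⁻ r in S, w r) * ‖f z‖ₑ ^ t ≤ 16 * ∫⁻ ζ in {ζ | ‖ζ‖ ∈ S},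
      ENNReal.ofReal (kernelFun z ζ) * ‖f ζ‖ₑ ^ t ∂(radialMeasure w) := by
  have hSm : MeasurableSet {ζ : ℂ | ‖ζ‖ ∈ S} := measurable_norm hS
  have hFm : Measurable fun ζ => ENNReal.ofReal (kernelFun z ζ) * ‖f ζ‖ₑ ^ t :=
    (measurable_kernelFun z).ennreal_ofReal.mul (hfm.enorm.pow_const t)
  rw [← lintegral_indicator hSm, lintegral_radialMeasure hw.measurable (hFm.indicator hSm),
    ← lintegral_indicator hS, ← lintegral_mul_const _ (hw.measurable.indicator hS),
    ← lintegral_const_mul' _ _ (by simp), ← lintegral_indicator measurableSet_Ioi]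
  refine lintegral_mono fun r => ?_
  by_cases hr : r ∈ S; swap
  · simp [hr]
  by_cases hr1 : r ∈ Ico (0 : ℝ) 1; swap
  · simp [indicator_of_mem hr, hw.eq_zero r hr1]
  have hrz : (1 + ‖z‖) / 2 ≤ r := hzS hr
  have hr2 : 1 / 2 ≤ r := by linarith [norm_nonneg z]
  rw [indicator_of_mem hr, indicator_of_mem (by simp only [mem_Ioi]; linarith : r ∈ Ioi (0 : ℝ))]
  have h1 := enorm_rpow_le_lintegral_circle hf hz hrz hr1.2 ht
  have h2 : ∀ θ : ℝ, {ζ : ℂ | ‖ζ‖ ∈ S}.indicator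
      (fun ζ => ENNReal.ofReal (kernelFun z ζ) * ‖f ζ‖ₑ ^ t) (r * Complex.exp (θ * Complex.I))
      = ENNReal.ofReal (kernelFun z (r * Complex.exp (θ * Complex.I))) *
        ‖f (r * Complex.exp (θ * Complex.I))‖ₑ ^ t := by
    intro θ
    apply indicator_of_mem
    simpa [abs_of_nonneg hr1.1] using hr
  simp only [h2]
  set A := ∫⁻ θ in Ioo (-Real.pi) Real.pi,
      ENNReal.ofReal (kernelFun z (r * Complex.exp (θ * Complex.I))) *
        ‖f (r * Complex.exp (θ * Complex.I))‖ₑ ^ t with hA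
  have h3 : (1 : ℝ≥0∞) ≤ 2 * ENNReal.ofReal r := by
    rw [show (2 : ℝ≥0∞) = ENNReal.ofReal 2 by simp, ← ENNReal.ofReal_mul (by norm_num),
      ENNReal.one_le_ofReal]
    linarith
  calc w r * ‖f z‖ₑ ^ t ≤ w r * (8 * A) := by gcongr
    _ ≤ (2 * ENNReal.ofReal r) * (w r * (8 * A)) := le_mul_of_one_le_left zero_le h3
    _ = _ := by ring

theorem lintegral_kernelFun_circle_le {z : ℂ} (hz : ‖z‖ < 1) {r : ℝ} (hr : r ∈ Ico (0 : ℝ) 1) :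
    ∫⁻ θ in Ioo (-Real.pi) Real.pi,
      ENNReal.ofReal (kernelFun z (r * Complex.exp (θ * Complex.I)))
      ≤ ENNReal.ofReal (2 * Real.pi) := by
  have hz' : 0 < 1 - ‖z‖ := by linarith
  have h := lintegral_inv_norm_sq_le hr.1 hr.2.le hz
  have h2 : ∀ θ : ℝ, ENNReal.ofReal (kernelFun z (r * Complex.exp (θ * Complex.I)))
      = ENNReal.ofReal (1 - ‖z‖) * ENNReal.ofReal
        (1 / ‖1 - (starRingEnd ℂ) z * (r * Complex.exp (θ * Complex.I))‖ ^ 2) := by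
    intro θ
    rw [← ENNReal.ofReal_mul hz'.le, kernelFun, ← div_eq_mul_one_div]
  simp only [h2]
  rw [lintegral_const_mul' _ _ ENNReal.ofReal_ne_top]
  refine (mul_le_mul_right h _).trans ?_
  rw [← ENNReal.ofReal_mul hz'.le]
  apply ENNReal.ofReal_le_ofReal
  have h3 : ‖z‖ * r ≤ ‖z‖ := mul_le_of_le_one_right (norm_nonneg z) hr.2.le
  rw [← mul_div_assoc, div_le_iff₀ (by linarith)]
  nlinarith [Real.two_pi_pos]

theorem IsProfile.lintegral_kernelFun_le (hw : IsProfile w D) {z : ℂ} (hz : ‖z‖ < 1) (ρ : ℝ) :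
    ∫⁻ ζ in {ζ | ρ ≤ ‖ζ‖}, ENNReal.ofReal (kernelFun z ζ) ∂(radialMeasure w)
      ≤ ENNReal.ofReal (2 * Real.pi) * tailMass w ρ := by
  have hSm : MeasurableSet {ζ : ℂ | ρ ≤ ‖ζ‖} := measurableSet_le measurable_const measurable_norm
  have hkm := (measurable_kernelFun z).ennreal_ofReal
  rw [← lintegral_indicator hSm]
  refine (lintegral_radialMeasure_le hw (hkm.indicator hSm)
    (G := (Ici ρ).indicator fun _ => ENNReal.ofReal (2 * Real.pi)) fun r hr => ?_).trans ?_
  · have hn : ∀ θ : ℝ, ‖(r : ℂ) * Complex.exp (θ * Complex.I)‖ = r := by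
      intro θ; simp [abs_of_nonneg hr.1]
    by_cases h : ρ ≤ r
    · rw [indicator_of_mem (show r ∈ Ici ρ from h)]
      refine (lintegral_mono fun θ => ?_).trans (lintegral_kernelFun_circle_le hz hr)
      exact indicator_le_self _ _ _
    · have : ∀ θ : ℝ, {ζ : ℂ | ρ ≤ ‖ζ‖}.indicator (fun ζ => ENNReal.ofReal (kernelFun z ζ))
          ((r : ℂ) * Complex.exp (θ * Complex.I)) = 0 := by
        intro θ
        apply indicator_of_notMem
        simpa only [mem_ofPred_eq, hn] using h
      simp [this]
  · rw [tailMass, ← lintegral_const_mul _ hw.measurable, ← lintegral_indicator measurableSet_Ici]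
    refine lintegral_mono fun r => ?_
    by_cases h : r ∈ Ici ρ
    · simp only [indicator_of_mem h]; rw [mul_comm]
    · simp [indicator_of_notMem h]

theorem IsProfile.isFiniteMeasure (hw : IsProfile w D) : IsFiniteMeasure (radialMeasure w) := by
  refine ⟨?_⟩
  have h := hw.lintegral_kernelFun_le (z := 0) (by simp) 0
  have h1 : {ζ : ℂ | (0 : ℝ) ≤ ‖ζ‖} = univ := by ext; simp
  rw [h1, Measure.restrict_univ] at h
  simp only [kernelFun, norm_zero, map_zero, zero_mul, sub_zero, norm_one, one_pow, div_one,
    ENNReal.ofReal_one, lintegral_const, one_mul] at h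
  exact h.trans_lt (ENNReal.mul_lt_top ENNReal.ofReal_lt_top hw.finite.lt_top)

/-- The quantity comparable to the `ω`-mass of the Carleson square at `a`. -/
def boxMass (w : ℝ → ℝ≥0∞) (a : ℂ) : ℝ≥0∞ := ENNReal.ofReal (1 - ‖a‖) * tailMass w ‖a‖

theorem IsProfile.boxMass_ne_top (hw : IsProfile w D) (a : ℂ) : boxMass w a ≠ ⊤ :=
  ENNReal.mul_ne_top ENNReal.ofReal_ne_top (hw.tailMass_ne_top _)

theorem IsProfile.boxMass_ne_zero (hw : IsProfile w D) {a : ℂ} (ha : ‖a‖ < 1) :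
    boxMass w a ≠ 0 :=
  mul_ne_zero (by simpa using ha) (hw.pos _ ha)

/-- Pointwise growth of functions in the weighted Bergman space. -/
theorem IsProfile.boxMass_mul_enorm_rpow_le (hw : IsProfile w D) {f : ℂ → ℂ} (hfm : Measurable f)
    (hf : DifferentiableOn ℂ f disc) {z : ℂ} (hz : ‖z‖ < 1) {t : ℝ} (ht : 0 < t) :
    boxMass w z * ‖f z‖ₑ ^ t ≤ 16 * D * ∫⁻ ζ, ‖f ζ‖ₑ ^ t ∂(radialMeasure w) := by
  have hz' : 0 < 1 - ‖z‖ := by linarith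
  have h := hw.lintegral_mul_enorm_rpow_le hfm hf hz ht (measurableSet_Ici (a := (1 + ‖z‖) / 2))
    subset_rfl
  have hSm : MeasurableSet {ζ : ℂ | ‖ζ‖ ∈ Ici ((1 + ‖z‖) / 2)} := measurable_norm measurableSet_Ici
  have hae : ∀ᵐ ζ ∂(radialMeasure w), ‖ζ‖ < 1 := by
    rw [ae_iff, radialMeasure, withDensity_apply _ (by measurability)]
    refine (setLIntegral_congr_fun (by measurability) fun ζ hζ => ?_).trans (lintegral_zero)
    exact hw.eq_zero _ fun h => hζ h.2
  calc boxMass w z * ‖f z‖ₑ ^ t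
      ≤ ENNReal.ofReal (1 - ‖z‖) * (D * tailMass w ((1 + ‖z‖) / 2)) * ‖f z‖ₑ ^ t := by
        unfold boxMass; gcongr; exact hw.doubling _ hz
    _ = ENNReal.ofReal (1 - ‖z‖) * D * ((∫⁻ r in Ici ((1 + ‖z‖) / 2), w r) * ‖f z‖ₑ ^ t) := by
        unfold tailMass; ring
    _ ≤ ENNReal.ofReal (1 - ‖z‖) * D * (16 * ∫⁻ ζ in {ζ | ‖ζ‖ ∈ Ici ((1 + ‖z‖) / 2)},
      ENNReal.ofReal (kernelFun z ζ) * ‖f ζ‖ₑ ^ t ∂(radialMeasure w)) := by gcongr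
    _ ≤ ENNReal.ofReal (1 - ‖z‖) * D * (16 * ∫⁻ ζ,
      ENNReal.ofReal (1 / (1 - ‖z‖)) * ‖f ζ‖ₑ ^ t ∂(radialMeasure w)) := by
        refine mul_le_mul' le_rfl (mul_le_mul' le_rfl ?_)
        refine (setLIntegral_le_lintegral _ _).trans (lintegral_mono_ae ?_)
        filter_upwards [hae] with ζ hζ
        gcongr
        have h1 := one_sub_norm_le (z := z) hζ.le
        unfold kernelFun
        rw [div_le_div_iff₀ (by nlinarith) hz']
        nlinarith
    _ = 16 * D * ((ENNReal.ofReal (1 - ‖z‖) * ENNReal.ofReal (1 / (1 - ‖z‖))) *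
        ∫⁻ ζ, ‖f ζ‖ₑ ^ t ∂(radialMeasure w)) := by
        rw [lintegral_const_mul' _ _ ENNReal.ofReal_ne_top]; ring
    _ = _ := by
        rw [← ENNReal.ofReal_mul hz'.le, mul_one_div_cancel hz'.ne']; simp

/-! ### Test functions -/

/-- This N is the decay exponent that beats doubling: passing to a tail of double size costs D but
gains 2^{-N}, a net factor of at most 1/2. -/
theorem IsProfile.exists_two_pow (hw : IsProfile w D) : ∃ N : ℕ, 2 * D ≤ 2 ^ N := by
  have h : 2 * D ≠ ⊤ := ENNReal.mul_ne_top (by simp) hw.const_ne_top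
  obtain ⟨N, hN⟩ := ENNReal.exists_nat_gt h
  refine ⟨N, hN.le.trans ?_⟩
  exact_mod_cast (Nat.lt_two_pow_self (n := N)).le

/-- Only one term of the series is needed. If 2^k(1-a) ≤ 1-r < 2^{k+1}(1-a), then 1-ar ≥ 1-r makes
the quotient at most 2^{-k}; if 1-r ≤ 1-a, the term k = 0 and the trivial bound 1 suffice. -/
theorem ofReal_div_pow_le_tsum {a r : ℝ} (ha0 : 0 ≤ a) (ha : a < 1) (hr : r ∈ Ico (0 : ℝ) 1)
    (N : ℕ) : ENNReal.ofReal (((1 - a) / (1 - a * r)) ^ N) ≤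
      ∑' k : ℕ, (2⁻¹ ^ N : ℝ≥0∞) ^ k * (Ici (1 - 2 ^ (k + 1) * (1 - a))).indicator 1 r := by
  have hh : 0 < 1 - a := by linarith
  have h1r : 1 - r ≤ 1 - a * r := by nlinarith [hr.1]
  have h1a : 1 - a ≤ 1 - a * r := by nlinarith [hr.2]
  have hr1 : 0 < 1 - r := by linarith [hr.2]
  have hpos : 0 < 1 - a * r := by linarith
  have hbase : (1 - a) / (1 - a * r) ≤ 1 := (div_le_one hpos).2 h1a
  have hbase0 : 0 ≤ (1 - a) / (1 - a * r) := by positivity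
  rcases le_total (1 - r) (1 - a) with hc | hc
  · refine le_trans ?_ (ENNReal.le_tsum 0)
    have hm : r ∈ Ici (1 - 2 ^ (0 + 1) * (1 - a)) := by simp only [mem_Ici]; norm_num; linarith
    rw [indicator_of_mem hm]
    simpa using pow_le_one₀ hbase0 hbase
  · obtain ⟨k, hk1, hk2⟩ := exists_nat_pow_near ((one_le_div hh).2 hc) (one_lt_two)
    rw [le_div_iff₀ hh] at hk1
    rw [div_lt_iff₀ hh] at hk2
    refine le_trans ?_ (ENNReal.le_tsum k)
    have hm : r ∈ Ici (1 - 2 ^ (k + 1) * (1 - a)) := by simp only [mem_Ici]; linarith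
    rw [indicator_of_mem hm, Pi.one_apply, mul_one]
    have h2 : (1 - a) / (1 - a * r) ≤ (2⁻¹ : ℝ) ^ k := by
      rw [inv_pow, ← one_div, div_le_div_iff₀ hpos (by positivity)]
      linarith
    calc ENNReal.ofReal (((1 - a) / (1 - a * r)) ^ N)
        ≤ ENNReal.ofReal (((2⁻¹ : ℝ) ^ k) ^ N) := by gcongr
      _ = (2⁻¹ ^ N : ℝ≥0∞) ^ k := by
        rw [← pow_mul, ← pow_mul, mul_comm N k, ENNReal.ofReal_pow (by norm_num),
          ENNReal.ofReal_inv_of_pos (by norm_num)]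
        simp

/-- After the dyadic decomposition the k-th tail is at most D^{k+1} ω̂(a) by iterated doubling, and
the weight 2^{-Nk} reduces this to 2^{-k} D ω̂(a), which is summable. -/
theorem IsProfile.lintegral_div_pow_le (hw : IsProfile w D) {N : ℕ} (hN : 2 * D ≤ 2 ^ N) {a : ℝ}
    (ha0 : 0 ≤ a) (ha : a < 1) :
    ∫⁻ r, w r * ENNReal.ofReal (((1 - a) / (1 - a * r)) ^ N) ≤ 2 * D * tailMass w a := by
  have hh : 0 < 1 - a := by linarith
  calc ∫⁻ r, w r * ENNReal.ofReal (((1 - a) / (1 - a * r)) ^ N)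
      ≤ ∫⁻ r, ∑' k : ℕ, (2⁻¹ ^ N : ℝ≥0∞) ^ k *
          (Ici (1 - 2 ^ (k + 1) * (1 - a))).indicator w r := by
        refine lintegral_mono fun r => ?_
        by_cases hr : r ∈ Ico (0 : ℝ) 1
        · refine (mul_le_mul_right (ofReal_div_pow_le_tsum ha0 ha hr N) _).trans ?_
          rw [← ENNReal.tsum_mul_left]
          refine ENNReal.tsum_le_tsum fun k => le_of_eq ?_
          by_cases h : r ∈ Ici (1 - 2 ^ (k + 1) * (1 - a))
          · rw [indicator_of_mem h, indicator_of_mem h, Pi.one_apply, mul_one, mul_comm]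
          · rw [indicator_of_notMem h, indicator_of_notMem h]; simp
        · simp [hw.eq_zero r hr]
    _ = ∑' k : ℕ, (2⁻¹ ^ N : ℝ≥0∞) ^ k * tailMass w (1 - 2 ^ (k + 1) * (1 - a)) := by
        rw [lintegral_tsum]
        · refine tsum_congr fun k => ?_
          rw [lintegral_const_mul _ (hw.measurable.indicator measurableSet_Ici),
            lintegral_indicator measurableSet_Ici, tailMass]
        · intro k
          exact ((hw.measurable.indicator measurableSet_Ici).const_mul _).aemeasurable
    _ ≤ ∑' k : ℕ, (D * tailMass w a) * 2⁻¹ ^ k := by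
        refine ENNReal.tsum_le_tsum fun k => ?_
        have h1 := hw.doubling_pow hh (k + 1)
        rw [sub_sub_cancel] at h1
        have h2 : 2⁻¹ ^ N * D ≤ (2⁻¹ : ℝ≥0∞) := by
          have h2' : 2⁻¹ ^ N * D = 2⁻¹ ^ N * (2 * D) * 2⁻¹ := by
            rw [mul_comm 2 D, mul_assoc, mul_assoc, ENNReal.mul_inv_cancel (by simp) (by simp),
              mul_one]
          rw [h2']
          refine mul_le_of_le_one_left zero_le ?_
          calc (2⁻¹ ^ N * (2 * D) : ℝ≥0∞) ≤ 2⁻¹ ^ N * 2 ^ N := by gcongr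
            _ = 1 := by rw [← mul_pow, ENNReal.inv_mul_cancel (by simp) (by simp), one_pow]
        calc (2⁻¹ ^ N : ℝ≥0∞) ^ k * tailMass w (1 - 2 ^ (k + 1) * (1 - a))
            ≤ (2⁻¹ ^ N : ℝ≥0∞) ^ k * (D ^ (k + 1) * tailMass w a) := by gcongr
          _ = (2⁻¹ ^ N * D) ^ k * (D * tailMass w a) := by rw [mul_pow]; ring
          _ ≤ 2⁻¹ ^ k * (D * tailMass w a) := by gcongr
          _ = _ := mul_comm _ _
    _ = 2 * D * tailMass w a := by
        rw [ENNReal.tsum_mul_left, ENNReal.tsum_geometric, ENNReal.one_sub_inv_two, inv_inv]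
        ring

/-- Tails of a doubling weight decay at most polynomially: the integrand of the preceding estimate
is at least (1-a)^N. This is what makes normalized test functions vanish pointwise. -/
theorem IsProfile.ofReal_pow_mul_tailMass_le (hw : IsProfile w D) {N : ℕ} (hN : 2 * D ≤ 2 ^ N)
    {a : ℝ} (ha0 : 0 ≤ a) (ha : a < 1) :
    ENNReal.ofReal ((1 - a) ^ N) * tailMass w 0 ≤ 2 * D * tailMass w a := by
  refine le_trans ?_ (hw.lintegral_div_pow_le hN ha0 ha)
  rw [tailMass, ← lintegral_const_mul _ hw.measurable, ← lintegral_indicator measurableSet_Ici]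
  refine lintegral_mono fun r => ?_
  by_cases hr : r ∈ Ico (0 : ℝ) 1
  · rw [indicator_of_mem (show r ∈ Ici (0 : ℝ) from hr.1), mul_comm]
    gcongr
    have : a * r < 1 := by nlinarith [hr.1, hr.2]
    rw [le_div_iff₀ (by linarith)]
    nlinarith [mul_nonneg ha0 hr.1]
  · simp [indicator, hw.eq_zero r hr]

/-- The test functions `((1 - |a|) / (1 - conj a z))^γ`. -/
def testFun (γ : ℕ) (a z : ℂ) : ℂ := (((1 - ‖a‖ : ℝ) : ℂ) / (1 - (starRingEnd ℂ) a * z)) ^ γ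

/-- The disc automorphism interchanging `a` and `0`. -/
def mobius (a z : ℂ) : ℂ := (a - z) / (1 - (starRingEnd ℂ) a * z)

theorem one_sub_conj_mul_ne_zero {a z : ℂ} (ha : ‖a‖ < 1) (hz : ‖z‖ ≤ 1) :
    1 - (starRingEnd ℂ) a * z ≠ 0 := by
  have := norm_one_sub_conj_mul_pos ha hz
  simpa using this

theorem differentiableOn_testFun (γ : ℕ) {a : ℂ} (ha : ‖a‖ < 1) :
    DifferentiableOn ℂ (testFun γ a) disc := by
  unfold testFun
  refine DifferentiableOn.pow (DifferentiableOn.div (by fun_prop) (by fun_prop) fun z hz => ?_) _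
  exact one_sub_conj_mul_ne_zero ha (by simpa using (mem_ball_zero_iff.1 hz).le)

theorem differentiableOn_mobius {a : ℂ} (ha : ‖a‖ < 1) :
    DifferentiableOn ℂ (mobius a) disc := by
  unfold mobius
  refine DifferentiableOn.div (by fun_prop) (by fun_prop) fun z hz => ?_
  exact one_sub_conj_mul_ne_zero ha (by simpa using (mem_ball_zero_iff.1 hz).le)

theorem measurable_testFun (γ : ℕ) (a : ℂ) : Measurable (testFun γ a) := by
  unfold testFun; fun_prop

theorem norm_testFun (γ : ℕ) {a : ℂ} (ha : ‖a‖ < 1) (z : ℂ) :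
    ‖testFun γ a z‖ = ((1 - ‖a‖) / ‖1 - (starRingEnd ℂ) a * z‖) ^ γ := by
  rw [testFun, norm_pow, norm_div, Complex.norm_real, Real.norm_of_nonneg (by linarith)]

/-- The sharp bound is 1; the constant 3 follows from the triangle inequality for a - z = a(1 -
conj(a) z) - (1-|a|²) z and is enough here. -/
theorem norm_mobius_le {a z : ℂ} (ha : ‖a‖ < 1) (hz : ‖z‖ < 1) : ‖mobius a z‖ ≤ 3 := by
  have h1 := one_sub_norm_le (z := a) hz.le
  have h2 := norm_one_sub_conj_mul_pos ha hz.le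
  rw [mobius, norm_div, div_le_iff₀ h2]
  have e : a - z = a * (1 - (starRingEnd ℂ) a * z) - ((1 - ‖a‖ ^ 2 : ℝ) : ℂ) * z := by
    have := Complex.mul_conj' a
    push_cast
    rw [← this]; ring
  rw [e]
  refine (norm_sub_le _ _).trans ?_
  rw [norm_mul, norm_mul, Complex.norm_real, Real.norm_of_nonneg (by nlinarith [norm_nonneg a])]
  have := norm_nonneg a
  have := norm_nonneg z
  have h3 : (1 - ‖a‖ ^ 2) * ‖z‖ ≤ 2 * (1 - ‖a‖) := by
    calc (1 - ‖a‖ ^ 2) * ‖z‖ ≤ (1 - ‖a‖ ^ 2) * 1 := by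
          gcongr
          nlinarith
      _ ≤ _ := by nlinarith
  have h4 : ‖a‖ * ‖1 - (starRingEnd ℂ) a * z‖ ≤ ‖1 - (starRingEnd ℂ) a * z‖ :=
    mul_le_of_le_one_left h2.le ha.le
  linarith

theorem mobius_sub_mobius {a z v : ℂ} (ha : ‖a‖ < 1) (hz : ‖z‖ < 1) (hv : ‖v‖ < 1) :
    mobius a z - mobius a v = (v - z) * ((1 - ‖a‖ ^ 2 : ℝ) : ℂ) /
      ((1 - (starRingEnd ℂ) a * z) * (1 - (starRingEnd ℂ) a * v)) := by
  have h1 := one_sub_conj_mul_ne_zero ha hz.le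
  have h2 := one_sub_conj_mul_ne_zero ha hv.le
  have := Complex.mul_conj' a
  unfold mobius
  rw [div_sub_div _ _ h1 h2]
  congr 1
  push_cast
  rw [← this]
  ring

/-- The test functions have `L^p` norms controlled by the box masses. -/
theorem IsProfile.lintegral_testFun_le (hw : IsProfile w D) {N : ℕ} (hN : 2 * D ≤ 2 ^ N) {γ : ℕ}
    {p : ℝ} (hp : 0 < p) (hγ : (N : ℝ) + 2 ≤ γ * p) {a : ℂ} (ha : ‖a‖ < 1) :
    ∫⁻ z, ‖testFun γ a z‖ₑ ^ p ∂(radialMeasure w)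
      ≤ ENNReal.ofReal (2 * Real.pi) * (2 * D) * boxMass w a := by
  have hh : 0 < 1 - ‖a‖ := by linarith
  have h := lintegral_radialMeasure_le hw (F := fun z => ‖testFun γ a z‖ₑ ^ p)
    ((measurable_testFun γ a).enorm.pow_const p)
    (G := fun r => (ENNReal.ofReal (1 - ‖a‖) * ENNReal.ofReal (2 * Real.pi)) *
      ENNReal.ofReal (((1 - ‖a‖) / (1 - ‖a‖ * r)) ^ N)) ?_
  · refine h.trans ?_
    have e : ∀ r, w r * ((ENNReal.ofReal (1 - ‖a‖) * ENNReal.ofReal (2 * Real.pi)) *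
        ENNReal.ofReal (((1 - ‖a‖) / (1 - ‖a‖ * r)) ^ N)) =
        (ENNReal.ofReal (1 - ‖a‖) * ENNReal.ofReal (2 * Real.pi)) *
        (w r * ENNReal.ofReal (((1 - ‖a‖) / (1 - ‖a‖ * r)) ^ N)) := fun r => by ring
    simp only [e]
    rw [lintegral_const_mul' _ _ (ENNReal.mul_ne_top ENNReal.ofReal_ne_top ENNReal.ofReal_ne_top)]
    refine (mul_le_mul_right (hw.lintegral_div_pow_le hN (norm_nonneg a) ha) _).trans ?_
    rw [boxMass]
    apply le_of_eq; ring
  · intro r hr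
    have hc : ∀ θ : ℝ, ‖testFun γ a (r * Complex.exp (θ * Complex.I))‖ₑ ^ p ≤
        (ENNReal.ofReal (1 - ‖a‖) * ENNReal.ofReal (((1 - ‖a‖) / (1 - ‖a‖ * r)) ^ N)) *
        ENNReal.ofReal (kernelFun a (r * Complex.exp (θ * Complex.I))) := by
      intro θ
      set ζ : ℂ := r * Complex.exp (θ * Complex.I) with hζ
      have hn : ‖ζ‖ = r := by simp [hζ, abs_of_nonneg hr.1]
      have hn1 : ‖ζ‖ ≤ 1 := hn.le.trans hr.2.le
      have h1 := one_sub_norm_le (z := a) hn1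
      have h2 := norm_one_sub_conj_mul_pos ha hn1
      have h3 := one_sub_norm_mul_le a ζ
      rw [hn] at h3
      have h4 : 0 < 1 - ‖a‖ * r := by nlinarith [norm_nonneg a, hr.1, hr.2]
      set b := ‖1 - (starRingEnd ℂ) a * ζ‖ with hb
      have hx0 : 0 < (1 - ‖a‖) / b := by positivity
      have hx1 : (1 - ‖a‖) / b ≤ 1 := (div_le_one h2).2 h1
      rw [← ofReal_norm, ENNReal.ofReal_rpow_of_nonneg (norm_nonneg _) hp.le, norm_testFun γ ha,
        ← ENNReal.ofReal_mul hh.le, ← ENNReal.ofReal_mul (by positivity)]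
      apply ENNReal.ofReal_le_ofReal
      rw [← hb, ← Real.rpow_natCast, ← Real.rpow_mul hx0.le]
      -- Of the N + 2 available powers, two form the Poisson-type kernel, which is integrated over
      -- the circle, and N are kept as a radial factor for the dyadic estimate.
      calc ((1 - ‖a‖) / b) ^ ((γ : ℝ) * p) ≤ ((1 - ‖a‖) / b) ^ ((N : ℝ) + 2) :=
            Real.rpow_le_rpow_of_exponent_ge hx0 hx1 hγ
        _ = ((1 - ‖a‖) / b) ^ N * ((1 - ‖a‖) / b) ^ 2 := by
            rw [Real.rpow_add hx0, Real.rpow_natCast]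
            norm_cast
        _ ≤ ((1 - ‖a‖) / (1 - ‖a‖ * r)) ^ N * ((1 - ‖a‖) / b) ^ 2 := by gcongr
        _ = _ := by rw [kernelFun, ← hb]; ring
    refine (lintegral_mono hc).trans ?_
    rw [lintegral_const_mul' _ _ (ENNReal.mul_ne_top ENNReal.ofReal_ne_top ENNReal.ofReal_ne_top)]
    refine (mul_le_mul_right (lintegral_kernelFun_circle_le ha hr) _).trans ?_
    apply le_of_eq; ring

/-! ### Recovering the pseudohyperbolic distance from two test functions -/

/-- A region around `a` of size comparable to `1 - |a|`. -/
def nearRegion (a : ℂ) : Set ℂ :=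
  {z | ‖z‖ < 1 ∧ ‖z - a‖ < 2 * (1 - ‖a‖) ∧ 1 - ‖a‖ ≤ 2 * (1 - ‖z‖)}

theorem measurableSet_nearRegion (a : ℂ) : MeasurableSet (nearRegion a) := by
  unfold nearRegion; measurability

theorem norm_one_sub_conj_mul_le_of_mem_nearRegion {a z : ℂ} (ha : ‖a‖ < 1)
    (hz : z ∈ nearRegion a) : ‖1 - (starRingEnd ℂ) a * z‖ ≤ 4 * (1 - ‖a‖) := by
  have e : 1 - (starRingEnd ℂ) a * z
      = ((1 - ‖a‖ ^ 2 : ℝ) : ℂ) - (starRingEnd ℂ) a * (z - a) := by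
    have := Complex.conj_mul' a
    push_cast
    rw [← this]; ring
  rw [e]
  refine (norm_sub_le _ _).trans ?_
  have h0 := norm_nonneg a
  rw [Complex.norm_real, Real.norm_of_nonneg (by nlinarith), norm_mul, Complex.norm_conj]
  have := norm_nonneg (z - a)
  nlinarith [hz.2.1]

/-- Replacing a by z changes the left side by at most |z-a| < 2(1-|a|) ≤ 4(1-|z|), which is absorbed
because 1-|z| ≤ |1 - conj(z) v|. The point v is arbitrary, so ψ may be far from φ. -/
theorem norm_one_sub_conj_mul_le_five_mul {a z v : ℂ} (hz : z ∈ nearRegion a) (hv : ‖v‖ < 1) :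
    ‖1 - (starRingEnd ℂ) a * v‖ ≤ 5 * ‖1 - (starRingEnd ℂ) z * v‖ := by
  have h1 := one_sub_norm_le (z := z) hv.le
  have e : 1 - (starRingEnd ℂ) a * v
      = (1 - (starRingEnd ℂ) z * v) + (starRingEnd ℂ) (z - a) * v := by
    rw [map_sub]; ring
  rw [e]
  refine (norm_add_le _ _).trans ?_
  rw [norm_mul, Complex.norm_conj]
  have := mul_le_of_le_one_right (norm_nonneg (z - a)) hv.le
  linarith [hz.2.1, hz.2.2]

/-- Two facts combine. In the formula for σ_a(z) - σ_a(v) the denominators are at most 4(1-|a|) and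
5|1 - conj(z) v|, which costs 20; and |f_a(z)| ≥ 4^{-γ} near a. The product f_a(z)(σ_a(z) - σ_a(v))
is then written through differences of the two test functions, with 3 bounding |σ_a(v)|. -/
theorem norm_div_le_of_mem_nearRegion {a z v : ℂ} (ha : ‖a‖ < 1) (hz : z ∈ nearRegion a)
    (hv : ‖v‖ < 1) (γ : ℕ) :
    ‖(v - z) / (1 - (starRingEnd ℂ) v * z)‖ ≤ 20 * 4 ^ γ *
      (‖mobius a z * testFun γ a z - mobius a v * testFun γ a v‖
        + 3 * ‖testFun γ a z - testFun γ a v‖) := by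
  have hh : 0 < 1 - ‖a‖ := by linarith
  have hz1 := hz.1
  have h1 := norm_one_sub_conj_mul_le_of_mem_nearRegion ha hz
  have h2 := norm_one_sub_conj_mul_le_five_mul hz hv
  have p1 := norm_one_sub_conj_mul_pos ha hz1.le
  have p2 := norm_one_sub_conj_mul_pos ha hv.le
  have p3 := norm_one_sub_conj_mul_pos hz1 hv.le
  have h3 : ‖(v - z) / (1 - (starRingEnd ℂ) v * z)‖ ≤ 20 * ‖mobius a z - mobius a v‖ := by
    rw [mobius_sub_mobius ha hz1 hv, norm_div, norm_div, norm_mul, norm_mul, Complex.norm_real,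
      Real.norm_of_nonneg (by nlinarith [norm_nonneg a]), norm_one_sub_conj_mul_comm v z,
      ← mul_div_assoc, div_le_div_iff₀ p3 (by positivity)]
    have h4 : ‖1 - (starRingEnd ℂ) a * z‖ * ‖1 - (starRingEnd ℂ) a * v‖
        ≤ (4 * (1 - ‖a‖)) * (5 * ‖1 - (starRingEnd ℂ) z * v‖) := by gcongr
    have h5 : 1 - ‖a‖ ≤ 1 - ‖a‖ ^ 2 := by nlinarith [norm_nonneg a]
    calc ‖v - z‖ * (‖1 - (starRingEnd ℂ) a * z‖ * ‖1 - (starRingEnd ℂ) a * v‖)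
        ≤ ‖v - z‖ * ((4 * (1 - ‖a‖)) * (5 * ‖1 - (starRingEnd ℂ) z * v‖)) := by gcongr
      _ = 20 * (‖v - z‖ * (1 - ‖a‖)) * ‖1 - (starRingEnd ℂ) z * v‖ := by ring
      _ ≤ _ := by gcongr
  have h4 : 1 ≤ 4 ^ γ * ‖testFun γ a z‖ := by
    rw [norm_testFun γ ha, ← mul_pow]
    refine one_le_pow₀ ?_
    rw [← mul_div_assoc, le_div_iff₀ p1]
    linarith
  have h5 : ‖testFun γ a z‖ * ‖mobius a z - mobius a v‖ ≤
      ‖mobius a z * testFun γ a z - mobius a v * testFun γ a v‖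
        + 3 * ‖testFun γ a z - testFun γ a v‖ := by
    rw [← norm_mul]
    have e : testFun γ a z * (mobius a z - mobius a v) =
        (mobius a z * testFun γ a z - mobius a v * testFun γ a v)
          - mobius a v * (testFun γ a z - testFun γ a v) := by ring
    rw [e]
    refine (norm_sub_le _ _).trans ?_
    rw [norm_mul]
    gcongr
    exact norm_mobius_le ha hv
  calc ‖(v - z) / (1 - (starRingEnd ℂ) v * z)‖ ≤ 20 * ‖mobius a z - mobius a v‖ := h3
    _ ≤ (4 ^ γ * ‖testFun γ a z‖) * (20 * ‖mobius a z - mobius a v‖) :=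
        le_mul_of_one_le_left (by positivity) h4
    _ = 20 * 4 ^ γ * (‖testFun γ a z‖ * ‖mobius a z - mobius a v‖) := by ring
    _ ≤ _ := by gcongr

/-! ### Dyadic annuli and the averaged Carleson condition -/

/-- The dyadic annuli `2^{-n-1} < 1 - |z| ≤ 2^{-n}`. -/
def annulus (n : ℕ) : Set ℂ := {z | (1 / 2 : ℝ) ^ (n + 1) < 1 - ‖z‖ ∧ 1 - ‖z‖ ≤ (1 / 2 : ℝ) ^ n}

theorem measurableSet_annulus (n : ℕ) : MeasurableSet (annulus n) := by
  unfold annulus; measurability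

theorem norm_lt_one_of_mem_annulus {n : ℕ} {z : ℂ} (hz : z ∈ annulus n) : ‖z‖ < 1 := by
  have : (0 : ℝ) < (1 / 2) ^ (n + 1) := by positivity
  linarith [hz.1]

theorem exists_mem_annulus {z : ℂ} (hz : ‖z‖ < 1) : ∃ n, z ∈ annulus n := by
  have h1 : 0 < 1 - ‖z‖ := by linarith
  obtain ⟨n, h⟩ := exists_nat_pow_near_of_lt_one h1 (by linarith [norm_nonneg z])
    (by norm_num : (0 : ℝ) < 1 / 2) (by norm_num)
  exact ⟨n, h⟩

/-- The mass of a Carleson box of size `2^{-n}`. -/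
def stepMass (w : ℝ → ℝ≥0∞) (n : ℕ) : ℝ≥0∞ :=
  ENNReal.ofReal ((1 / 2) ^ n) * tailMass w (1 - (1 / 2) ^ n)

theorem IsProfile.stepMass_ne_top (hw : IsProfile w D) (n : ℕ) : stepMass w n ≠ ⊤ :=
  ENNReal.mul_ne_top ENNReal.ofReal_ne_top (hw.tailMass_ne_top _)

theorem IsProfile.stepMass_ne_zero (hw : IsProfile w D) (n : ℕ) : stepMass w n ≠ 0 :=
  mul_ne_zero (by simp) (hw.pos _ (by simp))

theorem stepMass_succ_le (w : ℝ → ℝ≥0∞) (n : ℕ) : stepMass w (n + 1) ≤ 2⁻¹ * stepMass w n := by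
  unfold stepMass
  rw [← mul_assoc]
  have : (2⁻¹ : ℝ≥0∞) * ENNReal.ofReal ((1 / 2) ^ n) = ENNReal.ofReal ((1 / 2) ^ (n + 1)) := by
    rw [pow_succ', ENNReal.ofReal_mul (by norm_num)]
    congr 1
    rw [one_div, ENNReal.ofReal_inv_of_pos (by norm_num)]; simp
  rw [this]
  gcongr
  apply tailMass_antitone
  have : (1 / 2 : ℝ) ^ (n + 1) ≤ (1 / 2) ^ n :=
    pow_le_pow_of_le_one (by norm_num) (by norm_num) (Nat.le_succ n)
  linarith

/-- A Carleson type condition on the dyadic annuli. -/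
def AnnularCarleson (w : ℝ → ℝ≥0∞) (s : ℝ) (κ : ℝ≥0∞) (μ : Measure ℂ) : Prop :=
  ∀ ζ : ℂ, ‖ζ‖ < 1 → ∀ n,
    ∫⁻ z in annulus n, ENNReal.ofReal ((1 - ‖z‖) * kernelFun z ζ) ∂μ ≤ κ * stepMass w n ^ s

theorem norm_exp_mul_I_sub_exp_mul_I_le (x y : ℝ) :
    ‖Complex.exp (x * Complex.I) - Complex.exp (y * Complex.I)‖ ≤ |x - y| := by
  have e : Complex.exp (x * Complex.I) - Complex.exp (y * Complex.I) =
      Complex.exp (y * Complex.I) * (Complex.exp (Complex.I * ((x - y : ℝ) : ℂ)) - 1) := by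
    rw [mul_sub, ← Complex.exp_add, mul_one]
    congr 2
    push_cast; ring
  rw [e, norm_mul, Complex.norm_exp_ofReal_mul_I, one_mul, ← Real.norm_eq_abs]
  exact Real.norm_exp_I_mul_ofReal_sub_one_le

/-- With h = 2^{-n}, the radial displacement is at most h/2 and the angular one at most h, together
less than 2h. The lower bound 1-|z| > h/2 built into the annulus gives the last clause of
`nearRegion`. -/
theorem mem_nearRegion_of_abs_sub_arg_lt {n : ℕ} {z : ℂ} (hz : z ∈ annulus n) {θ : ℝ}
    (hθ : |θ - z.arg| < (1 / 2) ^ n) :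
    z ∈ nearRegion (((1 - (1 / 2) ^ n : ℝ) : ℂ) * Complex.exp (θ * Complex.I)) := by
  set h : ℝ := (1 / 2) ^ n with hh
  have h0 : 0 < h := by positivity
  have h1 : h ≤ 1 := pow_le_one₀ (by norm_num) (by norm_num)
  have hz1 := hz.1
  have hz2 := hz.2
  rw [pow_succ, ← hh] at hz1
  rw [← hh] at hz2
  have hn : ‖((1 - h : ℝ) : ℂ) * Complex.exp (θ * Complex.I)‖ = 1 - h := by
    rw [norm_mul, Complex.norm_exp_ofReal_mul_I, mul_one, Complex.norm_real,
      Real.norm_of_nonneg (by linarith)]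
  refine ⟨by linarith, ?_, by rw [hn]; linarith⟩
  rw [hn]
  have e : z - ((1 - h : ℝ) : ℂ) * Complex.exp (θ * Complex.I) =
      ((‖z‖ - (1 - h) : ℝ) : ℂ) * Complex.exp (z.arg * Complex.I) + ((1 - h : ℝ) : ℂ) *
        (Complex.exp (z.arg * Complex.I) - Complex.exp (θ * Complex.I)) := by
    conv_lhs => rw [← Complex.norm_mul_exp_arg_mul_I z]
    push_cast; ring
  rw [e]
  refine (norm_add_le _ _).trans_lt ?_
  rw [norm_mul, norm_mul, Complex.norm_exp_ofReal_mul_I, mul_one, Complex.norm_real,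
    Complex.norm_real, Real.norm_of_nonneg (by linarith : 0 ≤ 1 - h)]
  have h3 : ‖‖z‖ - (1 - h)‖ ≤ h / 2 := by
    rw [Real.norm_eq_abs, abs_le]; constructor <;> linarith
  have h4 := norm_exp_mul_I_sub_exp_mul_I_le z.arg θ
  rw [abs_sub_comm] at h4
  have h5 : (1 - h) * ‖Complex.exp (z.arg * Complex.I) - Complex.exp (θ * Complex.I)‖ ≤ h := by
    calc _ ≤ 1 * h := by
          apply mul_le_mul _ (h4.trans hθ.le) (norm_nonneg _) zero_le_one
          linarith
      _ = h := one_mul h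
  linarith

/-- The interval is placed on the side of arg z facing 0, so that it does not cross the cut of the
argument; h ≤ 1 < π leaves the room. -/
theorem exists_interval_near_arg (z : ℂ) {h : ℝ} (h0 : 0 < h) (h1 : h ≤ 1) :
    ∃ b : ℝ, Ioo b (b + h) ⊆ Ioo (-Real.pi) Real.pi ∧ ∀ θ ∈ Ioo b (b + h), |θ - z.arg| < h := by
  have hpi := Real.pi_gt_three
  have ha := Complex.neg_pi_lt_arg z
  have hb := Complex.arg_le_pi z
  rcases lt_or_ge 0 z.arg with hc | hc
  · refine ⟨z.arg - h, fun θ hθ => ⟨by linarith [hθ.1], by linarith [hθ.2]⟩, fun θ hθ => ?_⟩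
    rw [abs_lt]; constructor <;> linarith [hθ.1, hθ.2]
  · refine ⟨z.arg, fun θ hθ => ⟨by linarith [hθ.1], by linarith [hθ.2]⟩, fun θ hθ => ?_⟩
    rw [abs_lt]; constructor <;> linarith [hθ.1, hθ.2]

/-- Averaging a condition on the regions `nearRegion a` gives the condition on annuli. -/
theorem annularCarleson_of_nearRegion {s : ℝ} {κ : ℝ≥0∞} {μ : Measure ℂ} [SFinite μ]
    (hμ : ∀ a : ℂ, ‖a‖ < 1 → μ (nearRegion a) ≤ κ * boxMass w a ^ s) :
    AnnularCarleson w s (ENNReal.ofReal (50 * Real.pi) * κ) μ := by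
  intro ζ hζ n
  set h : ℝ := (1 / 2) ^ n with hh
  have h0 : 0 < h := by positivity
  have h1 : h ≤ 1 := pow_le_one₀ (by norm_num) (by norm_num)
  -- The centres run over the circle of radius 1-h. Each z in the annulus lies in `nearRegion (a θ)`
  -- for a set of θ of length at least h, on which the kernels at a(θ) and at z are comparable.
  -- Integrating the measure bounds against the kernel at a(θ) and exchanging integrals gives the
  -- annular condition.
  set a : ℝ → ℂ := fun θ => ((1 - h : ℝ) : ℂ) * Complex.exp (θ * Complex.I) with ha
  have hac : Continuous a := by fun_prop
  have hn : ∀ θ, ‖a θ‖ = 1 - h := by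
    intro θ
    rw [ha, norm_mul, Complex.norm_exp_ofReal_mul_I, mul_one, Complex.norm_real,
      Real.norm_of_nonneg (by linarith)]
  have ha1 : ∀ θ, ‖a θ‖ < 1 := fun θ => by rw [hn]; linarith
  have hbox : ∀ θ, boxMass w (a θ) = stepMass w n := by
    intro θ; rw [boxMass, stepMass, hn, sub_sub_cancel]
  let U : Set (ℂ × ℝ) := {x | x.1 ∈ nearRegion (a x.2)}
  have hU : MeasurableSet U := by
    have m1 : Measurable fun x : ℂ × ℝ => a x.2 := hac.measurable.comp measurable_snd
    have e : U = {x : ℂ × ℝ | ‖x.1‖ < 1} ∩ ({x | ‖x.1 - a x.2‖ < 2 * (1 - ‖a x.2‖)} ∩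
        {x | 1 - ‖a x.2‖ ≤ 2 * (1 - ‖x.1‖)}) := rfl
    rw [e]
    refine (measurableSet_lt measurable_fst.norm measurable_const).inter
      ((measurableSet_lt (measurable_fst.sub m1).norm ?_).inter (measurableSet_le ?_ ?_))
    · exact (measurable_const.sub m1.norm).const_mul _
    · exact measurable_const.sub m1.norm
    · exact (measurable_const.sub measurable_fst.norm).const_mul _
  let Φ : ℂ → ℝ → ℝ≥0∞ := fun z θ =>
    U.indicator (fun x => ENNReal.ofReal (kernelFun (a x.2) ζ)) (z, θ)
  have hkm : Measurable fun x : ℂ × ℝ => ENNReal.ofReal (kernelFun (a x.2) ζ) :=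
    (measurable_kernelFun_uncurry.comp ((hac.measurable.comp measurable_snd).prodMk
      measurable_const)).ennreal_ofReal
  have hΦ : Measurable (Function.uncurry Φ) := hkm.indicator hU
  have hpt : ∀ z ∈ annulus n, ENNReal.ofReal ((1 - ‖z‖) * kernelFun z ζ) ≤
      25 * ∫⁻ θ in Ioo (-Real.pi) Real.pi, Φ z θ := by
    intro z hz
    have hz1 := norm_lt_one_of_mem_annulus hz
    obtain ⟨b, hb1, hb2⟩ := exists_interval_near_arg z h0 h1
    have hle : ∀ θ ∈ Ioo b (b + h), ENNReal.ofReal ((1 - ‖z‖) * kernelFun z ζ / (25 * h))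
        ≤ Φ z θ := by
      intro θ hθ
      have hmem : z ∈ nearRegion (a θ) := mem_nearRegion_of_abs_sub_arg_lt hz (hb2 θ hθ)
      have hΦe : Φ z θ = ENNReal.ofReal (kernelFun (a θ) ζ) :=
        indicator_of_mem (show (z, θ) ∈ U from hmem) _
      rw [hΦe]
      apply ENNReal.ofReal_le_ofReal
      have h5 := norm_one_sub_conj_mul_le_five_mul hmem hζ
      have p1 := norm_one_sub_conj_mul_pos (ha1 θ) hζ.le
      have p2 := norm_one_sub_conj_mul_pos hz1 hζ.le
      unfold kernelFun
      rw [hn, sub_sub_cancel, ← mul_div_assoc, div_div, div_le_div_iff₀ (by positivity)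
        (by positivity)]
      have h6 : ‖1 - (starRingEnd ℂ) (a θ) * ζ‖ ^ 2 ≤ 25 * ‖1 - (starRingEnd ℂ) z * ζ‖ ^ 2 := by
        calc _ ≤ (5 * ‖1 - (starRingEnd ℂ) z * ζ‖) ^ 2 := by gcongr
          _ = _ := by ring
      have h7 : (1 - ‖z‖) * (1 - ‖z‖) ≤ h * h :=
        mul_le_mul hz.2 hz.2 (by linarith) h0.le
      calc (1 - ‖z‖) * (1 - ‖z‖) * ‖1 - (starRingEnd ℂ) (a θ) * ζ‖ ^ 2
          ≤ (h * h) * (25 * ‖1 - (starRingEnd ℂ) z * ζ‖ ^ 2) := by gcongr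
        _ = _ := by ring
    have h8 : ENNReal.ofReal ((1 - ‖z‖) * kernelFun z ζ / (25 * h)) * ENNReal.ofReal h
        ≤ ∫⁻ θ in Ioo (-Real.pi) Real.pi, Φ z θ := by
      calc _ = ∫⁻ θ in Ioo b (b + h), ENNReal.ofReal ((1 - ‖z‖) * kernelFun z ζ / (25 * h)) := by
            rw [setLIntegral_const, Real.volume_Ioo, add_sub_cancel_left]
        _ ≤ ∫⁻ θ in Ioo b (b + h), Φ z θ := setLIntegral_mono' measurableSet_Ioo hle
        _ ≤ _ := lintegral_mono_set hb1
    refine le_trans (le_of_eq ?_) (mul_le_mul_right h8 25)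
    have hk : 0 ≤ kernelFun z ζ := div_nonneg (by linarith) (by positivity)
    rw [show (25 : ℝ≥0∞) = ENNReal.ofReal 25 by simp, ← ENNReal.ofReal_mul' h0.le,
      ← ENNReal.ofReal_mul (by norm_num)]
    congr 1
    field_simp
  -- By symmetry of |1 - conj(a) ζ| in a and ζ, the kernel can be integrated in its centre, and the
  -- total is at most 2π uniformly in ζ. With the factor 25 above this is the constant 50π.
  have hcirc : ∫⁻ θ in Ioo (-Real.pi) Real.pi, ENNReal.ofReal (kernelFun (a θ) ζ)
      ≤ ENNReal.ofReal (2 * Real.pi) := by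
    have h2 := lintegral_inv_norm_sq_le (z := ζ) (r := 1 - h) (by linarith) (by linarith) hζ
    have e : ∀ θ : ℝ, ENNReal.ofReal (kernelFun (a θ) ζ) = ENNReal.ofReal h * ENNReal.ofReal
        (1 / ‖1 - (starRingEnd ℂ) ζ * (((1 - h : ℝ) : ℂ) * Complex.exp (θ * Complex.I))‖ ^ 2) := by
      intro θ
      rw [← ENNReal.ofReal_mul h0.le, kernelFun, hn, sub_sub_cancel, norm_one_sub_conj_mul_comm,
        ← div_eq_mul_one_div]
    simp only [e]
    rw [lintegral_const_mul' _ _ ENNReal.ofReal_ne_top]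
    refine (mul_le_mul_right h2 _).trans ?_
    rw [← ENNReal.ofReal_mul h0.le]
    apply ENNReal.ofReal_le_ofReal
    have h3 : ‖ζ‖ * (1 - h) ≤ 1 * (1 - h) := by gcongr
    rw [← mul_div_assoc, div_le_iff₀ (by linarith)]
    nlinarith [Real.two_pi_pos]
  calc ∫⁻ z in annulus n, ENNReal.ofReal ((1 - ‖z‖) * kernelFun z ζ) ∂μ
      ≤ ∫⁻ z in annulus n, (25 * ∫⁻ θ in Ioo (-Real.pi) Real.pi, Φ z θ) ∂μ :=
        setLIntegral_mono' (measurableSet_annulus n) hpt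
    _ ≤ ∫⁻ z, (25 * ∫⁻ θ in Ioo (-Real.pi) Real.pi, Φ z θ) ∂μ := setLIntegral_le_lintegral _ _
    _ = 25 * ∫⁻ θ in Ioo (-Real.pi) Real.pi, ∫⁻ z, Φ z θ ∂μ := by
        rw [lintegral_const_mul' _ _ (by simp), lintegral_lintegral_swap hΦ.aemeasurable]
    _ ≤ 25 * ∫⁻ θ in Ioo (-Real.pi) Real.pi,
          (κ * stepMass w n ^ s) * ENNReal.ofReal (kernelFun (a θ) ζ) := by
        refine mul_le_mul_right (lintegral_mono fun θ => ?_) _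
        have e : ∀ z, Φ z θ = (nearRegion (a θ)).indicator
            (fun _ => ENNReal.ofReal (kernelFun (a θ) ζ)) z := fun z => rfl
        simp only [e]
        rw [lintegral_indicator_const (measurableSet_nearRegion _), mul_comm]
        gcongr
        rw [← hbox θ]
        exact hμ _ (ha1 θ)
    _ = 25 * ((κ * stepMass w n ^ s) *
          ∫⁻ θ in Ioo (-Real.pi) Real.pi, ENNReal.ofReal (kernelFun (a θ) ζ)) := by
        rw [lintegral_const_mul]
        exact (measurable_kernelFun_uncurry.comp (hac.measurable.prodMk
          measurable_const)).ennreal_ofReal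
    _ ≤ 25 * ((κ * stepMass w n ^ s) * ENNReal.ofReal (2 * Real.pi)) := by gcongr
    _ = _ := by
        rw [show (50 : ℝ) * Real.pi = 25 * (2 * Real.pi) by ring,
          ENNReal.ofReal_mul (by norm_num : (0 : ℝ) ≤ 25)]
        simp only [ENNReal.ofReal_ofNat]
        ring

/-! ### Carleson embedding for p = q and two-sided doubling -/

theorem ae_radialMeasure_norm_lt_one (hw : IsProfile w D) : ∀ᵐ ζ ∂(radialMeasure w), ‖ζ‖ < 1 := by
  rw [ae_iff, radialMeasure, withDensity_apply _ (by measurability)]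
  refine (setLIntegral_congr_fun (by measurability) fun ζ hζ => ?_).trans lintegral_zero
  exact hw.eq_zero _ fun h => hζ h.2

/-- Doubling is used twice because 1 - 2^{-(n+2)} is beyond (1+|z|)/2 for every z in the n-th
annulus, which is where the Poisson estimate becomes available. -/
theorem IsProfile.stepMass_le (hw : IsProfile w D) (n : ℕ) :
    stepMass w n ≤ ENNReal.ofReal ((1 / 2) ^ n) * (D ^ 2 * tailMass w (1 - (1 / 2) ^ (n + 2))) := by
  have h := hw.doubling_pow (h := (1 / 2) ^ (n + 2)) (by positivity) 2
  have e : (2 : ℝ) ^ 2 * (1 / 2) ^ (n + 2) = (1 / 2) ^ n := by rw [pow_add]; ring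
  rw [e] at h
  unfold stepMass
  gcongr

theorem ofReal_half_pow_mul_kernelFun_le {n : ℕ} {z : ℂ} (hz : z ∈ annulus n) (ζ : ℂ) :
    ENNReal.ofReal ((1 / 2) ^ n) * ENNReal.ofReal (kernelFun z ζ)
      ≤ 2 * ENNReal.ofReal ((1 - ‖z‖) * kernelFun z ζ) := by
  have hz1 := norm_lt_one_of_mem_annulus hz
  have h := hz.1
  rw [pow_succ] at h
  have hk : 0 ≤ kernelFun z ζ := div_nonneg (by linarith) (by positivity)
  rw [show (2 : ℝ≥0∞) = ENNReal.ofReal 2 by simp, ← ENNReal.ofReal_mul (by positivity),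
    ← ENNReal.ofReal_mul (by norm_num), ← mul_assoc]
  apply ENNReal.ofReal_le_ofReal
  gcongr
  linarith

theorem disc_subset_iUnion_annulus : disc ⊆ ⋃ n, annulus n := fun _ hz =>
  mem_iUnion.2 (exists_mem_annulus (mem_ball_zero_iff.1 hz))

theorem measurable_scaledKernel : Measurable
    (Function.uncurry fun z ζ : ℂ => ENNReal.ofReal ((1 - ‖z‖) * kernelFun z ζ)) :=
  ((measurable_const.sub measurable_fst.norm).mul measurable_kernelFun_uncurry).ennreal_ofReal

/-- Each window is a union of N consecutive gaps, and each gap belongs to at most N windows. -/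
theorem sum_setLIntegral_window_le (ν : Measure ℂ) (F : ℂ → ℝ≥0∞) (N : ℕ) {ρ : ℕ → ℝ}
    (hρ : Monotone ρ) :
    ∑' n, ∫⁻ ζ in {ζ | ‖ζ‖ ∈ Ico (ρ n) (ρ (n + N))}, F ζ ∂ν ≤ N * ∫⁻ ζ, F ζ ∂ν := by
  have hm : ∀ a b : ℝ, MeasurableSet {ζ : ℂ | ‖ζ‖ ∈ Ico a b} := fun a b =>
    measurable_norm measurableSet_Ico
  set b : ℕ → ℝ≥0∞ := fun m => ∫⁻ ζ in {ζ | ‖ζ‖ ∈ Ico (ρ m) (ρ (m + 1))}, F ζ ∂ν with hb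
  have hbt : ∑' m, b m ≤ ∫⁻ ζ, F ζ ∂ν := by
    rw [← lintegral_iUnion (fun m => hm _ _)]
    · exact setLIntegral_le_lintegral _ _
    · intro i j hij
      exact (hρ.pairwise_disjoint_on_Ico_succ hij).preimage (fun ζ : ℂ => ‖ζ‖)
  have h1 : ∀ N n, ∫⁻ ζ in {ζ | ‖ζ‖ ∈ Ico (ρ n) (ρ (n + N))}, F ζ ∂ν
      ≤ ∑ j ∈ Finset.range N, b (n + j) := by
    intro N n
    induction N with
    | zero => simp
    | succ N ih =>
      rw [Finset.sum_range_succ]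
      refine le_trans ?_ (add_le_add_left ih _)
      refine le_trans (lintegral_mono_set ?_) (lintegral_union_le _ _ _)
      intro ζ hζ
      rcases lt_or_ge ‖ζ‖ (ρ (n + N)) with h | h
      · exact Or.inl ⟨hζ.1, h⟩
      · exact Or.inr ⟨h, hζ.2⟩
  calc _ ≤ ∑' n, ∑ j ∈ Finset.range N, b (n + j) := ENNReal.tsum_le_tsum (h1 N)
    _ = ∑ j ∈ Finset.range N, ∑' n, b (n + j) := by
        rw [Summable.tsum_finsetSum fun _ _ => ENNReal.summable]
    _ ≤ ∑ j ∈ Finset.range N, ∫⁻ ζ, F ζ ∂ν := by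
        refine Finset.sum_le_sum fun j _ => le_trans ?_ hbt
        exact ENNReal.tsum_comp_le_tsum_of_injective (add_left_injective j) b
    _ = _ := by simp

/-- The Carleson embedding `A^p_ω ⊆ L^p_μ` for two-sided doubling weights. -/
theorem IsProfile.lintegral_rpow_le_of_lower (hw : IsProfile w D) {N : ℕ} {c : ℝ≥0∞}
    (hlow : ∀ r ∈ Ico (0 : ℝ) 1,
      tailMass w r ≤ c * ∫⁻ s in Ico r (1 - (1 - r) / 2 ^ N), w s)
    {κ : ℝ≥0∞} {μ : Measure ℂ} [SFinite μ] (hμ : AnnularCarleson w 1 κ μ)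
    {p : ℝ} (hp : 0 < p) {f : ℂ → ℂ} (hfm : Measurable f) (hf : DifferentiableOn ℂ f disc) :
    ∫⁻ z in disc, ‖f z‖ₑ ^ p ∂μ
      ≤ 32 * D ^ 2 * c * N * κ * ∫⁻ z, ‖f z‖ₑ ^ p ∂(radialMeasure w) := by
  have := hw.isFiniteMeasure
  -- The exponent n + 2 puts the whole window beyond (1+|z|)/2 for all z in the n-th annulus, and N
  -- steps of ρ match the factor 2^N in the lower doubling hypothesis.
  set ρ : ℕ → ℝ := fun n => 1 - (1 / 2) ^ (n + 2) with hρ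
  have hρm : Monotone ρ := by
    intro i j hij
    have : (1 / 2 : ℝ) ^ (j + 2) ≤ (1 / 2) ^ (i + 2) :=
      pow_le_pow_of_le_one (by norm_num) (by norm_num) (by omega)
    simp only [hρ]; linarith
  set S : ℕ → Set ℂ := fun n => {ζ | ‖ζ‖ ∈ Ico (ρ n) (ρ (n + N))} with hS
  have hSm : ∀ n, MeasurableSet (S n) := fun n => measurable_norm measurableSet_Ico
  have hS1 : ∀ n, ∀ ζ ∈ S n, ‖ζ‖ < 1 := by
    intro n ζ hζ
    have : (0 : ℝ) < (1 / 2) ^ (n + N + 2) := by positivity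
    have h2 : ‖ζ‖ < 1 - (1 / 2) ^ (n + N + 2) := hζ.2
    linarith
  have hpt : ∀ n, ∀ z ∈ annulus n, stepMass w n * ‖f z‖ₑ ^ p ≤ 32 * D ^ 2 * c *
      ∫⁻ ζ in S n, ENNReal.ofReal ((1 - ‖z‖) * kernelFun z ζ) * ‖f ζ‖ₑ ^ p
        ∂(radialMeasure w) := by
    intro n z hz
    have hz1 := norm_lt_one_of_mem_annulus hz
    have hρ0 : ρ n ∈ Ico (0 : ℝ) 1 := by
      have h1 : (0 : ℝ) < (1 / 2) ^ (n + 2) := by positivity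
      have h2 : (1 / 2 : ℝ) ^ (n + 2) ≤ 1 := pow_le_one₀ (by norm_num) (by norm_num)
      constructor <;> simp only [hρ] <;> linarith
    have h1 := hlow _ hρ0
    have e : 1 - (1 - ρ n) / 2 ^ N = ρ (n + N) := by
      simp only [hρ]
      rw [sub_sub_cancel, show n + N + 2 = (n + 2) + N by ring, pow_add _ (n + 2) N]
      simp [div_eq_mul_inv]
    rw [e] at h1
    have h2 := hw.lintegral_mul_enorm_rpow_le hfm hf hz1 hp
      (measurableSet_Ico (a := ρ n) (b := ρ (n + N))) (by
        intro r hr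
        have h3 := hz.1
        have h4 := hr.1
        simp only [hρ] at h4
        rw [pow_succ] at h3
        rw [pow_add] at h4
        simp only [mem_Ici]
        linarith)
    calc stepMass w n * ‖f z‖ₑ ^ p
        ≤ (ENNReal.ofReal ((1 / 2) ^ n) * (D ^ 2 * (c * ∫⁻ s in Ico (ρ n) (ρ (n + N)), w s))) *
          ‖f z‖ₑ ^ p := by
          gcongr
          exact (hw.stepMass_le n).trans (by gcongr)
      _ = ENNReal.ofReal ((1 / 2) ^ n) * D ^ 2 * c *
          ((∫⁻ s in Ico (ρ n) (ρ (n + N)), w s) * ‖f z‖ₑ ^ p) := by ring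
      _ ≤ ENNReal.ofReal ((1 / 2) ^ n) * D ^ 2 * c * (16 * ∫⁻ ζ in S n,
          ENNReal.ofReal (kernelFun z ζ) * ‖f ζ‖ₑ ^ p ∂(radialMeasure w)) := by gcongr
      _ = 16 * D ^ 2 * c * ∫⁻ ζ in S n, (ENNReal.ofReal ((1 / 2) ^ n) *
          (ENNReal.ofReal (kernelFun z ζ) * ‖f ζ‖ₑ ^ p)) ∂(radialMeasure w) := by
          rw [lintegral_const_mul' _ _ ENNReal.ofReal_ne_top]; ring
      _ ≤ 16 * D ^ 2 * c * ∫⁻ ζ in S n, (2 *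
          (ENNReal.ofReal ((1 - ‖z‖) * kernelFun z ζ) * ‖f ζ‖ₑ ^ p)) ∂(radialMeasure w) := by
          refine mul_le_mul_right (lintegral_mono fun ζ => ?_) _
          rw [← mul_assoc, ← mul_assoc]
          exact mul_le_mul_left (ofReal_half_pow_mul_kernelFun_le hz ζ) _
      _ = _ := by
          rw [lintegral_const_mul' _ _ (by simp)]; ring
  -- The pointwise bound carries the factor `stepMass w n`; after Fubini the annular condition with
  -- exponent 1 produces the same factor, so it cancels.
  have hann : ∀ n, ∫⁻ z in annulus n, ‖f z‖ₑ ^ p ∂μ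
      ≤ 32 * D ^ 2 * c * κ * ∫⁻ ζ in S n, ‖f ζ‖ₑ ^ p ∂(radialMeasure w) := by
    intro n
    have hx0 := hw.stepMass_ne_zero n
    have hx1 := hw.stepMass_ne_top n
    refine (ENNReal.mul_le_mul_iff_right hx0 hx1).1 ?_
    have hjm : Measurable (Function.uncurry fun z ζ : ℂ =>
        ENNReal.ofReal ((1 - ‖z‖) * kernelFun z ζ) * ‖f ζ‖ₑ ^ p) :=
      measurable_scaledKernel.mul ((hfm.comp measurable_snd).enorm.pow_const p)
    calc stepMass w n * ∫⁻ z in annulus n, ‖f z‖ₑ ^ p ∂μ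
        = ∫⁻ z in annulus n, (stepMass w n * ‖f z‖ₑ ^ p) ∂μ := by
          rw [lintegral_const_mul' _ _ hx1]
      _ ≤ ∫⁻ z in annulus n, (32 * D ^ 2 * c *
          ∫⁻ ζ in S n, ENNReal.ofReal ((1 - ‖z‖) * kernelFun z ζ) * ‖f ζ‖ₑ ^ p
            ∂(radialMeasure w)) ∂μ := setLIntegral_mono' (measurableSet_annulus n) (hpt n)
      _ = 32 * D ^ 2 * c * ∫⁻ ζ in S n, ∫⁻ z in annulus n,
          ENNReal.ofReal ((1 - ‖z‖) * kernelFun z ζ) * ‖f ζ‖ₑ ^ p ∂μ ∂(radialMeasure w) := by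
          rw [lintegral_const_mul, lintegral_lintegral_swap hjm.aemeasurable]
          exact hjm.lintegral_prod_right
      _ ≤ 32 * D ^ 2 * c * ∫⁻ ζ in S n, (κ * stepMass w n) * ‖f ζ‖ₑ ^ p ∂(radialMeasure w) := by
          refine mul_le_mul_right (setLIntegral_mono' (hSm n) fun ζ hζ => ?_) _
          rw [lintegral_mul_const]
          · have := hμ ζ (hS1 n ζ hζ) n
            rw [ENNReal.rpow_one] at this
            gcongr
          · exact measurable_scaledKernel.comp measurable_prodMk_right
      _ = _ := by
          rw [lintegral_const_mul _ (hfm.enorm.pow_const p)]; ring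
  calc ∫⁻ z in disc, ‖f z‖ₑ ^ p ∂μ ≤ ∫⁻ z in ⋃ n, annulus n, ‖f z‖ₑ ^ p ∂μ :=
        lintegral_mono_set disc_subset_iUnion_annulus
    _ ≤ ∑' n, ∫⁻ z in annulus n, ‖f z‖ₑ ^ p ∂μ := lintegral_iUnion_le _ _
    _ ≤ ∑' n, 32 * D ^ 2 * c * κ * ∫⁻ ζ in S n, ‖f ζ‖ₑ ^ p ∂(radialMeasure w) :=
        ENNReal.tsum_le_tsum hann
    _ ≤ 32 * D ^ 2 * c * κ * (N * ∫⁻ z, ‖f z‖ₑ ^ p ∂(radialMeasure w)) := by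
        rw [ENNReal.tsum_mul_left]
        gcongr
        exact sum_setLIntegral_window_le _ _ N hρm
    _ = _ := by ring

/-! ### Carleson embedding for p < q: weak type and truncation -/

/-- Let N be the first index with y N ≤ 1. Going backwards from N - 1 the sequence at least doubles,
so the inverses sum to at most 2; going forwards from N it at least halves, so the powers form a
series of ratio at most 2^{-a}. The bound is independent of the sequence, as needed when it is
rescaled by μ(E). -/
theorem exists_tsum_min_le {a : ℝ} (ha : 0 < a) : ∃ C : ℝ≥0∞, C ≠ ⊤ ∧ ∀ y : ℕ → ℝ≥0∞, y 0 ≠ ⊤ →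
    (∀ n, y (n + 1) ≤ 2⁻¹ * y n) → ∑' n, min (y n ^ a) (y n)⁻¹ ≤ C := by
  have hr : (2⁻¹ : ℝ≥0∞) ^ a < 1 := by
    exact ENNReal.rpow_lt_one (by norm_num) ha
  refine ⟨2 + (1 - (2⁻¹ : ℝ≥0∞) ^ a)⁻¹, ?_, fun y hy0 hy => ?_⟩
  · refine ENNReal.add_ne_top.2 ⟨by simp, ENNReal.inv_ne_top.2 ?_⟩
    exact (tsub_pos_of_lt hr).ne'
  have hdec : ∀ n k, y (n + k) ≤ 2⁻¹ ^ k * y n := by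
    intro n k
    induction k with
    | zero => simp
    | succ k ih =>
      calc y (n + k + 1) ≤ 2⁻¹ * y (n + k) := hy _
        _ ≤ 2⁻¹ * (2⁻¹ ^ k * y n) := by gcongr
        _ = _ := by rw [← mul_assoc, pow_succ']
  have hex : ∃ n, y n ≤ 1 := by
    have h1 : Tendsto (fun n : ℕ => (2⁻¹ : ℝ≥0∞) ^ n * y 0) atTop (𝓝 (0 * y 0)) :=
      ENNReal.Tendsto.mul_const (ENNReal.tendsto_pow_atTop_nhds_zero_of_lt_one (by norm_num))
        (Or.inr hy0)
    rw [zero_mul] at h1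
    obtain ⟨n, hn⟩ := (h1.eventually (gt_mem_nhds one_pos)).exists
    refine ⟨n, le_trans ?_ hn.le⟩
    have := hdec 0 n
    rwa [zero_add] at this
  classical
  set N := Nat.find hex with hN
  rw [← ENNReal.summable.sum_add_tsum_nat_add' (k := N)]
  refine add_le_add ?_ ?_
  · calc ∑ n ∈ Finset.range N, min (y n ^ a) (y n)⁻¹
        ≤ ∑ n ∈ Finset.range N, (2⁻¹ : ℝ≥0∞) ^ (N - 1 - n) := by
          refine Finset.sum_le_sum fun n hn => (min_le_right _ _).trans ?_
          have hn' : n < N := Finset.mem_range.1 hn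
          have h1 : 1 < y (N - 1) := not_le.1 (Nat.find_min hex (by omega : N - 1 < N))
          have h2 := hdec n (N - 1 - n)
          rw [show n + (N - 1 - n) = N - 1 by omega] at h2
          have h3 : 1 ≤ 2⁻¹ ^ (N - 1 - n) * y n := h1.le.trans h2
          rw [ENNReal.inv_le_iff_inv_le, ← ENNReal.inv_pow]
          simp only [inv_inv]
          calc (2 : ℝ≥0∞) ^ (N - 1 - n) ≤ 2 ^ (N - 1 - n) * (2⁻¹ ^ (N - 1 - n) * y n) :=
                le_mul_of_one_le_right zero_le h3
            _ = y n := by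
                rw [← mul_assoc, ← mul_pow, ENNReal.mul_inv_cancel (by simp) (by simp), one_pow,
                  one_mul]
      _ = ∑ n ∈ Finset.range N, (2⁻¹ : ℝ≥0∞) ^ n := Finset.sum_range_reflect _ _
      _ ≤ ∑' n, (2⁻¹ : ℝ≥0∞) ^ n := ENNReal.sum_le_tsum _
      _ = 2 := by rw [ENNReal.tsum_geometric, ENNReal.one_sub_inv_two, inv_inv]
  · rw [← ENNReal.tsum_geometric]
    refine ENNReal.tsum_le_tsum fun n => (min_le_left _ _).trans ?_
    have h1 : y N ≤ 1 := Nat.find_spec hex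
    have h2 := hdec N n
    calc y (n + N) ^ a ≤ (2⁻¹ ^ n) ^ a := by
          rw [add_comm]
          gcongr
          exact h2.trans (mul_le_of_le_one_right zero_le h1)
      _ = _ := by
          rw [← ENNReal.rpow_natCast, ← ENNReal.rpow_mul, mul_comm, ENNReal.rpow_mul,
            ENNReal.rpow_natCast]

/-- The Poisson type kernel normalized by the tail integral. -/
def normKernel (w : ℝ → ℝ≥0∞) (z ζ : ℂ) : ℝ≥0∞ :=
  ENNReal.ofReal (kernelFun z ζ) * (tailMass w ((1 + ‖z‖) / 2))⁻¹

theorem measurable_normKernel_uncurry (w : ℝ → ℝ≥0∞) :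
    Measurable (Function.uncurry (normKernel w)) := by
  refine measurable_kernelFun_uncurry.ennreal_ofReal.mul (Measurable.inv ?_)
  exact (tailMass_antitone w).measurable.comp ((measurable_const.add measurable_fst.norm).div_const _)

theorem IsProfile.normKernel_le (hw : IsProfile w D) {n : ℕ} {z : ℂ} (hz : z ∈ annulus n) (ζ : ℂ) :
    normKernel w z ζ
      ≤ 2 * D ^ 2 * ((stepMass w n)⁻¹ * ENNReal.ofReal ((1 - ‖z‖) * kernelFun z ζ)) := by
  have hx0 := hw.stepMass_ne_zero n
  have hx1 := hw.stepMass_ne_top n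
  have hz1 := norm_lt_one_of_mem_annulus hz
  set T := tailMass w ((1 + ‖z‖) / 2) with hT
  have hT0 : T ≠ 0 := hw.pos _ (by linarith)
  have hT1 : T ≠ ⊤ := hw.tailMass_ne_top _
  have hWT : tailMass w (1 - (1 / 2) ^ (n + 2)) ≤ T := by
    apply tailMass_antitone
    have := hz.1
    rw [pow_succ] at this
    rw [pow_add]
    linarith
  have h : stepMass w n * normKernel w z ζ
      ≤ 2 * D ^ 2 * ENNReal.ofReal ((1 - ‖z‖) * kernelFun z ζ) := by
    calc stepMass w n * normKernel w z ζ
        ≤ (ENNReal.ofReal ((1 / 2) ^ n) * (D ^ 2 * T)) *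
            (ENNReal.ofReal (kernelFun z ζ) * T⁻¹) := by
          unfold normKernel
          gcongr
          exact (hw.stepMass_le n).trans (by gcongr)
      _ = D ^ 2 * (ENNReal.ofReal ((1 / 2) ^ n) * ENNReal.ofReal (kernelFun z ζ)) * (T * T⁻¹) := by
          ring
      _ ≤ D ^ 2 * (2 * ENNReal.ofReal ((1 - ‖z‖) * kernelFun z ζ)) * 1 := by
          rw [ENNReal.mul_inv_cancel hT0 hT1]
          exact mul_le_mul_left (mul_le_mul_right (ofReal_half_pow_mul_kernelFun_le hz ζ) _) _
      _ = _ := by ring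
  calc normKernel w z ζ = (stepMass w n)⁻¹ * (stepMass w n * normKernel w z ζ) := by
        rw [← mul_assoc, ENNReal.inv_mul_cancel hx0 hx1, one_mul]
    _ ≤ (stepMass w n)⁻¹ * (2 * D ^ 2 * ENNReal.ofReal ((1 - ‖z‖) * kernelFun z ζ)) := by gcongr
    _ = _ := by ring

theorem ofReal_mul_kernelFun_le_one {z ζ : ℂ} (hz : ‖z‖ < 1) (hζ : ‖ζ‖ ≤ 1) :
    ENNReal.ofReal ((1 - ‖z‖) * kernelFun z ζ) ≤ 1 := by
  rw [ENNReal.ofReal_le_one, kernelFun]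
  have h1 := one_sub_norm_le (z := z) hζ
  have h2 := norm_one_sub_conj_mul_pos hz hζ
  rw [← mul_div_assoc, div_le_one (by positivity)]
  nlinarith

/-- With M = μ(E) and x the step mass, the kernel integral over E in one annulus is bounded by
min(x^s, M)/x, up to constants: the first entry is the annular condition, the second the trivial
bound of the scaled kernel by 1. Substituting x = y M^{1/s} extracts M^{1-1/s} and leaves
min(y^{s-1}, 1/y), summable over the annuli since s > 1. -/
theorem IsProfile.setLIntegral_normKernel_le (hw : IsProfile w D) {s : ℝ} (hs : 1 < s)
    {μ : Measure ℂ} (hμ : AnnularCarleson w s 1 μ) {C : ℝ≥0∞}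
    (hC : ∀ y : ℕ → ℝ≥0∞, y 0 ≠ ⊤ → (∀ n, y (n + 1) ≤ 2⁻¹ * y n) →
      ∑' n, min (y n ^ (s - 1)) (y n)⁻¹ ≤ C)
    {E : Set ℂ} (hE : MeasurableSet E) (hEd : E ⊆ disc) (hE0 : μ E ≠ 0) (hE1 : μ E ≠ ⊤)
    {ζ : ℂ} (hζ : ‖ζ‖ < 1) :
    ∫⁻ z in E, normKernel w z ζ ∂μ ≤ 2 * D ^ 2 * C * μ E ^ (1 - 1 / s) := by
  have hs0 : 0 < s := by linarith
  set M := μ E with hM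
  have hn : ∀ n, ∫⁻ z in E ∩ annulus n, normKernel w z ζ ∂μ
      ≤ 2 * D ^ 2 * (M ^ (1 - 1 / s) * min ((stepMass w n * M ^ (-(1 / s))) ^ (s - 1))
        (stepMass w n * M ^ (-(1 / s)))⁻¹) := by
    intro n
    set x := stepMass w n with hx
    have hx0 : x ≠ 0 := hw.stepMass_ne_zero n
    have hx1 : x ≠ ⊤ := hw.stepMass_ne_top n
    have hm := hE.inter (measurableSet_annulus n)
    have h1 : ∫⁻ z in E ∩ annulus n, normKernel w z ζ ∂μ ≤ 2 * D ^ 2 * (x⁻¹ *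
        ∫⁻ z in E ∩ annulus n, ENNReal.ofReal ((1 - ‖z‖) * kernelFun z ζ) ∂μ) := by
      rw [← lintegral_const_mul' _ _ (ENNReal.inv_ne_top.2 hx0), ← lintegral_const_mul']
      · exact setLIntegral_mono' hm fun z hz => hw.normKernel_le hz.2 ζ
      · exact ENNReal.mul_ne_top (by simp) (ENNReal.pow_ne_top hw.const_ne_top)
    refine h1.trans (mul_le_mul_right ?_ _)
    have h2 : ∫⁻ z in E ∩ annulus n, ENNReal.ofReal ((1 - ‖z‖) * kernelFun z ζ) ∂μ ≤ x ^ s := by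
      refine (lintegral_mono_set inter_subset_right).trans ?_
      simpa using hμ ζ hζ n
    have h3 : ∫⁻ z in E ∩ annulus n, ENNReal.ofReal ((1 - ‖z‖) * kernelFun z ζ) ∂μ ≤ M := by
      calc _ ≤ ∫⁻ z in E ∩ annulus n, 1 ∂μ := setLIntegral_mono' hm fun z hz =>
            ofReal_mul_kernelFun_le_one (norm_lt_one_of_mem_annulus hz.2) hζ.le
        _ = μ (E ∩ annulus n) := setLIntegral_one _
        _ ≤ M := measure_mono inter_subset_left
    have hM' : ∀ r : ℝ, M ^ r ≠ 0 := fun r => (ENNReal.rpow_pos (pos_iff_ne_zero.2 hE0) hE1).ne'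
    have hM'' : ∀ r : ℝ, M ^ r ≠ ⊤ := fun r => ENNReal.rpow_ne_top_of_ne_zero hE0 hE1
    rw [mul_min]
    refine le_min ?_ ?_
    · calc _ ≤ x⁻¹ * x ^ s := by gcongr
        _ = x ^ (s - 1) := by
            rw [ENNReal.rpow_sub _ _ hx0 hx1, ENNReal.rpow_one, mul_comm, ENNReal.div_eq_inv_mul,
              mul_comm]
        _ = _ := by
            rw [ENNReal.mul_rpow_of_ne_top hx1 (hM'' _), ← ENNReal.rpow_mul, mul_left_comm,
              ← ENNReal.rpow_add _ _ hE0 hE1]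
            have : (1 - 1 / s) + -(1 / s) * (s - 1) = 0 := by field_simp; ring
            rw [this, ENNReal.rpow_zero, mul_one]
    · calc _ ≤ x⁻¹ * M := by gcongr
        _ = _ := by
            rw [ENNReal.mul_inv (Or.inl hx0) (Or.inl hx1), ← ENNReal.rpow_neg, mul_left_comm,
              ← ENNReal.rpow_add _ _ hE0 hE1]
            have : (1 - 1 / s) + - -(1 / s) = 1 := by ring
            rw [this, ENNReal.rpow_one]
  have hsub : E ⊆ ⋃ n, E ∩ annulus n := by
    rw [← inter_iUnion]
    exact subset_inter subset_rfl (hEd.trans disc_subset_iUnion_annulus)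
  calc ∫⁻ z in E, normKernel w z ζ ∂μ ≤ ∫⁻ z in ⋃ n, E ∩ annulus n, normKernel w z ζ ∂μ :=
        lintegral_mono_set hsub
    _ ≤ ∑' n, ∫⁻ z in E ∩ annulus n, normKernel w z ζ ∂μ := lintegral_iUnion_le _ _
    _ ≤ _ := ENNReal.tsum_le_tsum hn
    _ = 2 * D ^ 2 * (M ^ (1 - 1 / s) * ∑' n, min ((stepMass w n * M ^ (-(1 / s))) ^ (s - 1))
        (stepMass w n * M ^ (-(1 / s)))⁻¹) := by
        rw [ENNReal.tsum_mul_left, ENNReal.tsum_mul_left]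
    _ ≤ 2 * D ^ 2 * (M ^ (1 - 1 / s) * C) := by
        gcongr
        refine hC _ (ENNReal.mul_ne_top (hw.stepMass_ne_top 0)
          (ENNReal.rpow_ne_top_of_ne_zero hE0 hE1)) fun n => ?_
        rw [← mul_assoc]
        gcongr
        exact stepMass_succ_le w n
    _ = _ := by ring

/-- A weak type estimate for the normalized kernel. -/
theorem IsProfile.weak_type (hw : IsProfile w D) {s : ℝ} (hs : 1 < s)
    {μ : Measure ℂ} [IsFiniteMeasure μ] (hμ : AnnularCarleson w s 1 μ) {C : ℝ≥0∞}
    (hC : ∀ y : ℕ → ℝ≥0∞, y 0 ≠ ⊤ → (∀ n, y (n + 1) ≤ 2⁻¹ * y n) →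
      ∑' n, min (y n ^ (s - 1)) (y n)⁻¹ ≤ C)
    {E : Set ℂ} (hE : MeasurableSet E) (hEd : E ⊆ disc) {g : ℂ → ℝ≥0∞} (hg : Measurable g)
    {l : ℝ≥0∞} (hl : ∀ z ∈ E, l ≤ ∫⁻ ζ, normKernel w z ζ * g ζ ∂(radialMeasure w)) :
    l ^ s * μ E ≤ (2 * D ^ 2 * C * ∫⁻ ζ, g ζ ∂(radialMeasure w)) ^ s := by
  have := hw.isFiniteMeasure
  have hs0 : 0 < s := by linarith
  by_cases hE0 : μ E = 0
  · simp [hE0]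
  have hE1 : μ E ≠ ⊤ := measure_ne_top _ _
  set M := μ E with hM
  have hjm : Measurable (Function.uncurry fun z ζ : ℂ => normKernel w z ζ * g ζ) :=
    (measurable_normKernel_uncurry w).mul (hg.comp measurable_snd)
  -- The lower bound on E is integrated and the order of integration exchanged, so that only the
  -- kernel's mass over E is needed. Dividing by M^{1-1/s} leaves the weak type bound.
  have h1 : l * M ≤ (2 * D ^ 2 * C * M ^ (1 - 1 / s)) * ∫⁻ ζ, g ζ ∂(radialMeasure w) := by
    calc l * M = ∫⁻ z in E, l ∂μ := (setLIntegral_const _ _).symm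
      _ ≤ ∫⁻ z in E, ∫⁻ ζ, normKernel w z ζ * g ζ ∂(radialMeasure w) ∂μ :=
          setLIntegral_mono' hE hl
      _ = ∫⁻ ζ, ∫⁻ z in E, normKernel w z ζ * g ζ ∂μ ∂(radialMeasure w) :=
          lintegral_lintegral_swap hjm.aemeasurable
      _ ≤ ∫⁻ ζ, (2 * D ^ 2 * C * M ^ (1 - 1 / s)) * g ζ ∂(radialMeasure w) := by
          refine lintegral_mono_ae ?_
          filter_upwards [ae_radialMeasure_norm_lt_one hw] with ζ hζ
          rw [lintegral_mul_const]
          · gcongr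
            exact hw.setLIntegral_normKernel_le hs hμ hC hE hEd hE0 hE1 hζ
          · exact (measurable_normKernel_uncurry w).of_uncurry_right
      _ = _ := lintegral_const_mul _ hg
  have hM0 : M ^ (1 - 1 / s) ≠ 0 := (ENNReal.rpow_pos (pos_iff_ne_zero.2 hE0) hE1).ne'
  have hM1 : M ^ (1 - 1 / s) ≠ ⊤ := ENNReal.rpow_ne_top_of_ne_zero hE0 hE1
  have h2 : l * M ^ (1 / s) ≤ 2 * D ^ 2 * C * ∫⁻ ζ, g ζ ∂(radialMeasure w) := by
    refine (ENNReal.mul_le_mul_iff_right hM0 hM1).1 ?_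
    calc M ^ (1 - 1 / s) * (l * M ^ (1 / s)) = l * M := by
          rw [mul_left_comm, ← ENNReal.rpow_add _ _ hE0 hE1, sub_add_cancel, ENNReal.rpow_one]
      _ ≤ _ := h1
      _ = _ := by ring
  calc l ^ s * M = (l * M ^ (1 / s)) ^ s := by
        rw [ENNReal.mul_rpow_of_nonneg _ _ hs0.le, ← ENNReal.rpow_mul, one_div_mul_cancel hs0.ne',
          ENNReal.rpow_one]
    _ ≤ _ := ENNReal.rpow_le_rpow h2 hs0.le

/-- The part of |f|^t not exceeding τ contributes at most τ times the total mass of the normalized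
kernel over radii beyond (1+|z|)/2, which is at most 2π ≤ 7; here 112 = 16 · 7. Only the part above
τ remains under the integral. -/
theorem IsProfile.enorm_rpow_le_lintegral_normKernel (hw : IsProfile w D) {f : ℂ → ℂ}
    (hfm : Measurable f) (hf : DifferentiableOn ℂ f disc) {z : ℂ} (hz : ‖z‖ < 1) {t : ℝ}
    (ht : 0 < t) (τ : ℝ≥0∞) :
    ‖f z‖ₑ ^ t ≤ 112 * τ + 16 * ∫⁻ ζ, normKernel w z ζ *
      {ζ | τ < ‖f ζ‖ₑ ^ t}.indicator (fun ζ => ‖f ζ‖ₑ ^ t) ζ ∂(radialMeasure w) := by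
  set T := tailMass w ((1 + ‖z‖) / 2) with hT
  have hT0 : T ≠ 0 := hw.pos _ (by linarith)
  have hT1 : T ≠ ⊤ := hw.tailMass_ne_top _
  have hgm : Measurable fun ζ => ‖f ζ‖ₑ ^ t := hfm.enorm.pow_const t
  have hset : MeasurableSet {ζ | τ < ‖f ζ‖ₑ ^ t} := measurableSet_lt measurable_const hgm
  have hkm : Measurable (normKernel w z) :=
    (measurable_normKernel_uncurry w).of_uncurry_left
  have h := hw.lintegral_mul_enorm_rpow_le hfm hf hz ht (measurableSet_Ici (a := (1 + ‖z‖) / 2))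
    subset_rfl
  set A : Set ℂ := {ζ : ℂ | ‖ζ‖ ∈ Ici ((1 + ‖z‖) / 2)} with hA
  have hTe : ∫⁻ r in Ici ((1 + ‖z‖) / 2), w r = T := rfl
  rw [hTe] at h
  have hlow : ∫⁻ ζ in A, normKernel w z ζ ∂(radialMeasure w) ≤ 7 := by
    have h1 := hw.lintegral_kernelFun_le hz ((1 + ‖z‖) / 2)
    calc ∫⁻ ζ in A, normKernel w z ζ ∂(radialMeasure w)
        = (∫⁻ ζ in A, ENNReal.ofReal (kernelFun z ζ) ∂(radialMeasure w)) * T⁻¹ := by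
          rw [← lintegral_mul_const' _ _ (ENNReal.inv_ne_top.2 hT0)]; rfl
      _ ≤ (ENNReal.ofReal (2 * Real.pi) * T) * T⁻¹ := by gcongr; exact h1
      _ = ENNReal.ofReal (2 * Real.pi) := by
          rw [mul_assoc, ENNReal.mul_inv_cancel hT0 hT1, mul_one]
      _ ≤ ENNReal.ofReal 7 := by
          apply ENNReal.ofReal_le_ofReal; linarith [Real.pi_lt_d2]
      _ = 7 := by simp
  calc ‖f z‖ₑ ^ t = (T * ‖f z‖ₑ ^ t) * T⁻¹ := by
        rw [mul_comm T, mul_assoc, ENNReal.mul_inv_cancel hT0 hT1, mul_one]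
    _ ≤ (16 * ∫⁻ ζ in A, ENNReal.ofReal (kernelFun z ζ) * ‖f ζ‖ₑ ^ t ∂(radialMeasure w)) * T⁻¹ := by
        gcongr
    _ = 16 * ∫⁻ ζ in A, normKernel w z ζ * ‖f ζ‖ₑ ^ t ∂(radialMeasure w) := by
        rw [mul_assoc, ← lintegral_mul_const' _ _ (ENNReal.inv_ne_top.2 hT0)]
        congr 1
        refine lintegral_congr fun ζ => ?_
        rw [normKernel]; ring
    _ ≤ 16 * ∫⁻ ζ in A, (τ * normKernel w z ζ + normKernel w z ζ *
          {ζ | τ < ‖f ζ‖ₑ ^ t}.indicator (fun ζ => ‖f ζ‖ₑ ^ t) ζ) ∂(radialMeasure w) := by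
        refine mul_le_mul_right (lintegral_mono fun ζ => ?_) _
        by_cases hζ : τ < ‖f ζ‖ₑ ^ t
        · rw [indicator_of_mem (show ζ ∈ {ζ | τ < ‖f ζ‖ₑ ^ t} from hζ)]
          exact le_add_self
        · refine le_trans ?_ le_self_add
          rw [mul_comm τ]
          gcongr
          exact not_lt.1 hζ
    _ = 16 * (τ * ∫⁻ ζ in A, normKernel w z ζ ∂(radialMeasure w) + ∫⁻ ζ in A, normKernel w z ζ *
          {ζ | τ < ‖f ζ‖ₑ ^ t}.indicator (fun ζ => ‖f ζ‖ₑ ^ t) ζ ∂(radialMeasure w)) := by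
        rw [lintegral_add_left (hkm.const_mul _), lintegral_const_mul _ hkm]
    _ ≤ 16 * (τ * 7 + ∫⁻ ζ, normKernel w z ζ *
          {ζ | τ < ‖f ζ‖ₑ ^ t}.indicator (fun ζ => ‖f ζ‖ₑ ^ t) ζ ∂(radialMeasure w)) := by
        gcongr
        exact Measure.restrict_le_self
    _ = _ := by ring

theorem volume_ofReal_lt_le (c : ℝ≥0∞) : volume (Ioi (0 : ℝ) ∩ {l | ENNReal.ofReal l < c}) ≤ c := by
  by_cases hc : c = ⊤
  · simp [hc]
  · calc volume (Ioi (0 : ℝ) ∩ {l | ENNReal.ofReal l < c}) ≤ volume (Ioo 0 c.toReal) := by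
          refine measure_mono fun l hl => ⟨hl.1, ?_⟩
          exact (ENNReal.ofReal_lt_iff_lt_toReal (le_of_lt hl.1) hc).1 hl.2
      _ = c := by rw [Real.volume_Ioo, sub_zero, ENNReal.ofReal_toReal hc]

/-- By Fubini each point ζ is counted for levels l < c g(ζ), a set of length at most c g(ζ). The
truncated L¹ norms, integrated over all levels, thus give the square of an L² norm. -/
theorem lintegral_setLIntegral_lt_le {m : Measure ℂ} [SFinite m] {g : ℂ → ℝ≥0∞}
    (hg : Measurable g) (c : ℝ≥0∞) (hc0 : c ≠ 0) (hc1 : c ≠ ⊤) :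
    ∫⁻ l in Ioi (0 : ℝ), ∫⁻ ζ, {ζ | ENNReal.ofReal l / c < g ζ}.indicator g ζ ∂m
      ≤ c * ∫⁻ ζ, g ζ * g ζ ∂m := by
  have hset : MeasurableSet {x : ℝ × ℂ | ENNReal.ofReal x.1 / c < g x.2} :=
    measurableSet_lt (measurable_fst.ennreal_ofReal.div_const c) (hg.comp measurable_snd)
  have hm : Measurable (Function.uncurry fun (l : ℝ) (ζ : ℂ) =>
      {ζ | ENNReal.ofReal l / c < g ζ}.indicator g ζ) :=
    (hg.comp measurable_snd).indicator hset
  rw [lintegral_lintegral_swap hm.aemeasurable,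
    ← lintegral_const_mul _ (show Measurable fun ζ => g ζ * g ζ from hg.mul hg)]
  refine lintegral_mono fun ζ => ?_
  have e : ∀ l : ℝ, {ζ | ENNReal.ofReal l / c < g ζ}.indicator g ζ
      = {l : ℝ | ENNReal.ofReal l < c * g ζ}.indicator (fun _ => g ζ) l := by
    intro l
    simp only [indicator, mem_ofPred_eq, ENNReal.div_lt_iff (Or.inl hc0) (Or.inl hc1), mul_comm]
  simp only [e]
  have hms : MeasurableSet {l : ℝ | ENNReal.ofReal l < c * g ζ} :=
    measurableSet_lt ENNReal.measurable_ofReal measurable_const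
  rw [lintegral_indicator_const hms, Measure.restrict_apply hms, inter_comm]
  calc g ζ * volume (Ioi (0 : ℝ) ∩ {l : ℝ | ENNReal.ofReal l < c * g ζ})
      ≤ g ζ * (c * g ζ) := by gcongr; exact volume_ofReal_lt_le _
    _ = _ := by ring

/-- The Carleson embedding `A^p_ω ⊆ L^{ps}_μ` for `s > 1`. -/
theorem IsProfile.lintegral_rpow_le_of_one_lt (hw : IsProfile w D) {s : ℝ} (hs : 1 < s)
    {μ : Measure ℂ} [IsFiniteMeasure μ] (hμ : AnnularCarleson w s 1 μ) {C : ℝ≥0∞}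
    (hC : ∀ y : ℕ → ℝ≥0∞, y 0 ≠ ⊤ → (∀ n, y (n + 1) ≤ 2⁻¹ * y n) →
      ∑' n, min (y n ^ (s - 1)) (y n)⁻¹ ≤ C)
    {p : ℝ} (hp : 0 < p) {f : ℂ → ℂ} (hfm : Measurable f) (hf : DifferentiableOn ℂ f disc) :
    ∫⁻ z in disc, ‖f z‖ₑ ^ (p * s) ∂μ ≤ ENNReal.ofReal (2 * s) * (32 * (2 * D ^ 2 * C)) ^ s *
      224 ^ s * (∫⁻ z, ‖f z‖ₑ ^ p ∂(radialMeasure w)) ^ s := by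
  have := hw.isFiniteMeasure
  have hs0 : 0 < s := by linarith
  -- Working with |f|^{p/2} makes the known integral an L² quantity, strictly above the L¹ endpoint
  -- of the weak type estimate.
  set t : ℝ := p / 2 with ht
  have ht0 : 0 < t := by positivity
  set g : ℂ → ℝ≥0∞ := fun z => ‖f z‖ₑ ^ t with hg
  have hgm : Measurable g := hfm.enorm.pow_const t
  set G := ∫⁻ z, ‖f z‖ₑ ^ p ∂(radialMeasure w) with hGdef
  have hgg : ∫⁻ z, g z * g z ∂(radialMeasure w) = G := by
    refine lintegral_congr fun z => ?_
    simp only [hg]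
    rw [← ENNReal.rpow_add_of_nonneg _ _ ht0.le ht0.le, ht, add_halves]
  set A := 2 * D ^ 2 * C with hA
  set I : ℝ → ℝ≥0∞ := fun l =>
    ∫⁻ ζ, {ζ | ENNReal.ofReal l / 224 < g ζ}.indicator g ζ ∂(radialMeasure w) with hI
  have hIset : ∀ l : ℝ, MeasurableSet {ζ | ENNReal.ofReal l / 224 < g ζ} := fun l =>
    measurableSet_lt measurable_const hgm
  have hmain : ∀ l : ℝ, 0 < l → (μ.restrict disc) {z | l < ‖f z‖ ^ t} *
      ENNReal.ofReal (l ^ (2 * s - 1)) ≤ (32 * A) ^ s * (224 * G) ^ (s - 1) * I l := by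
    intro l hl
    set E : Set ℂ := {z | l < ‖f z‖ ^ t} ∩ disc with hE
    have hEm0 : MeasurableSet {z | l < ‖f z‖ ^ t} :=
      measurableSet_lt measurable_const (hfm.norm.pow_const t)
    have hEm : MeasurableSet E := hEm0.inter Metric.isOpen_ball.measurableSet
    rw [Measure.restrict_apply hEm0]
    set Λ := ENNReal.ofReal l with hΛ
    have hΛ0 : Λ ≠ 0 := by simpa [hΛ] using hl
    have hΛ1 : Λ ≠ ⊤ := ENNReal.ofReal_ne_top
    -- The truncation height Λ/224 makes 112 · Λ/224 half of Λ; the remaining half, divided by 16,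
    -- is Λ/32.
    have hlow : ∀ z ∈ E, Λ / 32 ≤ ∫⁻ ζ, normKernel w z ζ *
        {ζ | Λ / 224 < g ζ}.indicator g ζ ∂(radialMeasure w) := by
      intro z hz
      have hz1 : ‖z‖ < 1 := mem_ball_zero_iff.1 hz.2
      have h1 := hw.enorm_rpow_le_lintegral_normKernel hfm hf hz1 ht0 (Λ / 224)
      set J := ∫⁻ ζ, normKernel w z ζ * {ζ | Λ / 224 < g ζ}.indicator g ζ ∂(radialMeasure w)
        with hJ
      have h2 : Λ ≤ ‖f z‖ₑ ^ t := by
        rw [← ofReal_norm, ENNReal.ofReal_rpow_of_nonneg (norm_nonneg _) ht0.le]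
        exact ENNReal.ofReal_le_ofReal (le_of_lt hz.1)
      have h3 : Λ ≤ 112 * (Λ / 224) + 16 * J := h2.trans h1
      by_cases hJ1 : J = ⊤
      · rw [hJ1]; exact le_top
      clear hJ
      clear_value J
      lift J to NNReal using hJ1
      have e : Λ = ((l.toNNReal : NNReal) : ℝ≥0∞) := rfl
      rw [e] at h3 ⊢
      have h4 : l.toNNReal ≤ 112 * (l.toNNReal / 224) + 16 * J := by
        have : ((l.toNNReal : NNReal) : ℝ≥0∞) ≤ ((112 * (l.toNNReal / 224) + 16 * J : NNReal) : ℝ≥0∞) := by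
          push_cast
          rwa [ENNReal.coe_div (by norm_num)]
        exact_mod_cast this
      have h5 : l.toNNReal / 32 ≤ J := by
        rw [← NNReal.coe_le_coe] at h4 ⊢
        push_cast at h4 ⊢
        linarith
      have h6 : ((l.toNNReal / 32 : NNReal) : ℝ≥0∞) ≤ J := by exact_mod_cast h5
      rwa [ENNReal.coe_div (by norm_num)] at h6
    have hweak := hw.weak_type hs hμ hC hEm inter_subset_right
      (hgm.indicator (hIset l)) hlow
    -- A Chebyshev bound: where g > Λ/224, the factor Λ is at most 224 g. It pays for s - 1 of the s
    -- powers of `I l` given by the weak type estimate, and the one left is integrated in l.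
    have hIΛ : I l * Λ ≤ 224 * G := by
      rw [← hgg, ← lintegral_const_mul _ (show Measurable fun ζ => g ζ * g ζ from hgm.mul hgm), hI]
      simp only
      rw [← lintegral_mul_const _ (hgm.indicator (hIset l))]
      refine lintegral_mono fun ζ => ?_
      by_cases hζ : Λ / 224 < g ζ
      · rw [indicator_of_mem (show ζ ∈ {ζ | Λ / 224 < g ζ} from hζ)]
        rw [ENNReal.div_lt_iff (Or.inl (by simp)) (Or.inl (by simp))] at hζ
        calc g ζ * Λ ≤ g ζ * (g ζ * 224) := by gcongr
          _ = _ := by ring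
      · rw [indicator_of_notMem (show ζ ∉ {ζ | Λ / 224 < g ζ} from hζ)]
        simp
    have hpow : ENNReal.ofReal (l ^ (2 * s - 1)) = Λ ^ s * Λ ^ (s - 1) := by
      rw [← ENNReal.ofReal_rpow_of_pos hl, ← ENNReal.rpow_add _ _ hΛ0 hΛ1]
      congr 1; ring
    have hdiv : Λ ^ s = 32 ^ s * (Λ / 32) ^ s := by
      rw [← ENNReal.mul_rpow_of_nonneg _ _ hs0.le, ENNReal.mul_div_cancel (by simp) (by simp)]
    calc μ E * ENNReal.ofReal (l ^ (2 * s - 1))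
        = 32 ^ s * ((Λ / 32) ^ s * μ E) * Λ ^ (s - 1) := by rw [hpow, hdiv]; ring
      _ ≤ 32 ^ s * (A * I l) ^ s * Λ ^ (s - 1) := by gcongr
      _ = (32 * A) ^ s * (I l ^ (s - 1) * I l) * Λ ^ (s - 1) := by
          have e1 : I l ^ s = I l ^ (s - 1) * I l := by
            conv_rhs => rw [← ENNReal.rpow_one (I l), ← ENNReal.rpow_mul, one_mul,
              ← ENNReal.rpow_add_of_nonneg _ _ (by linarith : 0 ≤ s - 1) zero_le_one,
              sub_add_cancel]
          rw [ENNReal.mul_rpow_of_nonneg A _ hs0.le, e1, ENNReal.mul_rpow_of_nonneg 32 _ hs0.le]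
          ring
      _ = (32 * A) ^ s * (I l * Λ) ^ (s - 1) * I l := by
          rw [ENNReal.mul_rpow_of_nonneg _ _ (by linarith : 0 ≤ s - 1)]; ring
      _ ≤ (32 * A) ^ s * (224 * G) ^ (s - 1) * I l := by
          gcongr
  have hlayer := lintegral_rpow_eq_lintegral_meas_lt_mul (μ.restrict disc)
    (f := fun z => ‖f z‖ ^ t) (Eventually.of_forall fun z => by positivity)
    (hfm.norm.pow_const t).aemeasurable (p := 2 * s) (by linarith)
  have hlhs : ∫⁻ z in disc, ‖f z‖ₑ ^ (p * s) ∂μ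
      = ∫⁻ z in disc, ENNReal.ofReal ((‖f z‖ ^ t) ^ (2 * s)) ∂μ := by
    refine lintegral_congr fun z => ?_
    rw [← Real.rpow_mul (norm_nonneg _), ← ofReal_norm,
      ENNReal.ofReal_rpow_of_nonneg (norm_nonneg _) (by positivity)]
    congr 2
    rw [ht]; ring
  have hImeas : Measurable I := by
    have : Antitone I := fun l₁ l₂ h => lintegral_mono
      (indicator_le_indicator_of_subset (fun ζ hζ => lt_of_le_of_lt
        (ENNReal.div_le_div_right (ENNReal.ofReal_le_ofReal h) _) hζ) fun _ => zero_le)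
    exact this.measurable
  rw [hlhs, hlayer]
  calc ENNReal.ofReal (2 * s) * ∫⁻ l in Ioi (0 : ℝ), (μ.restrict disc) {z | l < ‖f z‖ ^ t} *
        ENNReal.ofReal (l ^ (2 * s - 1))
      ≤ ENNReal.ofReal (2 * s) * ∫⁻ l in Ioi (0 : ℝ),
          (32 * A) ^ s * (224 * G) ^ (s - 1) * I l :=
        mul_le_mul_right (setLIntegral_mono' measurableSet_Ioi hmain) _
    _ = ENNReal.ofReal (2 * s) * ((32 * A) ^ s * (224 * G) ^ (s - 1) *
          ∫⁻ l in Ioi (0 : ℝ), I l) := by rw [lintegral_const_mul _ hImeas]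
    _ ≤ ENNReal.ofReal (2 * s) * ((32 * A) ^ s * (224 * G) ^ (s - 1) * (224 * G)) := by
        gcongr
        rw [← hgg]
        exact lintegral_setLIntegral_lt_le hgm 224 (by simp) (by simp)
    _ = ENNReal.ofReal (2 * s) * ((32 * A) ^ s * (224 * G) ^ s) := by
        congr 1
        rw [mul_assoc]
        congr 1
        nth_rewrite 2 [← ENNReal.rpow_one (224 * G)]
        rw [← ENNReal.rpow_add_of_nonneg _ _ (by linarith : 0 ≤ s - 1) zero_le_one,
          sub_add_cancel]
    _ = _ := by
        rw [ENNReal.mul_rpow_of_nonneg 224 _ hs0.le]; ring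

/-! ### The embedding for arbitrary Borel measures -/

/-- Measures satisfying a Carleson condition with constant `κ` embed `A^p_ω` in `L^q`, with norm
controlled by `K κ`. -/
def HasCarlesonEmbedding (w : ℝ → ℝ≥0∞) (p q : ℝ) (K : ℝ≥0∞) : Prop :=
  ∀ (μ : Measure ℂ) (κ : ℝ≥0∞), κ ≠ 0 → κ ≠ ⊤ →
    (∀ a : ℂ, ‖a‖ < 1 → μ (nearRegion a) ≤ κ * boxMass w a ^ (q / p)) →
    ∀ f : ℂ → ℂ, Measurable f → DifferentiableOn ℂ f disc →
      ∫⁻ z in disc, ‖f z‖ₑ ^ q ∂μ ≤ K * κ * (∫⁻ z, ‖f z‖ₑ ^ p ∂(radialMeasure w)) ^ (q / p)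

theorem nearRegion_mem_nhds {a : ℂ} (ha : ‖a‖ < 1) : nearRegion a ∈ 𝓝 a := by
  refine Filter.mem_of_superset (Metric.ball_mem_nhds a (by linarith : 0 < (1 - ‖a‖) / 2)) ?_
  intro z hz
  rw [mem_ball_iff_norm] at hz
  have h1 := norm_sub_norm_le z a
  exact ⟨by linarith, by linarith, by linarith⟩

theorem measure_closedBall_lt_top {μ : Measure ℂ} (hμ : ∀ a : ℂ, ‖a‖ < 1 → μ (nearRegion a) ≠ ⊤)
    {R : ℝ} (hR : R < 1) : μ (Metric.closedBall 0 R) < ⊤ := by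
  refine (isCompact_closedBall (0 : ℂ) R).measure_lt_top_of_nhdsWithin fun a ha => ?_
  have ha1 : ‖a‖ < 1 := lt_of_le_of_lt (mem_closedBall_zero_iff.1 ha) hR
  exact ⟨nearRegion a, mem_nhdsWithin_of_mem_nhds (nearRegion_mem_nhds ha1), (hμ a ha1).lt_top⟩

/-- No finiteness of μ is assumed, but the condition makes each closed ball inside the disc of
finite mass. Restricting to an exhaustion by such balls makes Fubini available, scaling by the
inverse constant normalizes the annular condition to 1, and monotone convergence returns to μ with a
bound linear in κ. -/
theorem IsProfile.hasCarlesonEmbedding_of_finite (hw : IsProfile w D) {p q : ℝ} {K : ℝ≥0∞}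
    (hp : 0 < p) (hq : 0 < q)
    (h : ∀ (μ : Measure ℂ) [IsFiniteMeasure μ],
      AnnularCarleson w (q / p) 1 μ → ∀ f : ℂ → ℂ, Measurable f → DifferentiableOn ℂ f disc →
      ∫⁻ z in disc, ‖f z‖ₑ ^ q ∂μ ≤ K * (∫⁻ z, ‖f z‖ₑ ^ p ∂(radialMeasure w)) ^ (q / p)) :
    HasCarlesonEmbedding w p q (K * ENNReal.ofReal (50 * Real.pi)) := by
  intro μ κ hκ0 hκ1 hμ f hfm hf
  have hs0 : 0 < q / p := by positivity
  set c := ENNReal.ofReal (50 * Real.pi) with hc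
  have hc0 : c * κ ≠ 0 := mul_ne_zero (by simp [hc, Real.pi_pos]) hκ0
  have hc1 : c * κ ≠ ⊤ := ENNReal.mul_ne_top ENNReal.ofReal_ne_top hκ1
  have hfin : ∀ a : ℂ, ‖a‖ < 1 → μ (nearRegion a) ≠ ⊤ := fun a ha =>
    ne_top_of_le_ne_top (ENNReal.mul_ne_top hκ1
      (ENNReal.rpow_ne_top_of_nonneg hs0.le (hw.boxMass_ne_top a))) (hμ a ha)
  have hB1 : ∀ n : ℕ, (1 : ℝ) - (1 / 2) ^ n < 1 := fun n => by
    have : (0 : ℝ) < (1 / 2) ^ n := by positivity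
    linarith
  set B : ℕ → Set ℂ := fun n => Metric.closedBall 0 (1 - (1 / 2) ^ n) with hB
  have hBm : Monotone B := by
    intro i j hij
    apply Metric.closedBall_subset_closedBall
    have : (1 / 2 : ℝ) ^ j ≤ (1 / 2) ^ i := pow_le_pow_of_le_one (by norm_num) (by norm_num) hij
    linarith
  have hBu : ⋃ n, B n = disc := by
    ext z
    simp only [mem_iUnion, hB, mem_closedBall_zero_iff, mem_ball_zero_iff]
    constructor
    · rintro ⟨n, hn⟩
      exact hn.trans_lt (hB1 n)
    · intro hz
      obtain ⟨n, hn⟩ := exists_pow_lt_of_lt_one (by linarith : 0 < 1 - ‖z‖)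
        (by norm_num : (1 / 2 : ℝ) < 1)
      exact ⟨n, by linarith⟩
  rw [← hBu, setLIntegral_iUnion_of_directed _ hBm.directed_le]
  refine iSup_le fun n => ?_
  have : IsFiniteMeasure (μ.restrict (B n)) := isFiniteMeasure_restrict.2
    (measure_closedBall_lt_top hfin (hB1 n)).ne
  have h1 : AnnularCarleson w (q / p) (c * κ) (μ.restrict (B n)) :=
    annularCarleson_of_nearRegion fun a ha =>
      (Measure.restrict_apply_le _ _).trans (hμ a ha)
  set ν : Measure ℂ := (c * κ)⁻¹ • μ.restrict (B n) with hν
  have hi0 : (c * κ)⁻¹ ≠ ⊤ := ENNReal.inv_ne_top.2 hc0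
  have : IsFiniteMeasure ν := Measure.smul_finite _ hi0
  have h2 : AnnularCarleson w (q / p) 1 ν := by
    intro ζ hζ k
    rw [hν, Measure.restrict_smul, lintegral_smul_measure, smul_eq_mul]
    refine (mul_le_mul_right (h1 ζ hζ k) _).trans ?_
    rw [← mul_assoc, ENNReal.inv_mul_cancel hc0 hc1]
  have h3 := h ν h2 f hfm hf
  rw [hν, Measure.restrict_smul, lintegral_smul_measure, smul_eq_mul,
    Measure.restrict_restrict Metric.isOpen_ball.measurableSet,
    inter_eq_right.2 (hBu.subset.trans' (subset_iUnion B n))] at h3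
  calc ∫⁻ z in B n, ‖f z‖ₑ ^ q ∂μ
      = (c * κ) * ((c * κ)⁻¹ * ∫⁻ z in B n, ‖f z‖ₑ ^ q ∂μ) := by
        rw [← mul_assoc, ENNReal.mul_inv_cancel hc0 hc1, one_mul]
    _ ≤ (c * κ) * (K * (∫⁻ z, ‖f z‖ₑ ^ p ∂(radialMeasure w)) ^ (q / p)) := by gcongr
    _ = _ := by ring

theorem IsProfile.exists_hasCarlesonEmbedding_of_lt (hw : IsProfile w D) {p q : ℝ}
    (hp : 0 < p) (hpq : p < q) : ∃ K : ℝ≥0∞, K ≠ ⊤ ∧ HasCarlesonEmbedding w p q K := by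
  have hs : 1 < q / p := (one_lt_div hp).2 hpq
  obtain ⟨C, hC1, hC⟩ := exists_tsum_min_le (sub_pos.2 hs)
  have hD := hw.const_ne_top
  refine ⟨(ENNReal.ofReal (2 * (q / p)) * (32 * (2 * D ^ 2 * C)) ^ (q / p) * 224 ^ (q / p)) * _, ?_,
    hw.hasCarlesonEmbedding_of_finite hp (hp.trans hpq)
    fun μ _ hμ f hfm hf => ?_⟩
  rotate_left
  · have := hw.lintegral_rpow_le_of_one_lt hs hμ hC hp hfm hf
    rwa [mul_div_cancel₀ _ hp.ne'] at this
  · have h1 : (32 * (2 * D ^ 2 * C)) ^ (q / p) ≠ ⊤ :=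
      ENNReal.rpow_ne_top_of_nonneg (by linarith) (by finiteness)
    have h2 : (224 : ℝ≥0∞) ^ (q / p) ≠ ⊤ := ENNReal.rpow_ne_top_of_nonneg (by linarith) (by simp)
    finiteness

theorem IsProfile.exists_hasCarlesonEmbedding_of_lower (hw : IsProfile w D) {N : ℕ} {c : ℝ≥0∞}
    (hc : c ≠ ⊤) (hlow : ∀ r ∈ Ico (0 : ℝ) 1,
      tailMass w r ≤ c * ∫⁻ s in Ico r (1 - (1 - r) / 2 ^ N), w s)
    {p : ℝ} (hp : 0 < p) : ∃ K : ℝ≥0∞, K ≠ ⊤ ∧ HasCarlesonEmbedding w p p K := by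
  have hD := hw.const_ne_top
  refine ⟨(32 * D ^ 2 * c * N * 1) * _, ?_, hw.hasCarlesonEmbedding_of_finite hp hp fun μ _ hμ f hfm hf => ?_⟩
  rotate_left
  · rw [div_self hp.ne'] at hμ ⊢
    rw [ENNReal.rpow_one]
    exact hw.lintegral_rpow_le_of_lower hlow hμ hp hfm hf
  · finiteness

/-! ### Norms and image measures of weighted composition operators -/

theorem measurableSet_disc : MeasurableSet disc := Metric.isOpen_ball.measurableSet

/-- Elements of the spaces are controlled only on the disc; extension by zero makes them Borel on
the plane, as image measures and the embedding require. -/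
theorem measurable_indicator_disc {f : ℂ → ℂ} (hf : ContinuousOn f disc) :
    Measurable (disc.indicator f) := by
  classical
  rw [← piecewise_eq_indicator]
  exact hf.measurable_piecewise continuousOn_const measurableSet_disc

theorem differentiableOn_indicator_disc {f : ℂ → ℂ} (hf : DifferentiableOn ℂ f disc) :
    DifferentiableOn ℂ (disc.indicator f) disc :=
  hf.congr fun _ hz => indicator_of_mem hz f

theorem aestronglyMeasurable_restrict_disc {f : ℂ → ℂ} (hf : ContinuousOn f disc)
    (ν : Measure ℂ) : AEStronglyMeasurable f (ν.restrict disc) :=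
  hf.aestronglyMeasurable measurableSet_disc

theorem lpNorm_eq {q : ℝ} (hq : 0 < q) (ν : Measure ℂ) (f : ℂ → ℂ) :
    lpNorm q ν f = (∫⁻ z in disc, ‖f z‖ₑ ^ q ∂ν) ^ (1 / q) := by
  rw [lpNorm, eLpNorm_eq_lintegral_rpow_enorm_toReal (by simpa using hq) ENNReal.ofReal_ne_top,
    ENNReal.toReal_ofReal hq.le]

theorem lpNorm_rpow {q : ℝ} (hq : 0 < q) (ν : Measure ℂ) (f : ℂ → ℂ) :
    lpNorm q ν f ^ q = ∫⁻ z in disc, ‖f z‖ₑ ^ q ∂ν := by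
  rw [lpNorm_eq hq, ← ENNReal.rpow_mul, one_div_mul_cancel hq.ne', ENNReal.rpow_one]

theorem bergmanNorm_rpow {p : ℝ} (hp : 0 < p) {ω : ℝ → ℝ}
    (hω : (weightMeasure ω).restrict disc = radialMeasure w) (f : ℂ → ℂ) :
    bergmanNorm p ω f ^ p = ∫⁻ z, ‖f z‖ₑ ^ p ∂(radialMeasure w) := by
  rw [bergmanNorm, lpNorm_rpow hp, hω]

theorem memLebesgue_iff {q : ℝ} (hq : 0 < q) (ν : Measure ℂ) {f : ℂ → ℂ}
    (hf : AEStronglyMeasurable f (ν.restrict disc)) :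
    MemLebesgue q ν f ↔ ∫⁻ z in disc, ‖f z‖ₑ ^ q ∂ν ≠ ⊤ := by
  rw [← lpNorm_rpow hq, Ne, ENNReal.rpow_eq_top_iff_of_pos hq]
  exact ⟨fun h => h.2.ne, fun h => ⟨hf, lt_top_iff_ne_top.2 h⟩⟩

theorem memBergman_iff {p : ℝ} (hp : 0 < p) {ω : ℝ → ℝ}
    (hω : (weightMeasure ω).restrict disc = radialMeasure w) {f : ℂ → ℂ} :
    MemBergman p ω f ↔
      DifferentiableOn ℂ f disc ∧ ∫⁻ z, ‖f z‖ₑ ^ p ∂(radialMeasure w) ≠ ⊤ := by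
  refine and_congr_right fun hf => ?_
  rw [memLebesgue_iff hp _ (aestronglyMeasurable_restrict_disc hf.continuousOn _), hω]

theorem lintegral_radialMeasure_indicator_disc (hw : IsProfile w D) (f : ℂ → ℂ) (p : ℝ) :
    ∫⁻ z, ‖disc.indicator f z‖ₑ ^ p ∂(radialMeasure w)
      = ∫⁻ z, ‖f z‖ₑ ^ p ∂(radialMeasure w) := by
  refine lintegral_congr_ae ?_
  filter_upwards [ae_radialMeasure_norm_lt_one hw] with z hz
  rw [indicator_of_mem (mem_ball_zero_iff.2 hz)]

/-- The image under `φ` of the measure `|u|^q ν` on the disc. -/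
def pullMeasure (q : ℝ) (ν : Measure ℂ) (u φ : ℂ → ℂ) : Measure ℂ :=
  Measure.map (disc.indicator φ)
    ((ν.restrict disc).withDensity fun z => ‖disc.indicator u z‖ₑ ^ q)

theorem lintegral_pullMeasure {q : ℝ} {ν : Measure ℂ} {u φ : ℂ → ℂ} (hu : ContinuousOn u disc)
    (hφ : ContinuousOn φ disc) {F : ℂ → ℝ≥0∞} (hF : Measurable F) :
    ∫⁻ z, F z ∂(pullMeasure q ν u φ) = ∫⁻ z in disc, ‖u z‖ₑ ^ q * F (φ z) ∂ν := by
  have hφm := measurable_indicator_disc hφ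
  have hum := measurable_indicator_disc hu
  have hFφ : Measurable fun z => F (disc.indicator φ z) := hF.comp hφm
  rw [pullMeasure, lintegral_map hF hφm,
    lintegral_withDensity_eq_lintegral_mul _ (hum.enorm.pow_const q) hFφ]
  refine setLIntegral_congr_fun measurableSet_disc fun z hz => ?_
  simp only [Pi.mul_apply, indicator_of_mem hz]

theorem setLIntegral_pullMeasure {q : ℝ} {ν : Measure ℂ} {u φ : ℂ → ℂ} (hu : ContinuousOn u disc)
    (hφ : ContinuousOn φ disc) {F : ℂ → ℝ≥0∞} (hF : Measurable F) {A : Set ℂ}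
    (hA : MeasurableSet A) :
    ∫⁻ z in A, F z ∂(pullMeasure q ν u φ)
      = ∫⁻ z in disc, ‖u z‖ₑ ^ q * A.indicator F (φ z) ∂ν := by
  rw [← lintegral_indicator hA, lintegral_pullMeasure hu hφ (hF.indicator hA)]

theorem pullMeasure_apply {q : ℝ} {ν : Measure ℂ} {u φ : ℂ → ℂ} (hu : ContinuousOn u disc)
    (hφ : ContinuousOn φ disc) {A : Set ℂ} (hA : MeasurableSet A) :
    pullMeasure q ν u φ A = ∫⁻ z in disc, ‖u z‖ₑ ^ q * A.indicator 1 (φ z) ∂ν := by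
  rw [← setLIntegral_one, setLIntegral_pullMeasure hu hφ measurable_const hA]
  rfl

/-- The `L^q` norm of a weighted composition operator through the image measure. -/
theorem lintegral_weightedCompOp {q : ℝ} (hq : 0 < q) {ν : Measure ℂ} {u φ : ℂ → ℂ}
    (hu : ContinuousOn u disc) (hφ : IsAnalyticSelfMap φ) {f : ℂ → ℂ} (hf : ContinuousOn f disc) :
    ∫⁻ z in disc, ‖weightedCompOp u φ f z‖ₑ ^ q ∂ν
      = ∫⁻ z in disc, ‖disc.indicator f z‖ₑ ^ q ∂(pullMeasure q ν u φ) := by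
  rw [setLIntegral_pullMeasure hu hφ.1.continuousOn
    ((measurable_indicator_disc hf).enorm.pow_const q) measurableSet_disc]
  refine setLIntegral_congr_fun measurableSet_disc fun z hz => ?_
  have hm := hφ.2 hz
  simp only [weightedCompOp, Pi.mul_apply, Function.comp_apply, indicator_of_mem hm, enorm_mul]
  exact ENNReal.mul_rpow_of_nonneg _ _ hq.le

theorem aestronglyMeasurable_weightedCompOp {ν : Measure ℂ} {u φ : ℂ → ℂ}
    (hu : ContinuousOn u disc) (hφ : IsAnalyticSelfMap φ) {f : ℂ → ℂ} (hf : ContinuousOn f disc) :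
    AEStronglyMeasurable (weightedCompOp u φ f) (ν.restrict disc) :=
  aestronglyMeasurable_restrict_disc
    (hu.mul (hf.comp hφ.1.continuousOn hφ.2)) ν

/-- A Carleson condition on the image measure makes the weighted composition operator bounded. -/
theorem isBoundedOperator_weightedCompOp (hw : IsProfile w D) {p q : ℝ} (hp : 0 < p) (hq : 0 < q)
    {K : ℝ≥0∞} (hK : K ≠ ⊤) (hemb : HasCarlesonEmbedding w p q K) {ω : ℝ → ℝ}
    (hω : (weightMeasure ω).restrict disc = radialMeasure w) {ν : Measure ℂ} {u φ : ℂ → ℂ}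
    (hu : ContinuousOn u disc) (hφ : IsAnalyticSelfMap φ) {κ : ℝ≥0∞} (hκ0 : κ ≠ 0) (hκ1 : κ ≠ ⊤)
    (hμ : ∀ a : ℂ, ‖a‖ < 1 →
      pullMeasure q ν u φ (nearRegion a) ≤ κ * boxMass w a ^ (q / p)) :
    IsBoundedOperator p q ω ν (weightedCompOp u φ) := by
  have key : ∀ f, MemBergman p ω f → ∫⁻ z in disc, ‖weightedCompOp u φ f z‖ₑ ^ q ∂ν
      ≤ K * κ * bergmanNorm p ω f ^ q := by
    intro f hf
    have hfc := hf.1.continuousOn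
    rw [lintegral_weightedCompOp hq hu hφ hfc]
    refine (hemb _ κ hκ0 hκ1 hμ _ (measurable_indicator_disc hfc)
      (differentiableOn_indicator_disc hf.1)).trans (le_of_eq ?_)
    rw [lintegral_radialMeasure_indicator_disc hw, ← bergmanNorm_rpow hp hω, ← ENNReal.rpow_mul,
      mul_div_cancel₀ _ hp.ne']
  have hfin : ∀ f, MemBergman p ω f → bergmanNorm p ω f ≠ ⊤ := fun f hf => hf.2.2.ne
  refine ⟨fun f hf => ?_, ?_⟩
  · rw [memLebesgue_iff hq _ (aestronglyMeasurable_weightedCompOp hu hφ hf.1.continuousOn)]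
    refine ne_top_of_le_ne_top (ENNReal.mul_ne_top (ENNReal.mul_ne_top hK hκ1) ?_) (key f hf)
    exact ENNReal.rpow_ne_top_of_nonneg hq.le (hfin f hf)
  · have hC : (K * κ) ^ (1 / q) ≠ ⊤ :=
      ENNReal.rpow_ne_top_of_nonneg (by positivity) (ENNReal.mul_ne_top hK hκ1)
    refine ⟨((K * κ) ^ (1 / q)).toNNReal, fun f hf => ?_⟩
    rw [ENNReal.coe_toNNReal hC, lpNorm_eq hq]
    calc _ ≤ (K * κ * bergmanNorm p ω f ^ q) ^ (1 / q) := by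
          gcongr
          exact key f hf
      _ = _ := by
          rw [ENNReal.mul_rpow_of_nonneg _ _ (by positivity), ← ENNReal.rpow_mul,
            mul_one_div_cancel hq.ne', ENNReal.rpow_one]

/-! ### From the test functions to a Carleson condition -/

/-- The total size of the two test functions at `a` under the difference of composition
operators. -/
def testEnergy (q : ℝ) (ν : Measure ℂ) (φ ψ : ℂ → ℂ) (γ : ℕ) (a : ℂ) : ℝ≥0∞ :=
  (∫⁻ z in disc, ‖(compOp φ - compOp ψ) (mobius a * testFun γ a) z‖ₑ ^ q ∂ν)
    + ∫⁻ z in disc, ‖(compOp φ - compOp ψ) (testFun γ a) z‖ₑ ^ q ∂ν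

theorem add_rpow_le_two_rpow_mul {q : ℝ} (hq : 0 ≤ q) (x y : ℝ≥0∞) :
    (x + y) ^ q ≤ 2 ^ q * (x ^ q + y ^ q) := by
  rcases le_total x y with h | h
  · calc (x + y) ^ q ≤ (2 * y) ^ q := by
          gcongr
          rw [two_mul]; gcongr
      _ = 2 ^ q * y ^ q := ENNReal.mul_rpow_of_nonneg _ _ hq
      _ ≤ _ := by gcongr; exact le_add_self
  · calc (x + y) ^ q ≤ (2 * x) ^ q := by
          gcongr
          rw [two_mul]; gcongr
      _ = 2 ^ q * x ^ q := ENNReal.mul_rpow_of_nonneg _ _ hq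
      _ ≤ _ := by gcongr; exact le_self_add

theorem continuousOn_compOp_sub {φ ψ : ℂ → ℂ} (hφ : IsAnalyticSelfMap φ)
    (hψ : IsAnalyticSelfMap ψ) {f : ℂ → ℂ} (hf : ContinuousOn f disc) :
    ContinuousOn ((compOp φ - compOp ψ) f) disc :=
  (hf.comp hφ.1.continuousOn hφ.2).sub (hf.comp hψ.1.continuousOn hψ.2)

/-- Where φ(z) is near a, |δ(z)| is bounded by the sum of the two image functions at z. The weight u
is only required to have modulus |δ|, so that the same δ serves after φ and ψ are exchanged. The
constant is 20 · 3 · 2, the last factor coming from the quasi-triangle inequality for q-th powers.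
-/
theorem pullMeasure_nearRegion_le {q : ℝ} (hq : 0 < q) {ν : Measure ℂ} {u φ ψ : ℂ → ℂ}
    (hu : ContinuousOn u disc) (hud : ∀ z ∈ disc, ‖u z‖ = ‖delta φ ψ z‖)
    (hφ : IsAnalyticSelfMap φ) (hψ : IsAnalyticSelfMap ψ) (γ : ℕ) {a : ℂ} (ha : ‖a‖ < 1) :
    pullMeasure q ν u φ (nearRegion a) ≤ (120 * 4 ^ γ) ^ q * testEnergy q ν φ ψ γ a := by
  have hT : ∀ f : ℂ → ℂ, ContinuousOn f disc →
      AEMeasurable (fun z => ‖(compOp φ - compOp ψ) f z‖ₑ ^ q) (ν.restrict disc) := fun f hf =>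
    (aestronglyMeasurable_restrict_disc
      (continuousOn_compOp_sub hφ hψ hf) ν).enorm.pow_const q
  have hc1 := (differentiableOn_testFun γ ha).continuousOn
  have hc2 := ((differentiableOn_mobius ha).continuousOn.mul hc1)
  have hfin : ((120 : ℝ≥0∞) * 4 ^ γ) ^ q ≠ ⊤ :=
    ENNReal.rpow_ne_top_of_nonneg hq.le (by finiteness)
  rw [pullMeasure_apply hu hφ.1.continuousOn (measurableSet_nearRegion a), testEnergy,
    ← lintegral_add_left' (hT _ hc2), ← lintegral_const_mul' _ _ hfin]
  refine setLIntegral_mono' measurableSet_disc fun z hz => ?_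
  by_cases hn : φ z ∈ nearRegion a; swap
  · rw [indicator_of_notMem hn]; simp
  rw [indicator_of_mem hn, Pi.one_apply, mul_one]
  have h := norm_div_le_of_mem_nearRegion ha hn (mem_ball_zero_iff.1 (hψ.2 hz)) γ
  set A := (compOp φ - compOp ψ) (mobius a * testFun γ a) z with hA
  set B := (compOp φ - compOp ψ) (testFun γ a) z with hB
  have hA' : mobius a (φ z) * testFun γ a (φ z) - mobius a (ψ z) * testFun γ a (ψ z) = A := rfl
  have hB' : testFun γ a (φ z) - testFun γ a (ψ z) = B := rfl
  have hd : (ψ z - φ z) / (1 - (starRingEnd ℂ) (ψ z) * φ z) = delta φ ψ z := rfl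
  rw [hA', hB', hd, ← hud z hz] at h
  have h1 : ‖u z‖ ≤ (60 * 4 ^ γ) * (‖A‖ + ‖B‖) := by
    refine h.trans ?_
    have : (0 : ℝ) < 4 ^ γ := by positivity
    have h3 : ‖A‖ + 3 * ‖B‖ ≤ 3 * (‖A‖ + ‖B‖) := by linarith [norm_nonneg A]
    calc 20 * 4 ^ γ * (‖A‖ + 3 * ‖B‖) ≤ 20 * 4 ^ γ * (3 * (‖A‖ + ‖B‖)) := by gcongr
      _ = _ := by ring
  have h2 : ‖u z‖ₑ ≤ (60 * 4 ^ γ) * (‖A‖ₑ + ‖B‖ₑ) := by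
    rw [← ofReal_norm, ← ofReal_norm, ← ofReal_norm, ← ENNReal.ofReal_add (norm_nonneg _)
      (norm_nonneg _)]
    calc ENNReal.ofReal ‖u z‖ ≤ ENNReal.ofReal ((60 * 4 ^ γ) * (‖A‖ + ‖B‖)) :=
          ENNReal.ofReal_le_ofReal h1
      _ = _ := by
          rw [ENNReal.ofReal_mul (by positivity), ENNReal.ofReal_mul (by norm_num),
            ENNReal.ofReal_pow (by norm_num)]
          simp only [ENNReal.ofReal_ofNat]
  calc ‖u z‖ₑ ^ q ≤ ((60 * 4 ^ γ) * (‖A‖ₑ + ‖B‖ₑ)) ^ q := by gcongr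
    _ = (60 * 4 ^ γ) ^ q * (‖A‖ₑ + ‖B‖ₑ) ^ q := ENNReal.mul_rpow_of_nonneg _ _ hq.le
    _ ≤ (60 * 4 ^ γ) ^ q * (2 ^ q * (‖A‖ₑ ^ q + ‖B‖ₑ ^ q)) := by
        gcongr
        exact add_rpow_le_two_rpow_mul hq.le _ _
    _ = _ := by
        rw [← mul_assoc, ← ENNReal.mul_rpow_of_nonneg _ _ hq.le]
        congr 2
        ring

theorem IsProfile.lintegral_mobius_mul_testFun_le (hw : IsProfile w D) {p : ℝ} (hp : 0 < p) (γ : ℕ)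
    {a : ℂ} (ha : ‖a‖ < 1) :
    ∫⁻ z, ‖(mobius a * testFun γ a) z‖ₑ ^ p ∂(radialMeasure w)
      ≤ 3 ^ p * ∫⁻ z, ‖testFun γ a z‖ₑ ^ p ∂(radialMeasure w) := by
  rw [← lintegral_const_mul _ ((measurable_testFun γ a).enorm.pow_const p)]
  refine lintegral_mono_ae ?_
  filter_upwards [ae_radialMeasure_norm_lt_one hw] with z hz
  rw [← ENNReal.mul_rpow_of_nonneg _ _ hp.le, Pi.mul_apply, enorm_mul]
  gcongr
  rw [← ofReal_norm, show (3 : ℝ≥0∞) = ENNReal.ofReal 3 by simp]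
  exact ENNReal.ofReal_le_ofReal (norm_mobius_le ha hz)

/-! ### Normal families and the vanishing Carleson condition -/

/-- Montel's theorem in the disc, for pointwise convergence. -/
theorem exists_subseq_tendsto_of_locally_bounded {f : ℕ → ℂ → ℂ}
    (hf : ∀ n, DifferentiableOn ℂ (f n) disc)
    (hb : ∀ R : ℝ, 0 < R → R < 1 → ∃ B : ℝ, ∀ n z, ‖z‖ ≤ R → ‖f n z‖ ≤ B) :
    ∃ (g : ℂ → ℂ) (k : ℕ → ℕ), DifferentiableOn ℂ g disc ∧ StrictMono k ∧
      ∀ z ∈ disc, Tendsto (fun n => f (k n) z) atTop (𝓝 (g z)) := by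
  set a : ℕ → ℕ → ℂ := fun n i => (i.factorial : ℂ)⁻¹ * iteratedDeriv i (f n) 0 with ha
  have hsum : ∀ n, ∀ z ∈ disc, HasSum (fun i => a n i * z ^ i) (f n z) := by
    intro n z hz
    have h := Complex.hasSum_taylorSeries_on_ball (hf n) hz
    simp only [sub_zero, smul_eq_mul] at h
    refine h.congr_fun fun i => ?_
    simp only [ha]; ring
  have hcoef : ∀ R : ℝ, 0 < R → R < 1 → ∃ B : ℝ, 0 ≤ B ∧ ∀ n i, ‖a n i‖ ≤ B / R ^ i := by
    intro R hR0 hR1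
    obtain ⟨B, hB⟩ := hb R hR0 hR1
    refine ⟨B, (norm_nonneg _).trans (hB 0 0 (by simpa using hR0.le)), fun n i => ?_⟩
    have hcb : Metric.closedBall (0 : ℂ) R ⊆ disc := Metric.closedBall_subset_ball hR1
    have h := Complex.norm_iteratedDeriv_le_of_forall_mem_sphere_norm_le (c := 0) (f := f n) i hR0
      (((hf n).mono hcb).diffContOnCl_ball le_rfl)
      fun z hz => hB n z (mem_sphere_zero_iff_norm.1 hz).le
    rw [ha, norm_mul, norm_inv, Complex.norm_natCast, inv_mul_le_iff₀ (by positivity)]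
    rwa [← mul_div_assoc]
  obtain ⟨B, hB0, hB⟩ := hcoef (1 / 2) (by norm_num) (by norm_num)
  -- Cauchy estimates on the circle of radius 1/2 put the coefficient sequences in a compact product
  -- of discs, so a subsequence converges coefficientwise. The estimates for every R < 1 pass to the
  -- limit and dominate the power series throughout the disc.
  have hcomp : IsCompact (Set.pi univ fun i : ℕ => Metric.closedBall (0 : ℂ) (B / (1 / 2) ^ i)) :=
    isCompact_univ_pi fun i => isCompact_closedBall _ _
  obtain ⟨c, hc, k, hk, hlim⟩ := hcomp.isSeqCompact (x := a) fun n i _ => by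
    rw [mem_closedBall_zero_iff]; exact hB n i
  have hlim' : ∀ i, Tendsto (fun n => a (k n) i) atTop (𝓝 (c i)) := fun i =>
    (tendsto_pi_nhds.1 hlim) i
  have hcc : ∀ R : ℝ, 0 < R → R < 1 → ∃ B : ℝ, 0 ≤ B ∧ (∀ n i, ‖a n i‖ ≤ B / R ^ i) ∧
      ∀ i, ‖c i‖ ≤ B / R ^ i := by
    intro R hR0 hR1
    obtain ⟨B, hB0, hB⟩ := hcoef R hR0 hR1
    exact ⟨B, hB0, hB, fun i => le_of_tendsto (hlim' i).norm (Eventually.of_forall fun n => hB _ i)⟩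
  have hterm : ∀ {R r B : ℝ} {x z : ℂ} {i : ℕ}, 0 < R → 0 ≤ B → ‖z‖ ≤ r → ‖x‖ ≤ B / R ^ i →
      ‖x * z ^ i‖ ≤ B * (r / R) ^ i := by
    intro R r B x z i hR hB hz hx
    rw [norm_mul, norm_pow]
    calc ‖x‖ * ‖z‖ ^ i ≤ (B / R ^ i) * r ^ i := by gcongr
      _ = _ := by rw [div_pow]; ring
  have hgeo : ∀ {R r B : ℝ}, 0 < R → 0 ≤ r → r < R → Summable fun i : ℕ => B * (r / R) ^ i :=
    fun hR hr hrR =>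
      (summable_geometric_of_lt_one (by positivity) ((div_lt_one hR).2 hrR)).mul_left _
  have hmid : ∀ z ∈ disc, ∃ r R : ℝ, 0 < r ∧ ‖z‖ < r ∧ r < R ∧ R < 1 := by
    intro z hz
    obtain ⟨r, hr1, hr2⟩ := exists_between (mem_ball_zero_iff.1 hz)
    obtain ⟨R, hR1, hR2⟩ := exists_between hr2
    exact ⟨r, R, (norm_nonneg z).trans_lt hr1, hr1, hR1, hR2⟩
  refine ⟨fun z => ∑' i, c i * z ^ i, k, fun z hz => ?_, hk, fun z hz => ?_⟩
  · obtain ⟨r, R, hr0, hr, hrR, hR⟩ := hmid z hz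
    have hR0 := hr0.trans hrR
    obtain ⟨B, hB0, -, hB⟩ := hcc R hR0 hR
    have hd : DifferentiableOn ℂ (fun z => ∑' i, c i * z ^ i) (Metric.ball 0 r) :=
      Complex.differentiableOn_tsum_of_summable_norm (hgeo (B := B) hR0 hr0.le hrR)
        (fun i => (by fun_prop)) Metric.isOpen_ball
        fun i x hx => hterm hR0 hB0 (mem_ball_zero_iff.1 hx).le (hB i)
    exact (hd.differentiableAt (Metric.isOpen_ball.mem_nhds
      (mem_ball_zero_iff.2 hr))).differentiableWithinAt
  · obtain ⟨r, R, hr0, hr, hrR, hR⟩ := hmid z hz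
    have hR0 := hr0.trans hrR
    obtain ⟨B, hB0, hB, -⟩ := hcc R hR0 hR
    refine (tendsto_tsum_of_dominated_convergence (hgeo (B := B) hR0 hr0.le hrR)
      (fun i => (hlim' i).mul_const (z ^ i)) (Eventually.of_forall fun n i =>
        hterm hR0 hB0 hr.le (hB (k n) i))).congr fun n => ?_
    exact (hsum (k n) z hz).tsum_eq

theorem IsProfile.exists_bound_of_lintegral_le (hw : IsProfile w D) {p : ℝ} (hp : 0 < p)
    {M : ℝ≥0∞} (hM : M ≠ ⊤) {R : ℝ} (hR : R < 1) :
    ∃ B : ℝ, ∀ f : ℂ → ℂ, DifferentiableOn ℂ f disc →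
      ∫⁻ z, ‖f z‖ₑ ^ p ∂(radialMeasure w) ≤ M → ∀ z, ‖z‖ ≤ R → ‖f z‖ ≤ B := by
  have h0 : ENNReal.ofReal (1 - R) * tailMass w R ≠ 0 :=
    mul_ne_zero (by simpa using hR) (hw.pos R hR)
  set b : ℝ≥0∞ := (16 * D * M / (ENNReal.ofReal (1 - R) * tailMass w R)) ^ (1 / p) with hb
  have hbt : b ≠ ⊤ := ENNReal.rpow_ne_top_of_nonneg (by positivity)
    (ENNReal.div_ne_top (ENNReal.mul_ne_top (ENNReal.mul_ne_top (by simp) hw.const_ne_top) hM) h0)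
  refine ⟨b.toReal, fun f hf hfM z hz => ?_⟩
  have hz1 : ‖z‖ < 1 := hz.trans_lt hR
  have h := hw.boxMass_mul_enorm_rpow_le (measurable_indicator_disc hf.continuousOn)
    (differentiableOn_indicator_disc hf) hz1 hp
  rw [lintegral_radialMeasure_indicator_disc hw, indicator_of_mem (mem_ball_zero_iff.2 hz1)] at h
  have h2 : ENNReal.ofReal (1 - R) * tailMass w R * ‖f z‖ₑ ^ p ≤ 16 * D * M := by
    refine le_trans ?_ (h.trans (by gcongr))
    rw [boxMass]
    gcongr
    exact tailMass_antitone w hz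
  have h3 : ‖f z‖ₑ ≤ b := by
    rw [hb, one_div, ENNReal.le_rpow_inv_iff hp, ENNReal.le_div_iff_mul_le (Or.inl h0)
      (Or.inl (ENNReal.mul_ne_top ENNReal.ofReal_ne_top (hw.tailMass_ne_top R))), mul_comm]
    exact h2
  rw [← toReal_enorm]
  exact ENNReal.toReal_mono hbt h3

theorem lintegral_rpow_le_of_tendsto (hw : IsProfile w D) {p : ℝ} {f : ℕ → ℂ → ℂ} {g : ℂ → ℂ}
    (hf : ∀ n, ContinuousOn (f n) disc) {M : ℝ≥0∞}
    (hM : ∀ n, ∫⁻ z, ‖f n z‖ₑ ^ p ∂(radialMeasure w) ≤ M)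
    (hlim : ∀ z ∈ disc, Tendsto (fun n => f n z) atTop (𝓝 (g z))) :
    ∫⁻ z, ‖g z‖ₑ ^ p ∂(radialMeasure w) ≤ M := by
  have hle := lintegral_liminf_le (μ := radialMeasure w) (u := atTop)
    (f := fun n z => ‖disc.indicator (f n) z‖ₑ ^ p)
    fun n => (measurable_indicator_disc (hf n)).enorm.pow_const p
  simp only [lintegral_radialMeasure_indicator_disc hw] at hle
  refine le_trans (lintegral_mono_ae ?_) (hle.trans ?_)
  · filter_upwards [ae_radialMeasure_norm_lt_one hw] with z hz
    have hz' : z ∈ disc := mem_ball_zero_iff.2 hz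
    simp only [indicator_of_mem hz']
    have : Tendsto (fun n => ‖f n z‖ₑ ^ p) atTop (𝓝 (‖g z‖ₑ ^ p)) :=
      (ENNReal.continuous_rpow_const.tendsto _).comp ((continuous_enorm.tendsto _).comp (hlim z hz'))
    exact this.liminf_eq.ge
  · exact liminf_le_of_le (by isBoundedDefault) fun b hb => by
      obtain ⟨n, hn⟩ := hb.exists
      exact hn.trans (hM n)

/-- A vanishing Carleson condition turns pointwise convergence of bounded sequences into norm
convergence. -/
theorem tendsto_lintegral_rpow_of_vanishing (hw : IsProfile w D) {p q : ℝ} (hp : 0 < p)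
    (hq : 0 < q) {K : ℝ≥0∞} (hK : K ≠ ⊤) (hemb : HasCarlesonEmbedding w p q K) {μ : Measure ℂ}
    (hμ : ∀ a : ℂ, ‖a‖ < 1 → μ (nearRegion a) ≠ ⊤)
    (hvan : ∀ ε : ℝ≥0∞, ε ≠ 0 → ∃ R < 1, ∀ a : ℂ, R < ‖a‖ → ‖a‖ < 1 →
      μ (nearRegion a) ≤ ε * boxMass w a ^ (q / p))
    {h : ℕ → ℂ → ℂ} (hm : ∀ n, Measurable (h n)) (hd : ∀ n, DifferentiableOn ℂ (h n) disc)
    {M : ℝ≥0∞} (hMt : M ≠ ⊤) (hM : ∀ n, ∫⁻ z, ‖h n z‖ₑ ^ p ∂(radialMeasure w) ≤ M)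
    (hlim : ∀ z ∈ disc, Tendsto (fun n => h n z) atTop (𝓝 0)) :
    Tendsto (fun n => ∫⁻ z in disc, ‖h n z‖ₑ ^ q ∂μ) atTop (𝓝 0) := by
  rw [ENNReal.tendsto_nhds_zero]
  intro ε hε
  rcases eq_or_ne ε ⊤ with rfl | hεt
  · simp
  -- The summand 1 keeps A nonzero, so that η = (ε/2)/A is finite.
  set A : ℝ≥0∞ := K * M ^ (q / p) + 1 with hA
  have hAt : A ≠ ⊤ := by
    have : M ^ (q / p) ≠ ⊤ := ENNReal.rpow_ne_top_of_nonneg (by positivity) hMt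
    finiteness
  have hA0 : A ≠ 0 := by simp [hA]
  have hε0 : ε / 2 ≠ 0 := by simp [hε.ne']
  set η : ℝ≥0∞ := ε / 2 / A with hη
  have hη0 : η ≠ 0 := by simp [hη, hε.ne', hAt]
  have hηt : η ≠ ⊤ := ENNReal.div_ne_top (by finiteness) hA0
  obtain ⟨R, hR1, hR⟩ := hvan η hη0
  -- A point of `nearRegion a` with modulus above S forces 1-|a| ≤ 2(1-|z|) < 1-R. Hence regions
  -- with |a| ≤ R do not meet the outer part, and the restricted measure satisfies the Carleson
  -- condition with constant η for all a.
  set S : ℝ := (1 + R) / 2 with hS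
  have hS1 : S < 1 := by linarith
  have hfar : ∀ n, ∫⁻ z in disc, ‖h n z‖ₑ ^ q ∂(μ.restrict {z | S < ‖z‖}) ≤ ε / 2 := by
    intro n
    have hms : MeasurableSet {z : ℂ | S < ‖z‖} := measurableSet_lt measurable_const measurable_norm
    refine (hemb _ η hη0 hηt (fun a ha => ?_) _ (hm n) (hd n)).trans ?_
    · by_cases hRa : R < ‖a‖
      · exact (Measure.restrict_apply_le _ _).trans (hR a hRa ha)
      · rw [Measure.restrict_apply (measurableSet_nearRegion a)]
        have : nearRegion a ∩ {z | S < ‖z‖} = ∅ := by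
          refine eq_empty_of_forall_notMem fun z hz => hRa ?_
          have h1 := hz.1.2.2
          have h2 : S < ‖z‖ := hz.2
          linarith
        rw [this, measure_empty]
        exact zero_le
    · calc K * η * (∫⁻ z, ‖h n z‖ₑ ^ p ∂(radialMeasure w)) ^ (q / p)
          ≤ K * η * M ^ (q / p) := by
            gcongr
            exact hM n
        _ = η * (K * M ^ (q / p)) := by ring
        _ ≤ η * A := by gcongr; exact le_self_add
        _ = ε / 2 := ENNReal.div_mul_cancel hA0 hAt
  have hnear : Tendsto (fun n => ∫⁻ z in Metric.closedBall 0 S, ‖h n z‖ₑ ^ q ∂μ) atTop (𝓝 0) := by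
    obtain ⟨B, hB⟩ := hw.exists_bound_of_lintegral_le hp hMt hS1
    have hfin := measure_closedBall_lt_top hμ hS1
    have h0 : (0 : ℝ≥0∞) = ∫⁻ z in Metric.closedBall (0 : ℂ) S, 0 ∂μ := by simp
    rw [h0]
    refine tendsto_lintegral_of_dominated_convergence (fun _ => ENNReal.ofReal B ^ q)
      (fun n => (hm n).enorm.pow_const q) (fun n => ?_) ?_ ?_
    · refine (ae_restrict_iff' measurableSet_closedBall).2 (ae_of_all _ fun z hz => ?_)
      have := hB (h n) (hd n) (hM n) z (mem_closedBall_zero_iff.1 hz)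
      dsimp only
      gcongr
      rw [← ofReal_norm]
      exact ENNReal.ofReal_le_ofReal this
    · rw [lintegral_const, Measure.restrict_apply_univ]
      exact ENNReal.mul_ne_top (ENNReal.rpow_ne_top_of_nonneg hq.le ENNReal.ofReal_ne_top) hfin.ne
    · refine (ae_restrict_iff' measurableSet_closedBall).2 (ae_of_all _ fun z hz => ?_)
      have hz' : z ∈ disc := Metric.closedBall_subset_ball hS1 hz
      have : Tendsto (fun n => ‖h n z‖ₑ ^ q) atTop (𝓝 (‖(0 : ℂ)‖ₑ ^ q)) :=
        (ENNReal.continuous_rpow_const.tendsto _).comp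
          ((continuous_enorm.tendsto _).comp (hlim z hz'))
      simpa [ENNReal.zero_rpow_of_pos hq] using this
  filter_upwards [(ENNReal.tendsto_nhds_zero.1 hnear) (ε / 2) (pos_iff_ne_zero.2 hε0)] with n hn
  calc ∫⁻ z in disc, ‖h n z‖ₑ ^ q ∂μ
      ≤ ∫⁻ z in Metric.closedBall 0 S ∪ (disc ∩ {z | S < ‖z‖}), ‖h n z‖ₑ ^ q ∂μ := by
        refine lintegral_mono_set fun z hz => ?_
        rcases le_or_gt ‖z‖ S with h | h
        · exact Or.inl (mem_closedBall_zero_iff.2 h)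
        · exact Or.inr ⟨hz, h⟩
    _ ≤ _ := lintegral_union_le _ _ _
    _ ≤ ε / 2 + ε / 2 := by
        gcongr
        rw [← Measure.restrict_restrict measurableSet_disc]
        exact hfar n
    _ = ε := ENNReal.add_halves ε

theorem weightedCompOp_sub (u φ f g : ℂ → ℂ) :
    weightedCompOp u φ (f - g) = weightedCompOp u φ f - weightedCompOp u φ g := by
  ext z
  simp [weightedCompOp, mul_sub]

theorem MemBergman.sub {p : ℝ} {ω : ℝ → ℝ} {f g : ℂ → ℂ} (hf : MemBergman p ω f)
    (hg : MemBergman p ω g) : MemBergman p ω (f - g) :=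
  ⟨hf.1.sub hg.1, hf.2.sub hg.2⟩

/-- A vanishing Carleson condition on the image measure makes the weighted composition operator
compact. -/
theorem isCompactOp_weightedCompOp (hw : IsProfile w D) {p q : ℝ} (hp : 0 < p) (hq : 0 < q)
    {K : ℝ≥0∞} (hK : K ≠ ⊤) (hemb : HasCarlesonEmbedding w p q K) {ω : ℝ → ℝ}
    (hω : (weightMeasure ω).restrict disc = radialMeasure w) {ν : Measure ℂ} {u φ : ℂ → ℂ}
    (hu : ContinuousOn u disc) (hφ : IsAnalyticSelfMap φ) {κ : ℝ≥0∞} (hκ0 : κ ≠ 0) (hκ1 : κ ≠ ⊤)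
    (hμ : ∀ a : ℂ, ‖a‖ < 1 →
      pullMeasure q ν u φ (nearRegion a) ≤ κ * boxMass w a ^ (q / p))
    (hvan : ∀ ε : ℝ≥0∞, ε ≠ 0 → ∃ R < 1, ∀ a : ℂ, R < ‖a‖ → ‖a‖ < 1 →
      pullMeasure q ν u φ (nearRegion a) ≤ ε * boxMass w a ^ (q / p)) :
    IsCompactOp p q ω ν (weightedCompOp u φ) := by
  have hbdd := isBoundedOperator_weightedCompOp hw hp hq hK hemb hω hu hφ hκ0 hκ1 hμ
  refine ⟨hbdd.1, fun f hf ⟨M, hM⟩ => ?_⟩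
  have hMp : ∀ n, ∫⁻ z, ‖f n z‖ₑ ^ p ∂(radialMeasure w) ≤ (M : ℝ≥0∞) ^ p := fun n => by
    rw [← bergmanNorm_rpow hp hω]
    gcongr
    exact hM n
  have hMt : (M : ℝ≥0∞) ^ p ≠ ⊤ := ENNReal.rpow_ne_top_of_nonneg hp.le ENNReal.coe_ne_top
  -- The pointwise limit g belongs to the space by Fatou, so the vanishing condition can be applied
  -- to the bounded sequence of differences, which tends to zero pointwise.
  obtain ⟨g, k, hg, hk, hlim⟩ := exists_subseq_tendsto_of_locally_bounded (fun n => (hf n).1)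
    fun R _ hR => by
      obtain ⟨B, hB⟩ := hw.exists_bound_of_lintegral_le hp hMt hR
      exact ⟨B, fun n z hz => hB (f n) (hf n).1 (hMp n) z hz⟩
  have hgM := lintegral_rpow_le_of_tendsto hw (fun n => (hf (k n)).1.continuousOn)
    (fun n => hMp (k n)) hlim
  have hgB : MemBergman p ω g := (memBergman_iff hp hω).2 ⟨hg, ne_top_of_le_ne_top hMt hgM⟩
  refine ⟨weightedCompOp u φ g, k, hbdd.1 g hgB, hk, ?_⟩
  have hsub : ∀ n, MemBergman p ω (f (k n) - g) := fun n => (hf (k n)).sub hgB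
  have hmain : Tendsto (fun n => ∫⁻ z in disc, ‖disc.indicator (f (k n) - g) z‖ₑ ^ q
      ∂(pullMeasure q ν u φ)) atTop (𝓝 0) := by
    refine tendsto_lintegral_rpow_of_vanishing hw hp hq hK hemb (fun a ha => ?_) hvan
      (fun n => measurable_indicator_disc (hsub n).1.continuousOn)
      (fun n => differentiableOn_indicator_disc (hsub n).1)
      (M := 2 ^ p * ((M : ℝ≥0∞) ^ p + (M : ℝ≥0∞) ^ p)) ?_ (fun n => ?_) fun z hz => ?_
    · refine ne_top_of_le_ne_top (ENNReal.mul_ne_top hκ1 ?_) (hμ a ha)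
      exact ENNReal.rpow_ne_top_of_nonneg (by positivity) (hw.boxMass_ne_top a)
    · have : (2 : ℝ≥0∞) ^ p ≠ ⊤ := ENNReal.rpow_ne_top_of_nonneg hp.le (by simp)
      finiteness
    · rw [lintegral_radialMeasure_indicator_disc hw]
      calc ∫⁻ z, ‖(f (k n) - g) z‖ₑ ^ p ∂(radialMeasure w)
          ≤ ∫⁻ z, 2 ^ p * (‖disc.indicator (f (k n)) z‖ₑ ^ p + ‖disc.indicator g z‖ₑ ^ p)
            ∂(radialMeasure w) := by
            refine lintegral_mono_ae ?_
            filter_upwards [ae_radialMeasure_norm_lt_one hw] with z hz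
            have hz' : z ∈ disc := mem_ball_zero_iff.2 hz
            rw [indicator_of_mem hz', indicator_of_mem hz']
            refine le_trans ?_ (add_rpow_le_two_rpow_mul hp.le _ _)
            gcongr
            exact enorm_sub_le
        _ ≤ _ := by
            have h1 := (measurable_indicator_disc (hf (k n)).1.continuousOn).enorm.pow_const p
            have h2 := (measurable_indicator_disc hg.continuousOn).enorm.pow_const p
            have h3 : Measurable fun z =>
              ‖disc.indicator (f (k n)) z‖ₑ ^ p + ‖disc.indicator g z‖ₑ ^ p := h1.add h2
            rw [lintegral_const_mul _ h3, lintegral_add_left h1]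
            simp only [lintegral_radialMeasure_indicator_disc hw]
            gcongr
            exact hMp (k n)
    · simp only [indicator_of_mem hz, Pi.sub_apply]
      simpa using (hlim z hz).sub_const (g z)
  have h2 := (ENNReal.continuous_rpow_const (y := 1 / q)).tendsto 0 |>.comp hmain
  rw [ENNReal.zero_rpow_of_pos (by positivity)] at h2
  refine h2.congr fun n => ?_
  rw [← weightedCompOp_sub, lpNorm_eq hq,
    lintegral_weightedCompOp hq hu hφ (hsub n).1.continuousOn]
  rfl

/-! ### Consequences of compactness -/

theorem lpNorm_smul (q : ℝ) (ν : Measure ℂ) (c : ℂ) (f : ℂ → ℂ) :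
    lpNorm q ν (c • f) = ‖c‖ₑ * lpNorm q ν f :=
  eLpNorm_const_smul c f _ _

theorem enorm_ofReal_toReal {x : ℝ≥0∞} (hx : x ≠ ⊤) : ‖((x.toReal : ℝ) : ℂ)‖ₑ = x := by
  rw [← ofReal_norm, Complex.norm_real, Real.norm_of_nonneg ENNReal.toReal_nonneg,
    ENNReal.ofReal_toReal hx]

theorem MemBergman.const_smul {p : ℝ} {ω : ℝ → ℝ} {f : ℂ → ℂ} (hf : MemBergman p ω f) (c : ℂ) :
    MemBergman p ω (c • f) :=
  ⟨hf.1.const_smul c, MemLp.const_smul hf.2 c⟩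

/-- Compact homogeneous operators are bounded. -/
theorem IsCompactOp.isBoundedOperator {p q : ℝ} {ω : ℝ → ℝ} {ν : Measure ℂ}
    {T : (ℂ → ℂ) → (ℂ → ℂ)} (hT : IsCompactOp p q ω ν T)
    (hsmul : ∀ (c : ℂ) (f : ℂ → ℂ), T (c • f) = c • T f) : IsBoundedOperator p q ω ν T := by
  refine ⟨hT.1, ?_⟩
  by_contra! hcon
  choose f hf hlt using fun n : ℕ => hcon (n : NNReal)
  set L : ℕ → ℝ≥0∞ := fun n => lpNorm q ν (T (f n)) with hL
  have hL0 : ∀ n, L n ≠ 0 := fun n => (zero_le.trans_lt (hlt n)).ne'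
  have hLt : ∀ n, L n ≠ ⊤ := fun n => (hT.1 _ (hf n)).2.ne
  -- With this scaling the images have norm exactly n while the functions stay in the unit ball,
  -- because ‖T f_n‖ > n‖f_n‖.
  set c : ℕ → ℂ := fun n => (((n : ℝ≥0∞) / L n).toReal : ℂ) with hc
  have hcn : ∀ n, ‖c n‖ₑ = n / L n := fun n =>
    enorm_ofReal_toReal (ENNReal.div_ne_top (ENNReal.natCast_ne_top n) (hL0 n))
  have hTc : ∀ n, lpNorm q ν (T (c n • f n)) = n := fun n => by
    rw [hsmul, lpNorm_smul, hcn]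
    exact ENNReal.div_mul_cancel (hL0 n) (hLt n)
  obtain ⟨g, k, hg, hk, hlim⟩ := hT.2 (fun n => c n • f n) (fun n => (hf n).const_smul _)
    ⟨1, fun n => by
      rw [bergmanNorm, lpNorm_smul, hcn, ENNReal.coe_one, ENNReal.mul_comm_div,
        ← mul_div_assoc]
      refine ENNReal.div_le_of_le_mul ?_
      rw [one_mul]
      exact_mod_cast (hlt n).le⟩
  have hgt : lpNorm q ν g ≠ ⊤ := hg.2.ne
  -- For q < 1 the norm is only a quasi-norm, whence the constant in the triangle inequality. A
  -- convergent subsequence of images would be bounded by B, contradicting the norms n.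
  set B : ℝ≥0∞ := ENNReal.LpAddConst (ENNReal.ofReal q) * (1 + lpNorm q ν g) with hB
  have hBt : B ≠ ⊤ := ENNReal.mul_ne_top (ENNReal.LpAddConst_lt_top _).ne (by finiteness)
  obtain ⟨m, hm⟩ := ENNReal.exists_nat_gt hBt
  have hev := (ENNReal.tendsto_nhds_zero.1 hlim) 1 one_pos
  obtain ⟨n, hn1, hn2⟩ := (hev.and (eventually_ge_atTop m)).exists
  have hmem : MemLebesgue q ν (T (c (k n) • f (k n))) := hT.1 _ ((hf (k n)).const_smul _)
  have h := eLpNorm_add_le' (hmem.1.sub hg.1) hg.1 (ENNReal.ofReal q)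
  rw [sub_add_cancel] at h
  have h2 : ((k n : ℕ) : ℝ≥0∞) ≤ B := by
    rw [← hTc (k n)]
    refine h.trans ?_
    rw [hB]
    gcongr
    · exact hn1
    · exact le_rfl
  have h3 : (m : ℝ≥0∞) ≤ (k n : ℕ) := by exact_mod_cast hn2.trans (hk.id_le n)
  exact absurd (hm.trans_le (h3.trans h2)) (lt_irrefl _)

theorem compOp_sub_smul (φ ψ : ℂ → ℂ) (c : ℂ) (f : ℂ → ℂ) :
    (compOp φ - compOp ψ) (c • f) = c • (compOp φ - compOp ψ) f := by
  ext z
  simp [compOp, mul_sub]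

/-- A compact difference of composition operators maps bounded sequences converging to zero
pointwise to norm null sequences. -/
theorem tendsto_lpNorm_compOp_sub {p q : ℝ} (hq : 0 < q) {ω : ℝ → ℝ} {ν : Measure ℂ}
    {φ ψ : ℂ → ℂ} (hφ : IsAnalyticSelfMap φ) (hψ : IsAnalyticSelfMap ψ)
    (hT : IsCompactOp p q ω ν (compOp φ - compOp ψ)) {f : ℕ → ℂ → ℂ}
    (hf : ∀ n, MemBergman p ω (f n)) (hM : ∃ M : NNReal, ∀ n, bergmanNorm p ω (f n) ≤ M)
    (hlim : ∀ z ∈ disc, Tendsto (fun n => f n z) atTop (𝓝 0)) :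
    Tendsto (fun n => lpNorm q ν ((compOp φ - compOp ψ) (f n))) atTop (𝓝 0) := by
  refine tendsto_of_subseq_tendsto fun ns hns => ?_
  obtain ⟨M, hM⟩ := hM
  obtain ⟨g, k, hg, hk, hk2⟩ := hT.2 (fun n => f (ns n)) (fun n => hf _) ⟨M, fun n => hM _⟩
  refine ⟨k, hk2.congr fun n => ?_⟩
  -- The limit is identified as zero: norm convergence gives convergence in measure, hence almost
  -- everywhere along a subsequence, and the pointwise limits at φ(z) and ψ(z) are both zero.
  have hms := (tendstoInMeasure_of_tendsto_eLpNorm (by simpa using hq)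
    (fun n => (hT.1 _ (hf (ns (k n)))).1) hg.1 hk2)
  obtain ⟨ms, hms1, hms2⟩ := hms.exists_seq_tendsto_ae
  have hg0 : g =ᵐ[ν.restrict disc] 0 := by
    filter_upwards [hms2, ae_restrict_mem measurableSet_disc] with z hz hzd
    refine tendsto_nhds_unique hz ?_
    have hsub : Tendsto (fun i => ns (k (ms i))) atTop atTop :=
      hns.comp (hk.tendsto_atTop.comp hms1.tendsto_atTop)
    have h1 := (hlim _ (hφ.2 hzd)).comp hsub
    have h2 := (hlim _ (hψ.2 hzd)).comp hsub
    simpa [compOp] using! h1.sub h2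
  refine eLpNorm_congr_ae ?_
  filter_upwards [hg0] with z hz
  simp [hz]

/-! ### Uniform and vanishing bounds for the test functions -/

theorem IsProfile.exists_lintegral_testFun_le (hw : IsProfile w D) {N : ℕ} (hN : 2 * D ≤ 2 ^ N)
    {γ : ℕ} {p : ℝ} (hp : 0 < p) (hγ : (N : ℝ) + 2 ≤ γ * p) : ∃ M : ℝ≥0∞, M ≠ ⊤ ∧
      ∀ a : ℂ, ‖a‖ < 1 →
        ∫⁻ z, ‖testFun γ a z‖ₑ ^ p ∂(radialMeasure w) ≤ M * boxMass w a ∧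
        ∫⁻ z, ‖(mobius a * testFun γ a) z‖ₑ ^ p ∂(radialMeasure w) ≤ M * boxMass w a := by
  have h3 : (3 : ℝ≥0∞) ^ p ≠ ⊤ := ENNReal.rpow_ne_top_of_nonneg hp.le (by simp)
  have hD := hw.const_ne_top
  set M : ℝ≥0∞ := ENNReal.ofReal (2 * Real.pi) * (2 * D) with hM
  have hMt : M ≠ ⊤ := by finiteness
  refine ⟨(1 + 3 ^ p) * M, by finiteness, fun a ha => ?_⟩
  have h1 : _ ≤ M * boxMass w a := hw.lintegral_testFun_le hN hp hγ ha
  rw [add_mul, one_mul, add_mul, mul_assoc (3 ^ p)]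
  refine ⟨h1.trans le_self_add, (hw.lintegral_mobius_mul_testFun_le hp γ ha).trans ?_⟩
  exact le_add_of_le_right (mul_le_mul_right h1 _)

/-- The test functions tend to zero faster than the box masses. -/
theorem IsProfile.exists_enorm_testFun_rpow_le (hw : IsProfile w D) {N : ℕ}
    (hN : 2 * D ≤ 2 ^ N) {γ : ℕ} {p : ℝ} (hp : 0 < p) (hγ : (N : ℝ) + 2 ≤ γ * p) {z : ℂ}
    (hz : ‖z‖ < 1) : ∃ C : ℝ≥0∞, C ≠ ⊤ ∧ ∀ a : ℂ, ‖a‖ < 1 →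
      ‖testFun γ a z‖ₑ ^ p ≤ C * ENNReal.ofReal (1 - ‖a‖) * boxMass w a ∧
      ‖(mobius a * testFun γ a) z‖ₑ ^ p ≤ C * ENNReal.ofReal (1 - ‖a‖) * boxMass w a := by
  have hz' : 0 < 1 - ‖z‖ := by linarith
  have hW0 : tailMass w 0 ≠ 0 := hw.pos 0 one_pos
  have hWt : tailMass w 0 ≠ ⊤ := hw.finite
  have hD := hw.const_ne_top
  have h3 : (3 : ℝ≥0∞) ^ p ≠ ⊤ := ENNReal.rpow_ne_top_of_nonneg hp.le (by simp)
  set A : ℝ≥0∞ := ENNReal.ofReal ((1 - ‖z‖)⁻¹ ^ (γ * p)) with hA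
  set E : ℝ≥0∞ := A * (2 * D / tailMass w 0) with hE
  have hEt : E ≠ ⊤ := by
    have := ENNReal.div_ne_top (show 2 * D ≠ ⊤ by finiteness) hW0
    finiteness
  have hmain : ∀ a : ℂ, ‖a‖ < 1 →
      ‖testFun γ a z‖ₑ ^ p ≤ E * ENNReal.ofReal (1 - ‖a‖) * boxMass w a := by
    intro a ha
    have ha' : 0 < 1 - ‖a‖ := by linarith
    have hden : 1 - ‖z‖ ≤ ‖1 - (starRingEnd ℂ) a * z‖ := by
      have h := norm_sub_norm_le 1 ((starRingEnd ℂ) a * z)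
      rw [norm_one, norm_mul, Complex.norm_conj] at h
      nlinarith [norm_nonneg z, norm_nonneg a]
    -- Of the N + 2 powers of 1-|a|, N are bounded by a multiple of the tail, one completes the box
    -- mass, and the last remains as decay.
    have h1 : ‖testFun γ a z‖ ^ p ≤ (1 - ‖z‖)⁻¹ ^ (γ * p) * (1 - ‖a‖) ^ (N + 2) := by
      rw [norm_testFun γ ha, ← Real.rpow_natCast, ← Real.rpow_mul (by positivity)]
      calc ((1 - ‖a‖) / ‖1 - (starRingEnd ℂ) a * z‖) ^ ((γ : ℝ) * p)
          ≤ ((1 - ‖z‖)⁻¹ * (1 - ‖a‖)) ^ ((γ : ℝ) * p) := by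
            rw [div_eq_inv_mul]
            gcongr
        _ = (1 - ‖z‖)⁻¹ ^ (γ * p) * (1 - ‖a‖) ^ (γ * p) :=
            Real.mul_rpow (by positivity) ha'.le
        _ ≤ (1 - ‖z‖)⁻¹ ^ (γ * p) * (1 - ‖a‖) ^ ((N : ℝ) + 2) := by
            gcongr ?_ * ?_
            exact Real.rpow_le_rpow_of_exponent_ge ha' (by linarith [norm_nonneg a]) hγ
        _ = _ := by
            congr 1
            rw [← Real.rpow_natCast]
            norm_num
    have h2 : ENNReal.ofReal ((1 - ‖a‖) ^ N) ≤ 2 * D / tailMass w 0 * tailMass w ‖a‖ := by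
      rw [ENNReal.mul_comm_div, ← mul_div_assoc, ENNReal.le_div_iff_mul_le (Or.inl hW0) (Or.inl hWt)]
      exact (hw.ofReal_pow_mul_tailMass_le hN (norm_nonneg a) ha).trans (by rw [mul_assoc])
    calc ‖testFun γ a z‖ₑ ^ p = ENNReal.ofReal (‖testFun γ a z‖ ^ p) := by
          rw [← ofReal_norm, ENNReal.ofReal_rpow_of_nonneg (norm_nonneg _) hp.le]
      _ ≤ ENNReal.ofReal ((1 - ‖z‖)⁻¹ ^ (γ * p) * (1 - ‖a‖) ^ (N + 2)) :=
          ENNReal.ofReal_le_ofReal h1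
      _ = A * (ENNReal.ofReal ((1 - ‖a‖) ^ N) *
            (ENNReal.ofReal (1 - ‖a‖) * ENNReal.ofReal (1 - ‖a‖))) := by
          rw [ENNReal.ofReal_mul (by positivity), pow_add, ENNReal.ofReal_mul (by positivity),
            pow_two, ENNReal.ofReal_mul ha'.le]
      _ ≤ A * (2 * D / tailMass w 0 * tailMass w ‖a‖ *
            (ENNReal.ofReal (1 - ‖a‖) * ENNReal.ofReal (1 - ‖a‖))) := by gcongr
      _ = _ := by rw [hE, boxMass]; ring
  refine ⟨(1 + 3 ^ p) * E, by finiteness, fun a ha => ⟨(hmain a ha).trans ?_, ?_⟩⟩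
  · gcongr
    rw [add_mul, one_mul]
    exact le_self_add
  · rw [Pi.mul_apply, enorm_mul, ENNReal.mul_rpow_of_nonneg _ _ hp.le]
    calc ‖mobius a z‖ₑ ^ p * ‖testFun γ a z‖ₑ ^ p
        ≤ 3 ^ p * (E * ENNReal.ofReal (1 - ‖a‖) * boxMass w a) := by
          gcongr
          · rw [← ofReal_norm, show (3 : ℝ≥0∞) = ENNReal.ofReal 3 by simp]
            exact ENNReal.ofReal_le_ofReal (norm_mobius_le ha hz)
          · exact hmain a ha
      _ ≤ _ := by
          rw [add_mul, add_mul, add_mul, one_mul, mul_assoc (3 ^ p), mul_assoc (3 ^ p)]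
          exact le_add_self

theorem exists_testEnergy_le (hw : IsProfile w D) {N : ℕ} (hN : 2 * D ≤ 2 ^ N) {γ : ℕ} {p q : ℝ}
    (hp : 0 < p) (hq : 0 < q) (hγ : (N : ℝ) + 2 ≤ γ * p) {ω : ℝ → ℝ}
    (hω : (weightMeasure ω).restrict disc = radialMeasure w) {ν : Measure ℂ} {φ ψ : ℂ → ℂ}
    (hT : IsBoundedOperator p q ω ν (compOp φ - compOp ψ)) :
    ∃ κ : ℝ≥0∞, κ ≠ ⊤ ∧ ∀ a : ℂ, ‖a‖ < 1 →
      testEnergy q ν φ ψ γ a ≤ κ * boxMass w a ^ (q / p) := by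
  obtain ⟨C, hC⟩ := hT.2
  obtain ⟨M, hMt, hM⟩ := hw.exists_lintegral_testFun_le hN hp hγ
  have key : ∀ a : ℂ, ‖a‖ < 1 → ∀ h : ℂ → ℂ, DifferentiableOn ℂ h disc →
      ∫⁻ z, ‖h z‖ₑ ^ p ∂(radialMeasure w) ≤ M * boxMass w a →
      ∫⁻ z in disc, ‖(compOp φ - compOp ψ) h z‖ₑ ^ q ∂ν
        ≤ (C : ℝ≥0∞) ^ q * M ^ (q / p) * boxMass w a ^ (q / p) := by
    intro a ha h hd hle
    have hmem : MemBergman p ω h := (memBergman_iff hp hω).2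
      ⟨hd, ne_top_of_le_ne_top (ENNReal.mul_ne_top hMt (hw.boxMass_ne_top a)) hle⟩
    rw [← lpNorm_rpow hq]
    calc lpNorm q ν ((compOp φ - compOp ψ) h) ^ q ≤ (C * bergmanNorm p ω h) ^ q := by
          gcongr
          exact hC h hmem
      _ = (C : ℝ≥0∞) ^ q * (bergmanNorm p ω h ^ p) ^ (q / p) := by
          rw [ENNReal.mul_rpow_of_nonneg _ _ hq.le, ← ENNReal.rpow_mul, mul_div_cancel₀ _ hp.ne']
      _ ≤ (C : ℝ≥0∞) ^ q * (M * boxMass w a) ^ (q / p) := by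
          rw [bergmanNorm_rpow hp hω]
          gcongr
      _ = _ := by rw [ENNReal.mul_rpow_of_nonneg _ _ (by positivity), mul_assoc]
  refine ⟨2 * ((C : ℝ≥0∞) ^ q * M ^ (q / p)), ?_, fun a ha => ?_⟩
  · have h1 : (C : ℝ≥0∞) ^ q ≠ ⊤ := ENNReal.rpow_ne_top_of_nonneg hq.le ENNReal.coe_ne_top
    have h2 : M ^ (q / p) ≠ ⊤ := ENNReal.rpow_ne_top_of_nonneg (by positivity) hMt
    finiteness
  · rw [testEnergy, mul_assoc, two_mul]
    exact add_le_add
      (key a ha _ ((differentiableOn_mobius ha).mul (differentiableOn_testFun γ ha)) (hM a ha).2)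
      (key a ha _ (differentiableOn_testFun γ ha) (hM a ha).1)

/-- Normalized families decaying pointwise have vanishing images. -/
theorem tendsto_lintegral_div_boxMass (hw : IsProfile w D) {p q : ℝ} (hp : 0 < p) (hq : 0 < q)
    {ω : ℝ → ℝ} (hω : (weightMeasure ω).restrict disc = radialMeasure w) {ν : Measure ℂ}
    {φ ψ : ℂ → ℂ} (hφ : IsAnalyticSelfMap φ) (hψ : IsAnalyticSelfMap ψ)
    (hT : IsCompactOp p q ω ν (compOp φ - compOp ψ)) {a : ℕ → ℂ} (ha : ∀ n, ‖a n‖ < 1)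
    (halim : Tendsto (fun n => ‖a n‖) atTop (𝓝 1)) {h : ℂ → ℂ → ℂ}
    (hd : ∀ a : ℂ, ‖a‖ < 1 → DifferentiableOn ℂ (h a) disc) {M : ℝ≥0∞} (hMt : M ≠ ⊤)
    (hM : ∀ a : ℂ, ‖a‖ < 1 → ∫⁻ z, ‖h a z‖ₑ ^ p ∂(radialMeasure w) ≤ M * boxMass w a)
    (hpt : ∀ z ∈ disc, ∃ C : ℝ≥0∞, C ≠ ⊤ ∧ ∀ a : ℂ, ‖a‖ < 1 →
      ‖h a z‖ₑ ^ p ≤ C * ENNReal.ofReal (1 - ‖a‖) * boxMass w a) :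
    Tendsto (fun n => (∫⁻ z in disc, ‖(compOp φ - compOp ψ) (h (a n)) z‖ₑ ^ q ∂ν) /
      boxMass w (a n) ^ (q / p)) atTop (𝓝 0) := by
  have hX0 : ∀ n, boxMass w (a n) ≠ 0 := fun n => hw.boxMass_ne_zero (ha n)
  have hXt : ∀ n, boxMass w (a n) ≠ ⊤ := fun n => hw.boxMass_ne_top (a n)
  -- Normalization by the p-th root of the box mass: norms stay bounded, values at a fixed point
  -- decay like a power of 1-|a|, and q-th powers of image norms are divided by the box mass to the
  -- power q/p.
  set c : ℕ → ℂ := fun n => (((boxMass w (a n))⁻¹ ^ (1 / p)).toReal : ℂ) with hc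
  have hcn : ∀ n, ‖c n‖ₑ = (boxMass w (a n))⁻¹ ^ (1 / p) := fun n =>
    enorm_ofReal_toReal (ENNReal.rpow_ne_top_of_nonneg (by positivity)
      (ENNReal.inv_ne_top.2 (hX0 n)))
  have hcp : ∀ n, ‖c n‖ₑ ^ p = (boxMass w (a n))⁻¹ := fun n => by
    rw [hcn, ← ENNReal.rpow_mul, one_div_mul_cancel hp.ne', ENNReal.rpow_one]
  have hcq : ∀ n, ‖c n‖ₑ ^ q = (boxMass w (a n) ^ (q / p))⁻¹ := fun n => by
    rw [hcn, ← ENNReal.rpow_mul, one_div_mul_eq_div, ENNReal.inv_rpow]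
  have hmem : ∀ n, MemBergman p ω (h (a n)) := fun n => (memBergman_iff hp hω).2
    ⟨hd _ (ha n), ne_top_of_le_ne_top (ENNReal.mul_ne_top hMt (hXt n)) (hM _ (ha n))⟩
  have hMp : M ^ (1 / p) ≠ ⊤ := ENNReal.rpow_ne_top_of_nonneg (by positivity) hMt
  have hlim := tendsto_lpNorm_compOp_sub hq hφ hψ hT (f := fun n => c n • h (a n))
    (fun n => (hmem n).const_smul _) ⟨(M ^ (1 / p)).toNNReal, fun n => ?_⟩ fun z hz => ?_
  · have h1 := (ENNReal.continuous_rpow_const (y := q)).tendsto 0 |>.comp hlim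
    rw [ENNReal.zero_rpow_of_pos hq] at h1
    refine h1.congr fun n => ?_
    rw [Function.comp_apply, compOp_sub_smul, lpNorm_smul, ENNReal.mul_rpow_of_nonneg _ _ hq.le,
      lpNorm_rpow hq, hcq]
    exact ENNReal.div_eq_inv_mul.symm
  · rw [ENNReal.coe_toNNReal hMp, one_div, ENNReal.le_rpow_inv_iff hp, bergmanNorm, lpNorm_smul,
      ENNReal.mul_rpow_of_nonneg _ _ hp.le, hcp]
    change _ * bergmanNorm p ω (h (a n)) ^ p ≤ M
    rw [bergmanNorm_rpow hp hω, mul_comm, ← div_eq_mul_inv]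
    exact ENNReal.div_le_of_le_mul (hM _ (ha n))
  · obtain ⟨C, hCt, hC⟩ := hpt z hz
    have hle : ∀ n, ‖(c n • h (a n)) z‖ₑ ^ p ≤ C * ENNReal.ofReal (1 - ‖a n‖) := fun n => by
      rw [Pi.smul_apply, smul_eq_mul, enorm_mul, ENNReal.mul_rpow_of_nonneg _ _ hp.le, hcp,
        mul_comm, ← div_eq_mul_inv]
      exact ENNReal.div_le_of_le_mul (hC _ (ha n))
    have hr : Tendsto (fun n => C * ENNReal.ofReal (1 - ‖a n‖)) atTop (𝓝 0) := by
      have h1 : Tendsto (fun n => 1 - ‖a n‖) atTop (𝓝 0) := by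
        simpa using halim.const_sub 1
      have h2 := ENNReal.Tendsto.const_mul (a := C) (ENNReal.tendsto_ofReal h1) (Or.inr hCt)
      simpa using h2
    have h3 : Tendsto (fun n => ‖(c n • h (a n)) z‖ₑ ^ p) atTop (𝓝 0) :=
      tendsto_of_tendsto_of_tendsto_of_le_of_le tendsto_const_nhds hr (fun _ => zero_le) hle
    have h4 := (ENNReal.continuous_rpow_const (y := 1 / p)).tendsto 0 |>.comp h3
    rw [ENNReal.zero_rpow_of_pos (by positivity)] at h4
    rw [tendsto_zero_iff_enorm_tendsto_zero]
    refine h4.congr fun n => ?_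
    rw [Function.comp_apply, ← ENNReal.rpow_mul, mul_one_div_cancel hp.ne', ENNReal.rpow_one]

/-- A failure for some ε would supply centres approaching the unit circle whose normalized energies
stay above ε, while both normalized families of test functions have images tending to zero. -/
theorem exists_testEnergy_le_of_isCompactOp (hw : IsProfile w D) {N : ℕ} (hN : 2 * D ≤ 2 ^ N)
    {γ : ℕ} {p q : ℝ} (hp : 0 < p) (hq : 0 < q) (hγ : (N : ℝ) + 2 ≤ γ * p) {ω : ℝ → ℝ}
    (hω : (weightMeasure ω).restrict disc = radialMeasure w) {ν : Measure ℂ} {φ ψ : ℂ → ℂ}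
    (hφ : IsAnalyticSelfMap φ) (hψ : IsAnalyticSelfMap ψ)
    (hT : IsCompactOp p q ω ν (compOp φ - compOp ψ)) {ε : ℝ≥0∞} (hε : ε ≠ 0) :
    ∃ R < 1, ∀ a : ℂ, R < ‖a‖ → ‖a‖ < 1 →
      testEnergy q ν φ ψ γ a ≤ ε * boxMass w a ^ (q / p) := by
  by_contra! hcon
  have hR : ∀ n : ℕ, 1 - 1 / ((n : ℝ) + 1) < 1 := fun n => by
    have : (0 : ℝ) < 1 / ((n : ℝ) + 1) := by positivity
    linarith
  choose a ha1 ha2 ha3 using fun n => hcon _ (hR n)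
  have halim : Tendsto (fun n => ‖a n‖) atTop (𝓝 1) := by
    refine tendsto_of_tendsto_of_tendsto_of_le_of_le ?_ tendsto_const_nhds (fun n => (ha1 n).le)
      fun n => (ha2 n).le
    simpa using (tendsto_one_div_add_atTop_nhds_zero_nat (𝕜 := ℝ)).const_sub 1
  obtain ⟨M, hMt, hM⟩ := hw.exists_lintegral_testFun_le hN hp hγ
  have h1 := tendsto_lintegral_div_boxMass hw hp hq hω hφ hψ hT ha2 halim (h := testFun γ)
    (fun a ha => differentiableOn_testFun γ ha) hMt (fun a ha => (hM a ha).1) fun z hz => by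
      obtain ⟨C, hCt, hC⟩ := hw.exists_enorm_testFun_rpow_le hN hp hγ (mem_ball_zero_iff.1 hz)
      exact ⟨C, hCt, fun a ha => (hC a ha).1⟩
  have h2 := tendsto_lintegral_div_boxMass hw hp hq hω hφ hψ hT ha2 halim
    (h := fun a => mobius a * testFun γ a)
    (fun a ha => (differentiableOn_mobius ha).mul (differentiableOn_testFun γ ha)) hMt
    (fun a ha => (hM a ha).2) fun z hz => by
      obtain ⟨C, hCt, hC⟩ := hw.exists_enorm_testFun_rpow_le hN hp hγ (mem_ball_zero_iff.1 hz)
      exact ⟨C, hCt, fun a ha => (hC a ha).2⟩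
  have h3 := h2.add h1
  rw [add_zero] at h3
  obtain ⟨n, hn⟩ := ((ENNReal.tendsto_nhds_zero.1 h3) ε (pos_iff_ne_zero.2 hε)).exists
  rw [← ENNReal.add_div] at hn
  have hX : boxMass w (a n) ^ (q / p) ≠ 0 := by
    rw [Ne, ENNReal.rpow_eq_zero_iff_of_pos (by positivity)]
    exact hw.boxMass_ne_zero (ha2 n)
  have hXt : boxMass w (a n) ^ (q / p) ≠ ⊤ :=
    ENNReal.rpow_ne_top_of_nonneg (by positivity) (hw.boxMass_ne_top _)
  rw [ENNReal.div_le_iff hX hXt] at hn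
  exact absurd (ha3 n) (not_lt.2 hn)

/-! ### Borel versions of radial weights -/

/-- A weight is only almost everywhere measurable on [0,1). Polar coordinates show that changing it
on a null set of radii does not affect the measure on the disc. -/
theorem volume_norm_preimage_eq_zero {N : Set ℝ} (hN : MeasurableSet N) (h0 : volume N = 0) :
    volume ((fun z : ℂ => ‖z‖) ⁻¹' N) = 0 := by
  have hm : Measurable (N.indicator (1 : ℝ → ℝ≥0∞)) := measurable_one.indicator hN
  have h := lintegral_radialMeasure hm (F := fun _ => 1) measurable_const
  have h1 : ∫⁻ z, 1 ∂(radialMeasure (N.indicator (1 : ℝ → ℝ≥0∞)))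
      = volume ((fun z : ℂ => ‖z‖) ⁻¹' N) := by
    rw [lintegral_one, radialMeasure, withDensity_apply _ MeasurableSet.univ,
      Measure.restrict_univ, ← lintegral_indicator_one (measurable_norm hN)]
    rfl
  rw [← h1, h]
  refine le_antisymm ((setLIntegral_le_lintegral _ _).trans (le_of_eq ?_)) zero_le
  rw [lintegral_eq_zero_iff' (by fun_prop)]
  have hN' : ∀ᵐ r : ℝ, r ∉ N := measure_eq_zero_iff_ae_notMem.1 h0
  filter_upwards [hN'] with r hr
  simp [hr]

/-- A Borel version of a radial weight, with values in `[0,∞]` and extended by zero. -/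
def borelProfile {ω : ℝ → ℝ} (hω : IsRadialWeight ω) : ℝ → ℝ≥0∞ :=
  (Ico (0 : ℝ) 1).indicator fun s => ENNReal.ofReal (hω.integrable.aestronglyMeasurable.mk ω s)

theorem measurable_borelProfile {ω : ℝ → ℝ} (hω : IsRadialWeight ω) :
    Measurable (borelProfile hω) :=
  hω.integrable.aestronglyMeasurable.stronglyMeasurable_mk.measurable.ennreal_ofReal.indicator
    measurableSet_Ico

theorem weightMeasure_restrict_disc {ω : ℝ → ℝ} (hω : IsRadialWeight ω) :
    (weightMeasure ω).restrict disc = radialMeasure (borelProfile hω) := by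
  set ω' := hω.integrable.aestronglyMeasurable.mk ω with hω'
  have h1 : (fun z : ℂ => borelProfile hω ‖z‖) =
      disc.indicator fun z => ENNReal.ofReal (ω' ‖z‖) := by
    ext z
    by_cases hz : ‖z‖ < 1
    · rw [indicator_of_mem (mem_ball_zero_iff.2 hz), borelProfile,
        indicator_of_mem (show ‖z‖ ∈ Ico (0 : ℝ) 1 from ⟨norm_nonneg z, hz⟩)]
    · rw [indicator_of_notMem (fun h => hz (mem_ball_zero_iff.1 h)), borelProfile,
        indicator_of_notMem fun h => hz h.2]
  rw [weightMeasure, restrict_withDensity measurableSet_disc,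
    Measure.restrict_restrict measurableSet_disc, inter_self, radialMeasure, h1,
    withDensity_indicator measurableSet_disc]
  refine withDensity_congr_ae ?_
  have hae := hω.integrable.aestronglyMeasurable.ae_eq_mk
  rw [EventuallyEq, ae_restrict_iff' measurableSet_Ico, ae_iff] at hae
  set N := toMeasurable volume {s | ¬(s ∈ Ico (0 : ℝ) 1 → ω s = ω' s)} with hN
  have hN0 := volume_norm_preimage_eq_zero (measurableSet_toMeasurable _ _)
    ((measure_toMeasurable _).trans hae)
  rw [EventuallyEq, ae_restrict_iff' measurableSet_disc]
  filter_upwards [measure_eq_zero_iff_ae_notMem.1 hN0] with z hz hzd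
  have : ¬¬(‖z‖ ∈ Ico (0 : ℝ) 1 → ω ‖z‖ = ω' ‖z‖) := fun h => hz (subset_toMeasurable _ _ h)
  rw [not_not.1 this ⟨norm_nonneg z, mem_ball_zero_iff.1 hzd⟩]

theorem setLIntegral_borelProfile {ω : ℝ → ℝ} (hω : IsRadialWeight ω) {r t : ℝ} (hr : 0 ≤ r)
    (hrt : r ≤ t) (ht : t ≤ 1) :
    ∫⁻ s in Ico r t, borelProfile hω s = ENNReal.ofReal (∫ s in r..t, ω s) := by
  have hsub : Ico r t ⊆ Ico (0 : ℝ) 1 := fun s hs => ⟨hr.trans hs.1, hs.2.trans_le ht⟩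
  rw [intervalIntegral.integral_of_le hrt, integral_Ioc_eq_integral_Ioo,
    ← integral_Ico_eq_integral_Ioo, ofReal_integral_eq_lintegral_ofReal (hω.integrable.mono_set hsub)
    ((ae_restrict_iff' measurableSet_Ico).2 (ae_of_all _ fun s hs => hω.nonneg s (hsub hs)))]
  refine lintegral_congr_ae ?_
  have hae := ae_restrict_of_ae_restrict_of_subset hsub hω.integrable.aestronglyMeasurable.ae_eq_mk
  filter_upwards [hae, ae_restrict_mem measurableSet_Ico] with s hs hmem
  rw [borelProfile, indicator_of_mem (hsub hmem), ← hs]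

theorem tailMass_borelProfile {ω : ℝ → ℝ} (hω : IsRadialWeight ω) {r : ℝ}
    (hr : r ∈ Ico (0 : ℝ) 1) : tailMass (borelProfile hω) r = ENNReal.ofReal (tail ω r) := by
  rw [tail, ← setLIntegral_borelProfile hω hr.1 hr.2.le le_rfl, tailMass,
    ← lintegral_indicator measurableSet_Ici, ← lintegral_indicator measurableSet_Ico]
  refine lintegral_congr fun s => ?_
  by_cases h1 : s < 1
  · simp [indicator, h1]
  · simp [indicator, borelProfile, h1]

theorem tailMass_borelProfile_of_nonpos {ω : ℝ → ℝ} (hω : IsRadialWeight ω) {r : ℝ} (hr : r ≤ 0) :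
    tailMass (borelProfile hω) r = tailMass (borelProfile hω) 0 := by
  rw [tailMass, tailMass, ← lintegral_indicator measurableSet_Ici,
    ← lintegral_indicator measurableSet_Ici]
  refine lintegral_congr fun s => ?_
  by_cases h1 : 0 ≤ s
  · simp [indicator, h1, hr.trans h1]
  · simp [indicator, borelProfile, h1]

theorem UpperDoubling.exists_isProfile {ω : ℝ → ℝ} (hω : UpperDoubling ω) :
    ∃ D, IsProfile (borelProfile hω.1) D := by
  obtain ⟨C, hC1, hC⟩ := hω.2
  have hdoub : ∀ r ∈ Ico (0 : ℝ) 1, tailMass (borelProfile hω.1) r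
      ≤ ENNReal.ofReal C * tailMass (borelProfile hω.1) ((1 + r) / 2) := fun r hr => by
    rw [tailMass_borelProfile hω.1 hr, tailMass_borelProfile hω.1
      ⟨by linarith [hr.1], by linarith [hr.2]⟩, ← ENNReal.ofReal_mul (by linarith)]
    exact ENNReal.ofReal_le_ofReal (hC r hr)
  refine ⟨ENNReal.ofReal C, measurable_borelProfile hω.1, fun r hr => indicator_of_notMem hr _,
    ENNReal.ofReal_ne_top, ?_, fun r hr => ?_, fun r hr => ?_⟩
  · rw [tailMass_borelProfile hω.1 ⟨le_rfl, one_pos⟩]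
    exact ENNReal.ofReal_ne_top
  · rcases le_total 0 r with h | h
    · rw [tailMass_borelProfile hω.1 ⟨h, hr⟩]
      simpa using hω.1.tail_pos r ⟨h, hr⟩
    · rw [tailMass_borelProfile_of_nonpos hω.1 h, tailMass_borelProfile hω.1 ⟨le_rfl, one_pos⟩]
      simpa using hω.1.tail_pos 0 ⟨le_rfl, one_pos⟩
  -- Iterated doubling reaches negative radii, where the tail is constant; the condition there
  -- follows from the one at 0 and monotonicity.
  · rcases le_total 0 r with h | h
    · exact hdoub r ⟨h, hr⟩
    · rw [tailMass_borelProfile_of_nonpos hω.1 h]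
      refine (hdoub 0 ⟨le_rfl, one_pos⟩).trans ?_
      gcongr
      exact tailMass_antitone _ (by linarith)

/-- Lower doubling says that a fixed fraction 1 - 1/C of the tail lies between r and 1 - (1-r)/K.
Enlarging K to a power of 2 only enlarges this interval and aligns it with dyadic radii; c =
C/(C-1). -/
theorem LowerDoubling.exists_tailMass_le {ω : ℝ → ℝ} (hω : LowerDoubling ω) :
    ∃ (N : ℕ) (c : ℝ≥0∞), c ≠ ⊤ ∧ ∀ r ∈ Ico (0 : ℝ) 1,
      tailMass (borelProfile hω.1) r ≤
        c * ∫⁻ s in Ico r (1 - (1 - r) / 2 ^ N), borelProfile hω.1 s := by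
  obtain ⟨K, C, hK, hC, h⟩ := hω.2
  obtain ⟨N, hN⟩ := pow_unbounded_of_one_lt K one_lt_two
  refine ⟨N, ENNReal.ofReal (C / (C - 1)), ENNReal.ofReal_ne_top, fun r hr => ?_⟩
  have hr1 : 0 < 1 - r := by linarith [hr.2]
  have h2N : (1 : ℝ) ≤ 2 ^ N := one_le_pow₀ (by norm_num)
  set t := 1 - (1 - r) / 2 ^ N with ht
  set t' := 1 - (1 - r) / K with ht'
  have hrt : r ≤ t := by
    have : (1 - r) / 2 ^ N ≤ 1 - r := div_le_self hr1.le h2N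
    linarith
  have hrt' : r ≤ t' := by
    have : (1 - r) / K ≤ 1 - r := div_le_self hr1.le hK.le
    linarith
  have htt' : t' ≤ t := by
    have : (1 - r) / 2 ^ N ≤ (1 - r) / K := by gcongr
    linarith
  have ht1 : t ≤ 1 := by
    have : 0 ≤ (1 - r) / 2 ^ N := by positivity
    linarith
  have hint : ∀ x y : ℝ, 0 ≤ x → x ≤ y → y ≤ 1 → IntervalIntegrable ω volume x y := by
    intro x y hx hxy hy
    rw [intervalIntegrable_iff_integrableOn_Ico_of_le hxy]
    exact hω.1.integrable.mono_set fun s hs => ⟨hx.trans hs.1, hs.2.trans_le hy⟩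
  have hr0 := hr.1
  have hadd : (∫ s in r..t', ω s) + tail ω t' = tail ω r :=
    intervalIntegral.integral_add_adjacent_intervals (hint r t' hr0 hrt' (htt'.trans ht1))
      (hint t' 1 (hr0.trans hrt') (htt'.trans ht1) le_rfl)
  have hadd' : (∫ s in r..t', ω s) + (∫ s in t'..t, ω s) = ∫ s in r..t, ω s :=
    intervalIntegral.integral_add_adjacent_intervals (hint r t' hr0 hrt' (htt'.trans ht1))
      (hint t' t (hr0.trans hrt') htt' ht1)
  have hnn : 0 ≤ ∫ s in t'..t, ω s := by
    rw [intervalIntegral.integral_of_le htt', integral_Ioc_eq_integral_Ioo]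
    exact setIntegral_nonneg measurableSet_Ioo fun s hs =>
      hω.1.nonneg s ⟨by linarith [hs.1], by linarith [hs.2]⟩
  have hmain := h r hr
  rw [tailMass_borelProfile hω.1 hr, setLIntegral_borelProfile hω.1 hr0 hrt ht1,
    ← ENNReal.ofReal_mul (div_nonneg (by linarith) (by linarith))]
  refine ENNReal.ofReal_le_ofReal ?_
  rw [div_mul_eq_mul_div, le_div_iff₀ (by linarith)]
  nlinarith

/-! ### Conclusion -/

theorem continuousOn_delta {φ ψ : ℂ → ℂ} (hφ : IsAnalyticSelfMap φ) (hψ : IsAnalyticSelfMap ψ) :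
    ContinuousOn (delta φ ψ) disc := by
  refine ContinuousOn.div (hψ.1.continuousOn.sub hφ.1.continuousOn)
    (continuousOn_const.sub ((Complex.continuous_conj.comp_continuousOn hψ.1.continuousOn).mul
      hφ.1.continuousOn)) fun z hz => ?_
  exact one_sub_conj_mul_ne_zero (mem_ball_zero_iff.1 (hψ.2 hz)) (mem_ball_zero_iff.1 (hφ.2 hz)).le

theorem norm_delta_comm (φ ψ : ℂ → ℂ) (z : ℂ) : ‖delta φ ψ z‖ = ‖delta ψ φ z‖ := by
  rw [delta, delta, norm_div, norm_div, norm_sub_rev, norm_one_sub_conj_mul_comm]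

theorem IsBoundedOperator.neg {p q : ℝ} {ω : ℝ → ℝ} {ν : Measure ℂ} {T : (ℂ → ℂ) → (ℂ → ℂ)}
    (hT : IsBoundedOperator p q ω ν T) : IsBoundedOperator p q ω ν (-T) := by
  refine ⟨fun f hf => MemLp.neg (hT.1 f hf), hT.2.imp fun C hC f hf => ?_⟩
  rw [Pi.neg_apply, lpNorm, eLpNorm_neg]
  exact hC f hf

theorem IsCompactOp.neg {p q : ℝ} {ω : ℝ → ℝ} {ν : Measure ℂ} {T : (ℂ → ℂ) → (ℂ → ℂ)}
    (hT : IsCompactOp p q ω ν T) : IsCompactOp p q ω ν (-T) := by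
  refine ⟨fun f hf => MemLp.neg (hT.1 f hf), fun f hf hM => ?_⟩
  obtain ⟨g, k, hg, hk, hlim⟩ := hT.2 f hf hM
  refine ⟨-g, k, MemLp.neg hg, hk, hlim.congr fun n => ?_⟩
  rw [Pi.neg_apply, neg_sub_neg, ← neg_sub, lpNorm, lpNorm, eLpNorm_neg]

/-- The Carleson embedding for the weights of the theorem. -/
theorem exists_profile_carlesonEmbedding {p q : ℝ} (hp : 0 < p) {ω : ℝ → ℝ}
    (hω : (p < q ∧ UpperDoubling ω) ∨ (p = q ∧ Doubling ω)) :
    ∃ (w : ℝ → ℝ≥0∞) (D K : ℝ≥0∞), IsProfile w D ∧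
      (weightMeasure ω).restrict disc = radialMeasure w ∧ K ≠ ⊤ ∧ HasCarlesonEmbedding w p q K := by
  rcases hω with ⟨hpq, hω⟩ | ⟨rfl, hω⟩
  · obtain ⟨D, hD⟩ := hω.exists_isProfile
    obtain ⟨K, hK, hemb⟩ := hD.exists_hasCarlesonEmbedding_of_lt hp hpq
    exact ⟨_, D, K, hD, weightMeasure_restrict_disc hω.1, hK, hemb⟩
  · obtain ⟨D, hD⟩ := hω.1.exists_isProfile
    obtain ⟨N, c, hc, hlow⟩ := hω.2.exists_tailMass_le
    obtain ⟨K, hK, hemb⟩ := hD.exists_hasCarlesonEmbedding_of_lower hc hlow hp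
    exact ⟨_, D, K, hD, weightMeasure_restrict_disc hω.1.1, hK, hemb⟩

theorem exists_nat_le_mul {p : ℝ} (hp : 0 < p) (x : ℝ) : ∃ γ : ℕ, x ≤ γ * p := by
  obtain ⟨γ, hγ⟩ := exists_nat_ge (x / p)
  exact ⟨γ, (div_le_iff₀ hp).1 hγ⟩

theorem pullMeasure_nearRegion_le_of_testEnergy_le {p q : ℝ} (hq : 0 < q)
    {ν : Measure ℂ} {u φ ψ : ℂ → ℂ} (hu : ContinuousOn u disc)
    (hud : ∀ z ∈ disc, ‖u z‖ = ‖delta φ ψ z‖) (hφ : IsAnalyticSelfMap φ)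
    (hψ : IsAnalyticSelfMap ψ) {γ : ℕ} {a : ℂ} (ha : ‖a‖ < 1) {κ : ℝ≥0∞}
    (hκ : testEnergy q ν φ ψ γ a ≤ κ * boxMass w a ^ (q / p)) :
    pullMeasure q ν u φ (nearRegion a) ≤ (120 * 4 ^ γ) ^ q * κ * boxMass w a ^ (q / p) := by
  refine (pullMeasure_nearRegion_le hq hu hud hφ hψ γ ha).trans ?_
  rw [mul_assoc]
  exact mul_le_mul_right hκ _

/-- Boundedness of the difference of composition operators implies a Carleson condition. -/
theorem exists_pullMeasure_le (hw : IsProfile w D) {p q : ℝ} (hp : 0 < p) (hq : 0 < q)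
    {ω : ℝ → ℝ} (hω : (weightMeasure ω).restrict disc = radialMeasure w) {ν : Measure ℂ}
    {u φ ψ : ℂ → ℂ} (hu : ContinuousOn u disc) (hud : ∀ z ∈ disc, ‖u z‖ = ‖delta φ ψ z‖)
    (hφ : IsAnalyticSelfMap φ) (hψ : IsAnalyticSelfMap ψ)
    (hT : IsBoundedOperator p q ω ν (compOp φ - compOp ψ)) :
    ∃ κ : ℝ≥0∞, κ ≠ 0 ∧ κ ≠ ⊤ ∧ ∀ a : ℂ, ‖a‖ < 1 →
      pullMeasure q ν u φ (nearRegion a) ≤ κ * boxMass w a ^ (q / p) := by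
  obtain ⟨N, hN⟩ := hw.exists_two_pow
  obtain ⟨γ, hγ⟩ := exists_nat_le_mul hp ((N : ℝ) + 2)
  obtain ⟨κ, hκt, hκ⟩ := exists_testEnergy_le hw hN hp hq hγ hω hT
  have hc : ((120 : ℝ≥0∞) * 4 ^ γ) ^ q ≠ ⊤ := ENNReal.rpow_ne_top_of_nonneg hq.le (by finiteness)
  refine ⟨(120 * 4 ^ γ) ^ q * κ + 1, by simp, by finiteness, fun a ha => ?_⟩
  refine (pullMeasure_nearRegion_le_of_testEnergy_le hq hu hud hφ hψ ha (hκ a ha)).trans ?_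
  exact mul_le_mul_left le_self_add _

theorem isBoundedOperator_of_compOp_sub {p q : ℝ} (hp : 0 < p) {ω : ℝ → ℝ}
    (hω : (p < q ∧ UpperDoubling ω) ∨ (p = q ∧ Doubling ω)) {ν : Measure ℂ} {u φ ψ : ℂ → ℂ}
    (hu : ContinuousOn u disc) (hud : ∀ z ∈ disc, ‖u z‖ = ‖delta φ ψ z‖)
    (hφ : IsAnalyticSelfMap φ) (hψ : IsAnalyticSelfMap ψ)
    (hT : IsBoundedOperator p q ω ν (compOp φ - compOp ψ)) :
    IsBoundedOperator p q ω ν (weightedCompOp u φ) := by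
  have hq : 0 < q := by rcases hω with h | h <;> linarith [h.1]
  obtain ⟨w, D, K, hw, hωw, hK, hemb⟩ := exists_profile_carlesonEmbedding hp hω
  obtain ⟨κ, hκ0, hκt, hκ⟩ := exists_pullMeasure_le hw hp hq hωw hu hud hφ hψ hT
  exact isBoundedOperator_weightedCompOp hw hp hq hK hemb hωw hu hφ hκ0 hκt hκ

theorem isCompactOp_of_compOp_sub {p q : ℝ} (hp : 0 < p) {ω : ℝ → ℝ}
    (hω : (p < q ∧ UpperDoubling ω) ∨ (p = q ∧ Doubling ω)) {ν : Measure ℂ} {u φ ψ : ℂ → ℂ}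
    (hu : ContinuousOn u disc) (hud : ∀ z ∈ disc, ‖u z‖ = ‖delta φ ψ z‖)
    (hφ : IsAnalyticSelfMap φ) (hψ : IsAnalyticSelfMap ψ)
    (hT : IsCompactOp p q ω ν (compOp φ - compOp ψ)) :
    IsCompactOp p q ω ν (weightedCompOp u φ) := by
  have hq : 0 < q := by rcases hω with h | h <;> linarith [h.1]
  obtain ⟨w, D, K, hw, hωw, hK, hemb⟩ := exists_profile_carlesonEmbedding hp hω
  obtain ⟨κ, hκ0, hκt, hκ⟩ := exists_pullMeasure_le hw hp hq hωw hu hud hφ hψ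
    (hT.isBoundedOperator (compOp_sub_smul φ ψ))
  refine isCompactOp_weightedCompOp hw hp hq hK hemb hωw hu hφ hκ0 hκt hκ fun ε hε => ?_
  obtain ⟨N, hN⟩ := hw.exists_two_pow
  obtain ⟨γ, hγ⟩ := exists_nat_le_mul hp ((N : ℝ) + 2)
  have hc : ((120 : ℝ≥0∞) * 4 ^ γ) ^ q ≠ ⊤ := ENNReal.rpow_ne_top_of_nonneg hq.le (by finiteness)
  have hc0 : ((120 : ℝ≥0∞) * 4 ^ γ) ^ q ≠ 0 := by
    rw [Ne, ENNReal.rpow_eq_zero_iff_of_pos hq]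
    simp
  obtain ⟨R, hR1, hR⟩ := exists_testEnergy_le_of_isCompactOp hw hN hp hq hγ hωw hφ hψ hT
    (ENNReal.div_ne_zero.2 ⟨hε, hc⟩)
  refine ⟨R, hR1, fun a ha ha1 => ?_⟩
  refine (pullMeasure_nearRegion_le_of_testEnergy_le hq hu hud hφ hψ ha1 (hR a ha ha1)).trans ?_
  rw [ENNReal.mul_div_cancel hc0 hc]

end WeightedBergman

end

theorem mainTheorem5 (p q : ℝ) (ω : ℝ → ℝ) (ν : MeasureTheory.Measure ℂ) (φ ψ : ℂ → ℂ)
    (hp : 0 < p)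
    (hω : (p < q ∧ WeightedBergman.UpperDoubling ω) ∨ (p = q ∧ WeightedBergman.Doubling ω))
    (hφ : WeightedBergman.IsAnalyticSelfMap φ) (hψ : WeightedBergman.IsAnalyticSelfMap ψ) :
    (WeightedBergman.IsBoundedOperator p q ω ν
        (WeightedBergman.compOp φ - WeightedBergman.compOp ψ) →
      WeightedBergman.IsBoundedOperator p q ω ν
          (WeightedBergman.weightedCompOp (WeightedBergman.delta φ ψ) φ) ∧
        WeightedBergman.IsBoundedOperator p q ω ν
          (WeightedBergman.weightedCompOp (WeightedBergman.delta φ ψ) ψ)) ∧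
    (WeightedBergman.IsCompactOp p q ω ν
        (WeightedBergman.compOp φ - WeightedBergman.compOp ψ) →
      WeightedBergman.IsCompactOp p q ω ν
          (WeightedBergman.weightedCompOp (WeightedBergman.delta φ ψ) φ) ∧
        WeightedBergman.IsCompactOp p q ω ν
          (WeightedBergman.weightedCompOp (WeightedBergman.delta φ ψ) ψ)) := by
  have hu := WeightedBergman.continuousOn_delta hφ hψ
  have hcomm := fun z (_ : z ∈ WeightedBergman.disc) => WeightedBergman.norm_delta_comm φ ψ z
  have hneg : WeightedBergman.compOp ψ - WeightedBergman.compOp φ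
      = -(WeightedBergman.compOp φ - WeightedBergman.compOp ψ) := (neg_sub _ _).symm
  refine ⟨fun hT => ⟨?_, ?_⟩, fun hT => ⟨?_, ?_⟩⟩
  · exact WeightedBergman.isBoundedOperator_of_compOp_sub hp hω hu (fun _ _ => rfl) hφ hψ hT
  -- Exchanging φ and ψ changes the sign of the difference operator, which is harmless, and replaces
  -- δ by a function of the same modulus.
  · exact WeightedBergman.isBoundedOperator_of_compOp_sub hp hω hu hcomm hψ hφ (hneg ▸ hT.neg)
  · exact WeightedBergman.isCompactOp_of_compOp_sub hp hω hu (fun _ _ => rfl) hφ hψ hT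
  · exact WeightedBergman.isCompactOp_of_compOp_sub hp hω hu hcomm hψ hφ (hneg ▸ hT.neg)
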